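/- Let $R$ be a reduced irreducible (crystallographic) root system in a real vector space $\mathfrak h_{\mathbb R}$ with inner product $\langle\cdot,\cdot\rangle$, with simple roots $\alpha_1,\dots,\alpha_n$, positive roots $R^+$, coroots $\alpha^\vee=2\alpha/\langle\alpha,\alpha\rangle$, highest root $\theta$, $\rho=\frac12\sum_{\alpha\in R^+}\alpha$, Weyl group $W_0$ with longest element $w_0$, coweight lattice $P=\{\mu:\langle\mu,\alpha_i\rangle\in\mathbb Z \text{ for all } i\}$ and dominant coweights $P^+=\{\mu:\langle\mu,\alpha_i\rangle\in\mathbb Z_{\ge0}\text{ for all } i\}$. Let $Q^+=\sum_i\mathbb Z_{\ge0}\alpha_i^\vee$ and, for $\lambda\in P^+$, let $\Pi_\lambda=\bigcap_{w\in W_0}w(\lambda-Q^+)$. For $\alpha\in R$, $k\in\mathbb Z$ let $H_{\alpha+k\delta}=\{x:\langle x,\alpha\rangle=-k\}$; for $\alpha\in R^+$ its positive (negative) side is $\langle x,\alpha\rangle\ge-k$ (resp. $\le -k$). Let $c_0=\{x:\langle x,\alpha_i\rangle>0\ (1\le i\le n),\ \langle x,\theta\rangle<1\}$, let $s_1,\dots,s_n$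 be the reflections in $H_{\alpha_1},\dots,H_{\alpha_n}$ and $s_0$ the reflection in $H_{-\theta+\delta}$, let $t_\mu$ be the translation by $\mu$, and let $\tilde W=P\rtimes W_0$. The length $\ell(w)$ of $w\in\tilde W$ is the number of hyperplanes $H_{\alpha+k\delta}$ separating $c_0$ from $wc_0$, and $\Omega=\{w\in\tilde W:\ell(w)=0\}$. A reduced expression $\vec w$ of $w\in\tilde W$ is $w=s_{i_1}\cdots s_{i_\ell}\gamma$ with $\gamma\in\Omega$, $\ell=\ell(w)$. A positively folded alcove walk of type $s_{i_1}\cdots s_{i_\ell}\gamma$ is a sequence of $\ell$ steps starting at $1$, where the $k$th step from the current element $x$, with $s=s_{i_k}$ and $H$ the hyperplane between $xc_0$ and $xsc_0$, is either a crossing $x\to xs$ of $H$ (positive if $xsc_0$ is on the positive side of $H$, negative otherwise), or a fold $x\to x$ on $H$, allowed only if $xc_0$ is on the positive side of $H$; if the steps lead to $v$, then the walk ends at $v\gamma\in\tilde W$. Its dimension $\dim(p)$ is the number of positive crossings plus the number of folds. Let $\lambda\in P^+$ and $\mu\in P$. Fix a reduced expression $\vec m_\lambda$ of the minimal length element $m_\lambda$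 of $W_0t_\lambda W_0$, and a reduced expression $\vec u$ of each $u\in W_0^\lambda$, where $W_0^\lambda$ is the set of minimal length representatives of the cosets in $W_0/W_{0\lambda}$, $W_{0\lambda}$ being the stabilizer of $\lambda$ in $W_0$. For $\nu\in P$ let $\mathcal P(\vec\lambda)_\nu$ be the set of positively folded alcove walks of the types $\vec u\cdot\vec m_\lambda$ (concatenation), $u\in W_0^\lambda$, that end in $t_\nu W_0$. For $1\le i\le n$ the root operator $\tilde e_i$ is defined on positively folded alcove walks $p$ as follows. If $p$ has no negative crossing on a hyperplane $H_{\alpha_i+k\delta}$, $k\in\mathbb Z$, then $\tilde e_i(p)=0$. Otherwise let $k$ be maximal such that $p$ has a negative crossing on $H_\gamma$, $\gamma=\alpha_i+k\delta$. Then $\tilde e_i(p)$ is the walk of the same type in which the first negative crossing on $H_\gamma$ is replaced by a fold, and in which moreover the first later step that is in $p$ a fold on $H_{\gamma+\delta}$ or a positive crossing on $H_\gamma$, if there is one, is changed from a fold to a crossing or from a crossing to a fold, respectively. Put $\tilde e_i(0)=0$. Then the following hold. (1) If $\mu\notin\Pi_\lambda$, then $\mathcal P(\vec\lambda)_\mu=\emptyset$.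 (2) If $\mu\in\Pi_\lambda$, then there is a walk $p\in\mathcal P(\vec\lambda)_\mu$ with $\dim(p)=\langle\lambda+\mu,\rho\rangle$. (3) The set $\mathcal P(\vec\lambda)_{w_0\lambda}$ has exactly one element $p_{w_0\lambda}$. If $\mu\in\Pi_\lambda$ and $w_0=s_{i_1}\cdots s_{i_N}$ is any reduced decomposition, put $\mu_0=\mu$ and, for $1\le k\le N$, $m_k=\max\{m\in\mathbb Z_{\ge0}:\mu_{k-1}-m\alpha_{i_k}^\vee\in\Pi_\lambda\}$ and $\mu_k=\mu_{k-1}-m_k\alpha_{i_k}^\vee$. Then $p=\tilde e_{i_1}^{m_1}\cdots\tilde e_{i_N}^{m_N}(p_{w_0\lambda})$ is nonzero, lies in $\mathcal P(\vec\lambda)_\mu$, and has $\dim(p)=\langle\lambda+\mu,\rho\rangle$. (4) Consequently $\mathcal P(\vec\lambda)_\mu\neq\emptyset$ if and only if $\mu\in\Pi_\lambda$. -/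

import Mathlib

/-!
Positively folded alcove walks for a reduced irreducible crystallographic root system.

The root system is a root system `Φ : RootPairing ι ℝ M N`: the space in which coweights, coroots
and alcoves live is `N`, the roots are linear forms on `N`, and `⟨x, α⟩` is the evaluation of the
root `α` at `x : N`. An affine root `α + kδ` is given by an index `a : ι` and an integer `k`.
-/

noncomputable section

namespace AlcoveWalks

variable {ι M N : Type*} [AddCommGroup M] [Module ℝ M] [AddCommGroup N] [Module ℝ N]
  {Φ : RootPairing ι ℝ M N}

/-- The value `⟨x, α + kδ⟩ = ⟨x, α⟩ + k` of the affine root `α + kδ` at the point `x`. -/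
def affRoot (Φ : RootPairing ι ℝ M N) (a : ι) (k : ℤ) (x : N) : ℝ :=
  Φ.toLinearMap (Φ.root a) x + k

/-- The translation `t_μ`. -/
def trans (μ : N) : N ≃ᵃ[ℝ] N := AffineEquiv.constVAdd ℝ N μ

/-- The reflection `s_{α + kδ}`, namely `t_{-kα^∨} s_α`; see `affRefl_apply`. -/
def affRefl (Φ : RootPairing ι ℝ M N) (a : ι) (k : ℤ) : N ≃ᵃ[ℝ] N :=
  trans (-(k : ℝ) • Φ.coroot a) * (Φ.coreflection a).toAffineEquiv

theorem affRefl_apply (Φ : RootPairing ι ℝ M N) (a : ι) (k : ℤ) (x : N) :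
    affRefl Φ a k x = x - affRoot Φ a k x • Φ.coroot a := by
  simp [affRefl, affRoot, trans, RootPairing.coreflection_apply, add_smul, sub_eq_add_neg,
    add_comm, add_left_comm]

/-- The Weyl group `W₀`, as a group of affine transformations fixing the origin. -/
def weyl (Φ : RootPairing ι ℝ M N) : Subgroup (N ≃ᵃ[ℝ] N) :=
  Subgroup.closure (Set.range fun a => affRefl Φ a 0)

/-- The coweight lattice: the points at which all simple roots are integral. -/
def IsCoweight (b : Φ.Base) (μ : N) : Prop :=
  ∀ i ∈ b.support, ∃ z : ℤ, Φ.toLinearMap (Φ.root i) μ = z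

/-- The dominant coweights. -/
def IsDominant (b : Φ.Base) (μ : N) : Prop :=
  ∀ i ∈ b.support, ∃ z : ℕ, Φ.toLinearMap (Φ.root i) μ = z

/-- `ω` is the fundamental coweight dual to the simple root with index `i`. -/
def IsFundamental (b : Φ.Base) (i : ι) (ω : N) : Prop :=
  Φ.toLinearMap (Φ.root i) ω = 1 ∧
    ∀ j ∈ b.support, j ≠ i → Φ.toLinearMap (Φ.root j) ω = 0

/-- `θ` is the (index of the) highest root. -/
def IsHighestRoot (b : Φ.Base) (θ : ι) : Prop :=
  ∀ i ∈ b.support, ∀ ω, IsFundamental b i ω →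
    ∀ a, Φ.toLinearMap (Φ.root a) ω ≤ Φ.toLinearMap (Φ.root θ) ω

/-- `ρ`, half the sum of the positive roots. -/
def rho [Fintype ι] (b : Φ.Base) : M :=
  open Classical in (1 / 2 : ℝ) • ∑ a with b.IsPos a, Φ.root a

/-- `Q⁺`, the nonnegative integer combinations of the simple coroots. -/
def corootCone (b : Φ.Base) : AddSubmonoid N :=
  AddSubmonoid.closure (Φ.coroot '' b.support)

/-- The saturated set `Π_λ`, the intersection over `w ∈ W₀` of the sets `w(λ - Q⁺)`. -/
def saturatedSet (b : Φ.Base) (lam : N) : Set N :=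
  ⋂ w ∈ weyl Φ, (fun q => w (lam - q)) '' (corootCone b : Set N)

/-! ### Alcoves, hyperplanes and lengths -/

/-- The fundamental alcove `c₀`; the last condition is positivity of `α₀ = -θ + δ`. -/
def fundAlcove (b : Φ.Base) (θ : ι) : Set N :=
  {x | (∀ i ∈ b.support, 0 < affRoot Φ i 0 x) ∧ 0 < -Φ.toLinearMap (Φ.root θ) x + 1}

/-- The alcove `x c₀` lies in the half space `⟨·, α + kδ⟩ ≥ 0`
(the positive side of the hyperplane if `α` is a positive root). -/
def OnPos (b : Φ.Base) (θ : ι) (x : N ≃ᵃ[ℝ] N) (a : ι) (k : ℤ) : Prop :=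
  ∀ v ∈ x '' fundAlcove b θ, 0 ≤ affRoot Φ a k v

/-- The alcove `x c₀` lies in the half space `⟨·, α + kδ⟩ ≤ 0`
(the negative side of the hyperplane if `α` is a positive root). -/
def OnNeg (b : Φ.Base) (θ : ι) (x : N ≃ᵃ[ℝ] N) (a : ι) (k : ℤ) : Prop :=
  ∀ v ∈ x '' fundAlcove b θ, affRoot Φ a k v ≤ 0

/-- The extended affine Weyl group `P ⋊ W₀`, as the set of all `t_μ w`. -/
def extAffWeyl (b : Φ.Base) : Set (N ≃ᵃ[ℝ] N) :=
  {x | ∃ μ, IsCoweight b μ ∧ ∃ w ∈ weyl Φ, x = trans μ * w}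

/-- The length of `w`: the number of hyperplanes separating `c₀` from `w c₀`. Each hyperplane
`H_{α + kδ}` is counted once, as the pair `(α, k)` with `α` positive. -/
def len (b : Φ.Base) (θ : ι) (w : N ≃ᵃ[ℝ] N) : ℕ :=
  {h : ι × ℤ | b.IsPos h.1 ∧
    ((OnPos b θ 1 h.1 h.2 ∧ OnNeg b θ w h.1 h.2) ∨
      (OnNeg b θ 1 h.1 h.2 ∧ OnPos b θ w h.1 h.2))}.ncard

/-- `Ω`, the elements of length zero of the extended affine Weyl group. -/
def lengthZero (b : Φ.Base) (θ : ι) : Set (N ≃ᵃ[ℝ] N) :=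
  {γ | γ ∈ extAffWeyl b ∧ len b θ γ = 0}

/-- The Coxeter generators of the affine Weyl group: `some i` is `s_i` for the simple root with
index `i`, and `none` is `s₀ = s_{-θ + δ} = s_{θ - δ}`. -/
def gen (b : Φ.Base) (θ : ι) : Option b.support → N ≃ᵃ[ℝ] N
  | some i => affRefl Φ i 0
  | none => affRefl Φ θ (-1)

/-- `s_{i₁} ⋯ s_{i_ℓ} γ` is a reduced expression for `w`, with `γ ∈ Ω`. -/
def IsReducedExpr (b : Φ.Base) (θ : ι) (word : List (Option b.support)) (γ w : N ≃ᵃ[ℝ] N) : Prop :=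
  γ ∈ lengthZero b θ ∧ (word.map (gen b θ)).prod * γ = w ∧ word.length = len b θ w

/-- `w₀` is the longest element of `W₀`. -/
def IsLongest (b : Φ.Base) (θ : ι) (w₀ : N ≃ᵃ[ℝ] N) : Prop :=
  w₀ ∈ weyl Φ ∧ ∀ w ∈ weyl Φ, len b θ w ≤ len b θ w₀

/-- `w = s_{i₁} ⋯ s_{i_N}` is a reduced decomposition in the simple reflections of `W₀`. -/
def IsReducedWord (b : Φ.Base) (θ : ι) (word : List b.support) (w : N ≃ᵃ[ℝ] N) : Prop :=
  (word.map fun i => affRefl Φ i 0).prod = w ∧ word.length = len b θ w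

/-- The double coset `W₀ t_λ W₀`. -/
def doubleCoset (Φ : RootPairing ι ℝ M N) (lam : N) : Set (N ≃ᵃ[ℝ] N) :=
  {x | ∃ v ∈ weyl Φ, ∃ w ∈ weyl Φ, x = v * trans lam * w}

/-- `m` is an element of minimal length of `W₀ t_λ W₀`. -/
def IsMinimalIn (b : Φ.Base) (θ : ι) (lam : N) (m : N ≃ᵃ[ℝ] N) : Prop :=
  m ∈ doubleCoset Φ lam ∧ ∀ x ∈ doubleCoset Φ lam, len b θ m ≤ len b θ x

/-- `W₀^λ`: the minimal length representatives of the cosets `u W_{0λ}` in `W₀`, where `W_{0λ}` is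
the stabilizer of `λ` in `W₀`. -/
def minReps (b : Φ.Base) (θ : ι) (lam : N) : Set (N ≃ᵃ[ℝ] N) :=
  {u | u ∈ weyl Φ ∧ ∀ v ∈ weyl Φ, v lam = lam → len b θ u ≤ len b θ (u * v)}

/-! ### Alcove walks -/

/-- At each step a walk crosses the wall of the given type or is folded back at it. -/
inductive Move
  | cross
  | fold

/-- The exchange of crossings and folds. -/
def Move.toggle : Move → Move
  | .cross => .fold
  | .fold => .cross

/-- A (folded) alcove walk starting at `1`: the list of its steps, each given by the type of the
wall it meets there and by what it does, and the sheet `γ` to which it jumps at the end. -/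
structure Walk (b : Φ.Base) where
  steps : List (Option b.support × Move)
  sheet : N ≃ᵃ[ℝ] N

namespace Walk

variable {b : Φ.Base} (θ : ι) (p : Walk b)

/-- The alcove reached after the first `k` steps: a crossing of type `s` leads from `x` to `xs`,
a fold stays at `x`. -/
def pos (k : ℕ) : N ≃ᵃ[ℝ] N :=
  ((p.steps.take k).map fun st => match st.2 with
    | .cross => gen b θ st.1
    | .fold => 1).prod

/-- The end alcove in the extended affine Weyl group. -/
def endAlcove : N ≃ᵃ[ℝ] N := p.pos θ p.steps.length * p.sheet

/-- The step with number `k` (counted from `0`) crosses `H_{α + jδ}` from the negative to the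
positive side (where `α` is positive). -/
def PosCrossingOn (k : ℕ) (a : ι) (j : ℤ) : Prop :=
  ∃ s, p.steps[k]? = some (s, Move.cross) ∧
    OnNeg b θ (p.pos θ k) a j ∧ OnPos b θ (p.pos θ k * gen b θ s) a j

/-- The step with number `k` crosses `H_{α + jδ}` from the positive to the negative side. -/
def NegCrossingOn (k : ℕ) (a : ι) (j : ℤ) : Prop :=
  ∃ s, p.steps[k]? = some (s, Move.cross) ∧
    OnPos b θ (p.pos θ k) a j ∧ OnNeg b θ (p.pos θ k * gen b θ s) a j

/-- The step with number `k` is a positive fold on `H_{α + jδ}`: the walk is at an alcove `x` on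
the positive side, `xs` is on the negative side, and the walk stays at `x`. -/
def PosFoldOn (k : ℕ) (a : ι) (j : ℤ) : Prop :=
  ∃ s, p.steps[k]? = some (s, Move.fold) ∧
    OnPos b θ (p.pos θ k) a j ∧ OnNeg b θ (p.pos θ k * gen b θ s) a j

/-- All folds are positive. -/
def PositivelyFolded : Prop :=
  ∀ k s, p.steps[k]? = some (s, Move.fold) → ∃ a j, b.IsPos a ∧ p.PosFoldOn θ k a j

/-- The dimension: the number of positive crossings plus the number of folds. -/
def dim : ℕ :=
  {k : ℕ | ∃ a j, b.IsPos a ∧ p.PosCrossingOn θ k a j}.ncard +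
    {k : ℕ | ∃ s, p.steps[k]? = some (s, Move.fold)}.ncard

/-! ### Root operators -/

/-- `H_{α_i + jδ}` is the `i`-critical hyperplane of `p`, and step `k` is its `i`-critical
crossing: `j` is maximal such that `p` has a negative crossing on `H_{α_i + jδ}`, and the step
with number `k` is the first such crossing. -/
def IsCritical (i : ι) (k : ℕ) (j : ℤ) : Prop :=
  IsGreatest {j' : ℤ | ∃ k', p.NegCrossingOn θ k' i j'} j ∧
    IsLeast {k' : ℕ | p.NegCrossingOn θ k' i j} k

/-- After the critical crossing at step `k`, step `k'` is the first one that is a fold on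
`H_{α_i + (j+1)δ}` or a positive crossing on `H_{α_i + jδ}`. -/
def IsReturn (i : ι) (k : ℕ) (j : ℤ) (k' : ℕ) : Prop :=
  IsLeast {l : ℕ | k < l ∧ (p.PosFoldOn θ l i (j + 1) ∨ p.PosCrossingOn θ l i j)} k'

/-- Exchange crossing and fold at step `k`, keeping the type of the walk. The part of the walk
after that step is thereby reflected in the hyperplane met at that step. -/
def toggleAt (k : ℕ) : Walk b where
  steps := p.steps.modify k fun st => (st.1, st.2.toggle)
  sheet := p.sheet

open Classical in
/-- The raising operator `ẽ_i`, with `none` for the value `0`. The critical crossing on `H_γ`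
becomes a fold, so that the following part of the walk is reflected in `H_γ`. At the first later
fold on `H_{γ+δ}` or positive crossing on `H_γ`, if there is one, a fold becomes a positive
crossing (the rest of the walk is then translated by `α_i^∨`), and a positive crossing becomes a
fold (the rest of the walk is then unchanged). -/
def rootOp (i : ι) : Option (Walk b) :=
  if hc : ∃ c : ℕ × ℤ, p.IsCritical θ i c.1 c.2 then
    if hr : ∃ k', p.IsReturn θ i hc.choose.1 hc.choose.2 k' then
      some ((p.toggleAt hc.choose.1).toggleAt hr.choose)
    else some (p.toggleAt hc.choose.1)
  else none

end Walk

/-- The power `ẽ_i^m`, extended by `ẽ_i(0) = 0`. -/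
def rootOpPow {b : Φ.Base} (θ : ι) (i : ι) (m : ℕ) (p : Option (Walk b)) : Option (Walk b) :=
  (fun q : Option (Walk b) => q.bind fun r => r.rootOp θ i)^[m] p

/-- The largest `m ≥ 0` with `ν - m α_i^∨ ∈ Π_λ`. -/
def maxStep (b : Φ.Base) (lam ν : N) (i : ι) : ℕ :=
  sSup {m : ℕ | ν - m • Φ.coroot i ∈ saturatedSet b lam}

/-- For a word `i₁, …, i_N` the walk `ẽ_{i₁}^{m₁} ⋯ ẽ_{i_N}^{m_N}(p)`, where `μ₀ = μ`,
`m_k = maxStep` of `μ_{k-1}` in the direction `i_k`, and `μ_k = μ_{k-1} - m_k α_{i_k}^∨`. -/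
def stringWalk {b : Φ.Base} (θ : ι) (lam : N) (p : Walk b) : N → List b.support → Option (Walk b)
  | _, [] => some p
  | μ, i :: word => rootOpPow θ i (maxStep b lam μ i)
      (stringWalk θ lam p (μ - maxStep b lam μ i • Φ.coroot i) word)

/-- The set `𝒫(λ⃗)_μ` of positively folded alcove walks of the types `u⃗ · m⃗_λ`, `u ∈ W₀^λ`, with
end alcove in `t_μ W₀`. Here `m⃗_λ` is the word `mword` followed by `γ ∈ Ω`, and `u⃗` is `uword u`. -/
def walkSet (b : Φ.Base) (θ : ι) (lam : N) (mword : List (Option b.support)) (γ : N ≃ᵃ[ℝ] N)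
    (uword : (N ≃ᵃ[ℝ] N) → List (Option b.support)) (μ : N) : Set (Walk b) :=
  {p | p.PositivelyFolded θ ∧
    (∃ u ∈ minReps b θ lam, p.steps.map Prod.fst = uword u ++ mword ∧ p.sheet = γ) ∧
    ∃ w ∈ weyl Φ, p.endAlcove θ = trans μ * w}

end AlcoveWalks

end

/-! An alcove x c₀ is recorded by the integers `lvl b x a`: the root a takes values strictly between
`lvl` and `lvl + 1` on it. Crossing a wall changes these integers only at ± the root of that wall,
and by one, so separation, length and dimension become integer arithmetic.

End points. A folded walk of reduced type ends below its type in the Bruhat order. A reflection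
bringing an alcove closer to c₀ moves the image of the origin along a root string towards its linear
reflection, and Π_λ is closed under such moves (`BruhatLE.apply_zero_mem`). So walks can only end
over points of Π_λ.

Dimension. Counting steps by kind, 2 dim equals length plus number of folds plus `lvlSum` of the end
alcove (`Walk.two_mul_dim`). If the end is t_ν w, the last term is 2⟨ν,ρ⟩ minus the number of
positive roots made negative by w⁻¹. Each fold strictly increases that number (`Walk.folds_le`), and
the type u m_λ has length at most 2⟨λ,ρ⟩. Hence dim ≤ ⟨λ+ν,ρ⟩ (`dim_le_of_mem_walkSet`). For ν = w₀λ
the bound is 0, which forces a walk without folds and gives uniqueness.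

Raising. A root operator removes exactly one negative crossing from a walk of fixed length, so it
raises dim by one, and it moves the end ν by 0 or by α_i^∨. For a walk attaining the bound, 0 would
violate the bound; so the end moves by α_i^∨ and the bound is attained again. A walk reaching level
−n in direction α_i admits at least n such operations (`exists_rootOp_eq_some`).

Strings. It remains that the descent from μ along maximal strings ends at w₀λ (`descend_longest`).
Inductively, the k-th point is the only point of Π_λ in itself minus the cone spanned by the coroots
of the positive roots that s_{i₁}⋯s_{i_k} makes negative. For w₀ this cone is Q⁺, and w₀λ lies below
every point of Π_λ. -/

set_option linter.unusedSectionVars false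

/-! ### Roots as linear forms, positivity, highest root. -/

noncomputable section

namespace AlcoveWalks

variable {ι M N : Type*} [AddCommGroup M] [Module ℝ M] [AddCommGroup N] [Module ℝ N]
  {Φ : RootPairing ι ℝ M N}

/-! ### Roots as linear forms, and positivity -/

/-- The root with index `a`, as a linear form. -/
def ev (Φ : RootPairing ι ℝ M N) (a : ι) : N →ₗ[ℝ] ℝ := Φ.toLinearMap (Φ.root a)

/-- The index of the negative of a root. -/
def ng (Φ : RootPairing ι ℝ M N) (a : ι) : ι := Φ.reflectionPerm a a

/-- The integer `⟨c^∨, a⟩`. -/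
def pr (Φ : RootPairing ι ℝ M N) [Φ.IsCrystallographic] (a c : ι) : ℤ := Φ.pairingIn ℤ a c

theorem root_ng (a : ι) : Φ.root (ng Φ a) = -Φ.root a := by simp [ng]

theorem coroot_ng (a : ι) : Φ.coroot (ng Φ a) = -Φ.coroot a := by simp [ng]

theorem ng_ng (a : ι) : ng Φ (ng Φ a) = a :=
  Φ.root.injective (by rw [root_ng, root_ng, neg_neg])

theorem ng_injective : Function.Injective (ng Φ) :=
  Function.LeftInverse.injective (g := ng Φ) ng_ng

theorem eq_ng_iff {a c : ι} : a = ng Φ c ↔ ng Φ a = c :=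
  ⟨fun h => by rw [h, ng_ng], fun h => by rw [← h, ng_ng]⟩

theorem ev_ng (a : ι) (v : N) : ev Φ (ng Φ a) v = -ev Φ a v := by
  simp [ev, root_ng]

theorem ev_injective {a c : ι} (h : ∀ v, ev Φ a v = ev Φ c v) : a = c := by
  apply Φ.root.injective
  apply (LinearMap.IsPerfPair.bijective_left Φ.toLinearMap).1
  ext v
  exact h v

theorem ev_coroot [Φ.IsCrystallographic] (a c : ι) : ev Φ a (Φ.coroot c) = pr Φ a c := by
  have := Φ.algebraMap_pairingIn ℤ a c
  simp only [algebraMap_int_eq, eq_intCast] at this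
  simp [ev, pr, this]

theorem pr_self [Φ.IsCrystallographic] (a : ι) : pr Φ a a = 2 := by
  have := ev_coroot (Φ := Φ) a a
  simp only [ev, RootPairing.root_coroot_two] at this
  exact_mod_cast this.symm

theorem pr_ng_left [Φ.IsCrystallographic] (a c : ι) : pr Φ (ng Φ a) c = -pr Φ a c := by
  have := ev_coroot (Φ := Φ) (ng Φ a) c
  rw [ev_ng, ev_coroot] at this
  exact_mod_cast this.symm

theorem ev_reflectionPerm [Φ.IsCrystallographic] (c a : ι) (v : N) :
    ev Φ (Φ.reflectionPerm c a) v = ev Φ a v - pr Φ a c * ev Φ c v := by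
  rw [← ev_coroot]
  simp [ev, ← Φ.reflectionPerm_root]

theorem reflectionPerm_ng (c a : ι) :
    Φ.reflectionPerm c (ng Φ a) = ng Φ (Φ.reflectionPerm c a) := by
  apply Φ.root.injective
  rw [root_ng, ← Φ.reflectionPerm_root, ← Φ.reflectionPerm_root, root_ng]
  simp
  abel

theorem isPos_ng (b : Φ.Base) (a : ι) : b.IsPos (ng Φ a) ↔ ¬ b.IsPos a :=
  RootPairing.Base.IsPos.neg_iff_not b a

section Base

variable [Φ.IsRootSystem] (b : Φ.Base)

theorem exists_eval (f : b.support → ℝ) :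
    ∃ v : N, ∀ i : b.support, ev Φ i v = f i := by
  obtain ⟨v, hv⟩ := (LinearMap.IsPerfPair.bijective_right Φ.toLinearMap).2
    (b.toWeightBasis.constr ℝ f)
  refine ⟨v, fun i => ?_⟩
  have := LinearMap.congr_fun hv (Φ.root i)
  rw [← b.toWeightBasis_apply i, Module.Basis.constr_basis] at this
  rw [ev, ← b.toWeightBasis_apply i]
  exact this

theorem exists_coeff (a : ι) : ∃ f : ι → ℤ,
    (∀ v, ev Φ a v = ∑ j ∈ b.support, f j * ev Φ j v) ∧ b.height a = ∑ j ∈ b.support, f j ∧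
    (b.IsPos a → ∀ j, 0 ≤ f j) := by
  obtain ⟨f, hf₀, hf₁, hf₂⟩ := b.exists_root_eq_sum_int a
  refine ⟨f, fun v => ?_, RootPairing.Base.height_eq_sum hf₂, fun hpos j => ?_⟩
  · simp only [ev, hf₂, map_sum, LinearMap.coe_sum, Finset.sum_apply, map_zsmul,
      LinearMap.smul_apply, zsmul_eq_mul]
  · rcases hf₁ with h | h
    · exact h.le j
    · rw [RootPairing.Base.isPos_iff, RootPairing.Base.height_eq_sum hf₂] at hpos
      exact absurd hpos (not_lt.2 (Finset.sum_nonpos fun i _ => h.le i))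

theorem exists_height_vector : ∃ h : N, ∀ a, ev Φ a h = b.height a := by
  obtain ⟨h, hh⟩ := exists_eval b fun _ => 1
  refine ⟨h, fun a => ?_⟩
  obtain ⟨f, hf, hf', -⟩ := exists_coeff b a
  rw [hf, hf', Int.cast_sum]
  refine Finset.sum_congr rfl fun j hj => ?_
  rw [hh ⟨j, hj⟩, mul_one]

/-- A coweight at which every root takes its height as value. -/
def heightVector : N := (exists_height_vector b).choose

theorem ev_heightVector (a : ι) : ev Φ a (heightVector b) = b.height a :=
  (exists_height_vector b).choose_spec a

/-- Positivity becomes a linear inequality at one fixed vector, so sign arguments about reflected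
roots reduce to real arithmetic. -/
theorem isPos_iff_ev {a : ι} : b.IsPos a ↔ 0 < ev Φ a (heightVector b) := by
  rw [ev_heightVector, RootPairing.Base.isPos_iff]
  exact Int.cast_pos.symm

theorem ev_heightVector_simple {i : ι} (hi : i ∈ b.support) : ev Φ i (heightVector b) = 1 := by
  rw [ev_heightVector, RootPairing.Base.height_one_of_mem_support hi, Int.cast_one]

variable {b}

theorem ev_nonneg_of_isPos {a : ι} (ha : b.IsPos a) {v : N}
    (hv : ∀ i ∈ b.support, 0 ≤ ev Φ i v) : 0 ≤ ev Φ a v := by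
  obtain ⟨f, hf, -, hf'⟩ := exists_coeff b a
  rw [hf]
  exact Finset.sum_nonneg fun j hj => mul_nonneg (by exact_mod_cast hf' ha j) (hv j hj)

/-- Some simple root occurs with coefficient at least one. This turns strict positivity on the
simple roots into strict positivity on all positive roots. -/
theorem exists_le_ev_of_isPos {a : ι} (ha : b.IsPos a) {v : N}
    (hv : ∀ i ∈ b.support, 0 ≤ ev Φ i v) : ∃ i ∈ b.support, ev Φ i v ≤ ev Φ a v := by
  obtain ⟨f, hf, hh, hf'⟩ := exists_coeff b a
  have : ∃ j ∈ b.support, 0 < f j := by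
    by_contra! hcon
    rw [RootPairing.Base.isPos_iff, hh] at ha
    exact absurd ha (not_lt.2 (Finset.sum_nonpos hcon))
  obtain ⟨j, hj, hj'⟩ := this
  refine ⟨j, hj, ?_⟩
  have h1 : (1 : ℝ) ≤ f j := by exact_mod_cast hj'
  have h2 : (f j : ℝ) * ev Φ j v ≤ ev Φ a v := by
    rw [hf]
    exact Finset.single_le_sum (f := fun i => (f i : ℝ) * ev Φ i v)
      (fun i hi => mul_nonneg (by exact_mod_cast hf' ha i) (hv i hi)) hj
  nlinarith [hv j hj]

theorem exists_isFundamental {i : ι} (hi : i ∈ b.support) : ∃ ω, IsFundamental b i ω := by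
  classical
  obtain ⟨ω, hω⟩ := exists_eval b (Pi.single ⟨i, hi⟩ 1)
  refine ⟨ω, ?_, fun j hj hji => ?_⟩
  · exact (hω ⟨i, hi⟩).trans (by simp)
  · exact (hω ⟨j, hj⟩).trans (Pi.single_eq_of_ne (by simpa using hji) _)

theorem IsFundamental.ev_nonneg {i : ι} {ω : N} (hω : IsFundamental b i ω) :
    ∀ j ∈ b.support, 0 ≤ ev Φ j ω := by
  intro j hj
  by_cases h : j = i
  · subst h; exact le_of_lt (by rw [ev, hω.1]; norm_num)
  · exact (hω.2 j hj h).ge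

theorem eq_of_ev_fundamental {a c : ι}
    (h : ∀ i ∈ b.support, ∀ ω, IsFundamental b i ω → ev Φ a ω = ev Φ c ω) : a = c := by
  classical
  obtain ⟨f, hf, -, -⟩ := exists_coeff b a
  obtain ⟨g, hg, -, -⟩ := exists_coeff b c
  apply ev_injective (Φ := Φ)
  intro v
  rw [hf, hg]
  refine Finset.sum_congr rfl fun i hi => ?_
  obtain ⟨ω, hω⟩ := exists_isFundamental hi
  have key := h i hi ω hω
  have aux : ∀ f : ι → ℤ, ∑ j ∈ b.support, (f j : ℝ) * ev Φ j ω = f i := by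
    intro f
    rw [Finset.sum_eq_single_of_mem i hi fun j hj hji => by
      rw [show ev Φ j ω = 0 from hω.2 j hj hji, mul_zero], show ev Φ i ω = 1 from hω.1, mul_one]
  rw [hf, hg, aux, aux] at key
  rw [key]

/-! ### The highest root -/

variable {θ : ι}

theorem IsHighestRoot.ev_le (hθ : IsHighestRoot b θ) (a : ι) {v : N}
    (hv : ∀ i ∈ b.support, 0 ≤ ev Φ i v) : ev Φ a v ≤ ev Φ θ v := by
  classical
  obtain ⟨f, hf, -, -⟩ := exists_coeff b a
  obtain ⟨g, hg, -, -⟩ := exists_coeff b θ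
  rw [hf, hg]
  refine Finset.sum_le_sum fun i hi => mul_le_mul_of_nonneg_right ?_ (hv i hi)
  obtain ⟨ω, hω⟩ := exists_isFundamental hi
  have key : ev Φ a ω ≤ ev Φ θ ω := hθ i hi ω hω a
  have aux : ∀ f : ι → ℤ, ∑ j ∈ b.support, (f j : ℝ) * ev Φ j ω = f i := by
    intro f
    rw [Finset.sum_eq_single_of_mem i hi fun j hj hji => by
      rw [show ev Φ j ω = 0 from hω.2 j hj hji, mul_zero], show ev Φ i ω = 1 from hω.1, mul_one]
  rwa [hf, hg, aux, aux] at key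

theorem heightVector_nonneg : ∀ i ∈ b.support, 0 ≤ ev Φ i (heightVector b) :=
  fun i hi => by rw [ev_heightVector_simple b hi]; norm_num

theorem IsHighestRoot.isPos (hθ : IsHighestRoot b θ) : b.IsPos θ := by
  rw [isPos_iff_ev]
  -- In the second case −θ is positive and dominated by θ, so θ is positive at the height vector all
  -- the same.
  by_cases h : b.IsPos θ
  · rwa [← isPos_iff_ev]
  · rw [← isPos_ng, isPos_iff_ev] at h
    exact h.trans_le (hθ.ev_le _ heightVector_nonneg)

theorem isPos_reflectionPerm_simple [Finite ι] [Φ.IsCrystallographic] [Φ.IsReduced] {i a : ι}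
    (hi : i ∈ b.support) (h : a ≠ i) (h' : a ≠ ng Φ i) :
    b.IsPos (Φ.reflectionPerm i a) ↔ b.IsPos a := by
  by_cases ha : b.IsPos a
  · simp only [ha, iff_true]
    exact ha.reflectionPerm hi h
  · simp only [ha, iff_false]
    rw [← isPos_ng] at ha ⊢
    rw [← reflectionPerm_ng]
    exact ha.reflectionPerm hi fun e => h' (eq_ng_iff.2 e)

variable [Finite ι] [Φ.IsCrystallographic]

/-- Since s_i θ cannot exceed θ, ⟨α_i^∨, θ⟩ ≥ 0; the two pairings of a pair of roots have the same
sign. -/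
theorem IsHighestRoot.pr_simple_nonneg (hθ : IsHighestRoot b θ) {i : ι} (hi : i ∈ b.support) :
    0 ≤ pr Φ i θ := by
  obtain ⟨ω, hω⟩ := exists_isFundamental hi
  have h1 : 0 ≤ pr Φ θ i := by
    have := hθ.ev_le (Φ.reflectionPerm i θ) hω.ev_nonneg
    rw [ev_reflectionPerm, show ev Φ i ω = 1 from hω.1] at this
    have : (0 : ℝ) ≤ pr Φ θ i := by linarith
    exact_mod_cast this
  by_contra! h2
  have h3 : 0 < Φ.pairingIn ℤ (ng Φ i) θ := by
    have := pr_ng_left (Φ := Φ) i θ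
    rw [pr] at this; rw [this]; omega
  rw [Φ.zero_lt_pairingIn_iff'] at h3
  have h4 : pr Φ θ (ng Φ i) = - pr Φ θ i := by
    have := ev_coroot (Φ := Φ) θ (ng Φ i)
    rw [coroot_ng, map_neg, ev_coroot] at this
    exact_mod_cast this.symm
  rw [pr] at h4
  omega

theorem IsHighestRoot.pr_nonneg (hθ : IsHighestRoot b θ) {a : ι} (ha : b.IsPos a) :
    0 ≤ pr Φ a θ := by
  have := ev_nonneg_of_isPos ha (v := Φ.coroot θ) fun i hi => by
    rw [ev_coroot]; exact_mod_cast hθ.pr_simple_nonneg hi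
  rw [ev_coroot] at this
  exact_mod_cast this

/-- If n = ⟨θ^∨, a⟩ ≥ 2, the root −s_θ a = nθ − a is at most θ, so a ≥ (n − 1)θ ≥ θ on dominant
vectors, while a ≤ θ; thus a = θ. This is what makes s₀ cross only its own wall. -/
theorem IsHighestRoot.pr_le_one (hθ : IsHighestRoot b θ) {a : ι} (ha : a ≠ θ) :
    pr Φ a θ ≤ 1 := by
  by_contra! h
  have h2 : (2 : ℝ) ≤ pr Φ a θ := by exact_mod_cast h
  have key : ∀ v : N, (∀ i ∈ b.support, 0 ≤ ev Φ i v) → ev Φ a v = ev Φ θ v := by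
    intro v hv
    have h3 := hθ.ev_le (ng Φ (Φ.reflectionPerm θ a)) hv
    rw [ev_ng, ev_reflectionPerm] at h3
    have h4 := hθ.ev_le a hv
    have h5 := ev_nonneg_of_isPos hθ.isPos hv
    nlinarith
  exact ha (eq_of_ev_fundamental fun i hi ω hω => key ω hω.ev_nonneg)

end Base

/-! ### Positive coroots -/

theorem root_mem_closure_of_isPos {b : Φ.Base} {a : ι} (ha : b.IsPos a) :
    Φ.root a ∈ AddSubmonoid.closure (Φ.root '' b.support) := by
  obtain ⟨f, hf₀, hf₁, hf₂⟩ := b.exists_root_eq_sum_int a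
  have hf : ∀ j, 0 ≤ f j := by
    rcases hf₁ with h | h
    · exact h.le
    · rw [RootPairing.Base.isPos_iff, RootPairing.Base.height_eq_sum hf₂] at ha
      exact absurd ha (not_lt.2 (Finset.sum_nonpos fun i _ => h.le i))
  rw [hf₂]
  refine sum_mem fun j hj => ?_
  obtain ⟨n, hn⟩ := Int.eq_ofNat_of_zero_le (hf j)
  rw [hn, natCast_zsmul]
  exact nsmul_mem (AddSubmonoid.subset_closure (Set.mem_image_of_mem _ hj)) n

/-- Among roots and among coroots alike, a simple reflection changes the sign of ± its own root
only, so both notions of positivity propagate identically from the simple roots. -/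
theorem isPos_flip_iff [Finite ι] [Φ.IsCrystallographic] [Φ.IsReduced] [Φ.IsRootSystem]
    {b : Φ.Base} (a : ι) : b.flip.IsPos a ↔ b.IsPos a := by
  have := Module.IsReflexive.of_isPerfPair Φ.toLinearMap
  have := Module.IsReflexive.of_isPerfPair Φ.toLinearMap.flip
  have hng : ∀ c, b.flip.IsPos (ng Φ c) ↔ ¬ b.flip.IsPos c := fun c =>
    RootPairing.Base.IsPos.neg_iff_not b.flip c
  refine b.induction_reflect (p := fun a => b.flip.IsPos a ↔ b.IsPos a) a ?_ ?_ ?_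
  · intro i hi
    change b.flip.IsPos (ng Φ i) ↔ b.IsPos (ng Φ i)
    rw [hng, isPos_ng, hi]
  · intro i hi
    exact iff_of_true (RootPairing.Base.isPos_of_mem_support (b := b.flip) hi)
      (RootPairing.Base.isPos_of_mem_support hi)
  · intro i j hi hj
    have hj1 : b.IsPos j := RootPairing.Base.isPos_of_mem_support hj
    have hj2 : b.flip.IsPos j := RootPairing.Base.isPos_of_mem_support (b := b.flip) hj
    by_cases h : i = j
    · subst h
      change b.flip.IsPos (ng Φ i) ↔ b.IsPos (ng Φ i)
      rw [hng, isPos_ng, hi]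
    by_cases h' : i = ng Φ j
    · rw [h', reflectionPerm_ng]
      change b.flip.IsPos (ng Φ (ng Φ j)) ↔ b.IsPos (ng Φ (ng Φ j))
      rw [ng_ng]
      exact iff_of_true hj2 hj1
    rw [isPos_reflectionPerm_simple hj h h', ← hi]
    exact isPos_reflectionPerm_simple (Φ := Φ.flip) (b := b.flip) hj h h'

theorem coroot_mem_corootCone [Finite ι] [Φ.IsCrystallographic] [Φ.IsReduced] [Φ.IsRootSystem]
    {b : Φ.Base} {a : ι} (ha : b.IsPos a) : Φ.coroot a ∈ corootCone b :=
  root_mem_closure_of_isPos (Φ := Φ.flip) (b := b.flip) ((isPos_flip_iff a).2 ha)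

end AlcoveWalks

end

/-! ### The automorphism group of the affine root system and its action on roots. -/

noncomputable section

namespace AlcoveWalks

variable {ι M N : Type*} [Fintype ι] [AddCommGroup M] [Module ℝ M] [AddCommGroup N] [Module ℝ N]
  {Φ : RootPairing ι ℝ M N}

/-! ### Affine automorphisms of the affine root system -/

/-- Composing the affine map `x` with the root `a` gives the affine root `c + kδ`. -/
def IsPull (Φ : RootPairing ι ℝ M N) (x : N ≃ᵃ[ℝ] N) (a c : ι) (k : ℤ) : Prop :=
  (∀ v, ev Φ a (x v) = ev Φ c v + k) ∧
    ∀ (v : N) (t : ℝ), x (v + t • Φ.coroot c) = x v + t • Φ.coroot a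

theorem IsPull.mul {x y : N ≃ᵃ[ℝ] N} {a c d : ι} {k l : ℤ} (hx : IsPull Φ x a c k)
    (hy : IsPull Φ y c d l) : IsPull Φ (x * y) a d (k + l) := by
  refine ⟨fun v => ?_, fun v t => ?_⟩
  · rw [AffineEquiv.coe_mul, Function.comp_apply, hx.1, hy.1]
    push_cast; ring
  · rw [AffineEquiv.coe_mul, Function.comp_apply, Function.comp_apply, hy.2, hx.2]

theorem IsPull.unique {x : N ≃ᵃ[ℝ] N} {a c d : ι} {k l : ℤ} (h : IsPull Φ x a c k)
    (h' : ∀ v, ev Φ a (x v) = ev Φ d v + l) : c = d ∧ k = l := by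
  have h0 : k = l := by
    have := (h.1 0).symm.trans (h' 0)
    simp only [map_zero, zero_add] at this
    exact_mod_cast this
  subst h0
  exact ⟨ev_injective (Φ := Φ) fun v => add_right_cancel ((h.1 v).symm.trans (h' v)), rfl⟩

theorem apply_inv_apply (x : N ≃ᵃ[ℝ] N) (v : N) : x (x⁻¹ v) = v := x.apply_symm_apply v

theorem inv_apply_apply (x : N ≃ᵃ[ℝ] N) (v : N) : x⁻¹ (x v) = v := x.symm_apply_apply v

theorem mul_apply (x y : N ≃ᵃ[ℝ] N) (v : N) : (x * y) v = x (y v) := rfl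

/-- The group of affine automorphisms of the affine root system. -/
def rootAut (Φ : RootPairing ι ℝ M N) : Subgroup (N ≃ᵃ[ℝ] N) where
  carrier := {x | ∀ a, ∃ c k, IsPull Φ x a c k}
  mul_mem' := by
    intro x y hx hy a
    obtain ⟨c, k, h⟩ := hx a
    obtain ⟨d, l, h'⟩ := hy c
    exact ⟨d, _, h.mul h'⟩
  one_mem' := fun a => ⟨a, 0, fun v => by simp, fun v t => by simp⟩
  inv_mem' := by
    intro x hx a
    choose f k hf using hx
    have hinj : Function.Injective f := by
      intro c d hcd
      apply ev_injective (Φ := Φ)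
      have h1 := (hf c).1
      have h2 := (hf d).1
      rw [← hcd] at h2
      have h3 : ∀ v, ev Φ c v = ev Φ d v + (k c - k d) := by
        intro v
        have e1 := h1 (x⁻¹ v)
        have e2 := h2 (x⁻¹ v)
        rw [apply_inv_apply] at e1 e2
        linarith
      intro v
      have := h3 0
      simp only [map_zero, zero_add] at this
      rw [h3 v, ← this, add_zero]
    -- Distinct roots have distinct pull-backs and there are finitely many roots, so every root is a
    -- pull-back.
    obtain ⟨c, rfl⟩ := (Finite.injective_iff_surjective.1 hinj) a
    refine ⟨c, -k c, fun v => ?_, fun v t => ?_⟩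
    · have := (hf c).1 (x⁻¹ v)
      rw [apply_inv_apply] at this
      push_cast; linarith
    · apply x.injective
      rw [apply_inv_apply, (hf c).2, apply_inv_apply]

/-- The index of the root that `x` pulls the root `a` back to, up to an integer. -/
def pull (Φ : RootPairing ι ℝ M N) (x : N ≃ᵃ[ℝ] N) (a : ι) : ι :=
  open Classical in if h : ∃ c k, IsPull Φ x a c k then h.choose else a

/-- The value of the root `a` at the image of the origin under `x`. -/
def shift (Φ : RootPairing ι ℝ M N) (x : N ≃ᵃ[ℝ] N) (a : ι) : ℤ :=
  open Classical in if h : ∃ c k, IsPull Φ x a c k then h.choose_spec.choose else 0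

variable {x y : N ≃ᵃ[ℝ] N}

theorem isPull (hx : x ∈ rootAut Φ) (a : ι) : IsPull Φ x a (pull Φ x a) (shift Φ x a) := by
  have h : ∃ c k, IsPull Φ x a c k := hx a
  rw [pull, shift, dif_pos h, dif_pos h]
  exact h.choose_spec.choose_spec

theorem ev_apply (hx : x ∈ rootAut Φ) (a : ι) (v : N) :
    ev Φ a (x v) = ev Φ (pull Φ x a) v + shift Φ x a := (isPull hx a).1 v

theorem apply_add_smul_coroot (hx : x ∈ rootAut Φ) (a : ι) (v : N) (t : ℝ) :
    x (v + t • Φ.coroot (pull Φ x a)) = x v + t • Φ.coroot a := (isPull hx a).2 v t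

theorem shift_eq (hx : x ∈ rootAut Φ) (a : ι) : (shift Φ x a : ℝ) = ev Φ a (x 0) := by
  rw [ev_apply hx, map_zero, zero_add]

theorem pull_eq (hx : x ∈ rootAut Φ) {a c : ι} {k : ℤ} (h : ∀ v, ev Φ a (x v) = ev Φ c v + k) :
    pull Φ x a = c := ((isPull hx a).unique h).1

theorem shift_eq_of (hx : x ∈ rootAut Φ) {a c : ι} {k : ℤ}
    (h : ∀ v, ev Φ a (x v) = ev Φ c v + k) : shift Φ x a = k := ((isPull hx a).unique h).2

/-- Pulling back reverses products; accordingly `pull Φ x⁻¹` is the action of the linear part of x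
on roots, and it is used in this sense below. -/
theorem pull_mul (hx : x ∈ rootAut Φ) (hy : y ∈ rootAut Φ) (a : ι) :
    pull Φ (x * y) a = pull Φ y (pull Φ x a) :=
  pull_eq (mul_mem hx hy) ((isPull hx a).mul (isPull hy _)).1

theorem shift_mul (hx : x ∈ rootAut Φ) (hy : y ∈ rootAut Φ) (a : ι) :
    shift Φ (x * y) a = shift Φ x a + shift Φ y (pull Φ x a) :=
  shift_eq_of (mul_mem hx hy) ((isPull hx a).mul (isPull hy _)).1

theorem pull_one (a : ι) : pull Φ 1 a = a :=
  pull_eq (k := 0) (one_mem _) fun v => by simp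

theorem shift_one (a : ι) : shift Φ 1 a = 0 :=
  shift_eq_of (c := a) (one_mem _) fun v => by simp

theorem pull_pull_inv (hx : x ∈ rootAut Φ) (a : ι) : pull Φ x (pull Φ x⁻¹ a) = a := by
  rw [← pull_mul (inv_mem hx) hx, inv_mul_cancel, pull_one]

theorem pull_inv_pull (hx : x ∈ rootAut Φ) (a : ι) : pull Φ x⁻¹ (pull Φ x a) = a := by
  rw [← pull_mul hx (inv_mem hx), mul_inv_cancel, pull_one]

theorem pull_injective (hx : x ∈ rootAut Φ) : Function.Injective (pull Φ x) :=
  Function.LeftInverse.injective (pull_inv_pull hx)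

theorem pull_ng (hx : x ∈ rootAut Φ) (a : ι) : pull Φ x (ng Φ a) = ng Φ (pull Φ x a) := by
  refine pull_eq (k := -shift Φ x a) hx fun v => ?_
  rw [ev_ng, ev_ng, ev_apply hx]; push_cast; ring

theorem shift_ng (hx : x ∈ rootAut Φ) (a : ι) : shift Φ x (ng Φ a) = -shift Φ x a := by
  refine shift_eq_of (c := ng Φ (pull Φ x a)) hx fun v => ?_
  rw [ev_ng, ev_ng, ev_apply hx]; push_cast; ring

variable [Φ.IsCrystallographic]

/-- The second clause of `IsPull` says that coroots are transported along with roots; evaluating a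
root on it gives invariance of the pairing. -/
theorem pr_pull (hx : x ∈ rootAut Φ) (a c : ι) : pr Φ (pull Φ x a) (pull Φ x c) = pr Φ a c := by
  have h := apply_add_smul_coroot hx c 0 1
  have h2 := congrArg (ev Φ a) h
  rw [ev_apply hx, one_smul, zero_add, one_smul, map_add, ev_coroot, ev_coroot, ← shift_eq hx] at h2
  have : (pr Φ (pull Φ x a) (pull Φ x c) : ℝ) = pr Φ a c := by linarith
  exact_mod_cast this

theorem pull_reflectionPerm (hx : x ∈ rootAut Φ) (c a : ι) :
    pull Φ x (Φ.reflectionPerm c a) = Φ.reflectionPerm (pull Φ x c) (pull Φ x a) := by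
  refine pull_eq (k := shift Φ x a - pr Φ a c * shift Φ x c) hx fun v => ?_
  rw [ev_reflectionPerm, ev_reflectionPerm, pr_pull hx, ev_apply hx, ev_apply hx]
  push_cast; ring

theorem affRefl_apply' (c : ι) (j : ℤ) (v : N) :
    affRefl Φ c j v = v - (ev Φ c v + j) • Φ.coroot c := affRefl_apply Φ c j v

theorem ev_affRefl (c : ι) (j : ℤ) (a : ι) (v : N) :
    ev Φ a (affRefl Φ c j v) = ev Φ (Φ.reflectionPerm c a) v + (-j * pr Φ a c : ℤ) := by
  rw [affRefl_apply', map_sub, map_smul, ev_coroot, ev_reflectionPerm]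
  push_cast; simp; ring

theorem affRefl_mem (c : ι) (j : ℤ) : affRefl Φ c j ∈ rootAut Φ := by
  intro a
  refine ⟨Φ.reflectionPerm c a, _, ev_affRefl c j a, fun v t => ?_⟩
  rw [affRefl_apply', affRefl_apply', ← Φ.reflectionPerm_coroot]
  rw [show Φ.toLinearMap (Φ.root c) (Φ.coroot a) = ev Φ c (Φ.coroot a) from rfl, map_add, map_smul,
    map_sub, map_smul, show ev Φ c (Φ.coroot c) = 2 from Φ.root_coroot_two c]
  simp only [smul_eq_mul]
  module

theorem pull_affRefl (c : ι) (j : ℤ) (a : ι) : pull Φ (affRefl Φ c j) a = Φ.reflectionPerm c a :=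
  pull_eq (affRefl_mem c j) (ev_affRefl c j a)

theorem shift_affRefl (c : ι) (j : ℤ) (a : ι) : shift Φ (affRefl Φ c j) a = -j * pr Φ a c :=
  shift_eq_of (affRefl_mem c j) (ev_affRefl c j a)

theorem affRefl_mul_self (c : ι) (j : ℤ) : affRefl Φ c j * affRefl Φ c j = 1 := by
  ext v
  rw [mul_apply, AffineEquiv.coe_one, id, affRefl_apply', affRefl_apply', map_sub, map_smul,
    show ev Φ c (Φ.coroot c) = 2 from Φ.root_coroot_two c]
  simp only [smul_eq_mul]
  module

theorem affRefl_mul_cancel_left (c : ι) (j : ℤ) (x : N ≃ᵃ[ℝ] N) :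
    affRefl Φ c j * (affRefl Φ c j * x) = x := by
  rw [← mul_assoc, affRefl_mul_self, one_mul]

theorem affRefl_ng (c : ι) (j : ℤ) : affRefl Φ (ng Φ c) (-j) = affRefl Φ c j := by
  ext v
  rw [affRefl_apply', affRefl_apply', ev_ng, coroot_ng]
  push_cast; module

/-- Conjugating a reflection by an automorphism. -/
theorem mul_affRefl (hx : x ∈ rootAut Φ) (c : ι) (j : ℤ) :
    x * affRefl Φ (pull Φ x c) (j + shift Φ x c) = affRefl Φ c j * x := by
  ext v
  rw [mul_apply, mul_apply, affRefl_apply', affRefl_apply', sub_eq_add_neg, ← neg_smul,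
    apply_add_smul_coroot hx, ev_apply hx, sub_eq_add_neg, ← neg_smul]
  push_cast
  module

theorem trans_apply (μ v : N) : trans μ v = μ + v := rfl

theorem trans_mem {μ : N} (h : ∀ a, ∃ z : ℤ, ev Φ a μ = z) : trans μ ∈ rootAut Φ := by
  intro a
  obtain ⟨z, hz⟩ := h a
  refine ⟨a, z, fun v => ?_, fun v t => ?_⟩
  · rw [trans_apply, map_add, hz, add_comm]
  · rw [trans_apply, trans_apply, add_assoc]

theorem pull_trans {μ : N} (h : trans μ ∈ rootAut Φ) (a : ι) : pull Φ (trans μ) a = a := by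
  refine pull_eq (k := shift Φ (trans μ) a) h fun v => ?_
  rw [shift_eq h, trans_apply, trans_apply, add_zero, map_add, add_comm]

theorem coroot_trans_mem (c : ι) : trans (Φ.coroot c) ∈ rootAut Φ :=
  trans_mem fun a => ⟨_, ev_coroot a c⟩

theorem IsCoweight.exists_int {b : Φ.Base} {μ : N} [Φ.IsRootSystem] (h : IsCoweight b μ) (a : ι) :
    ∃ z : ℤ, ev Φ a μ = z := by
  obtain ⟨f, hf, -, -⟩ := exists_coeff b a
  choose! g hg using h
  refine ⟨∑ j ∈ b.support, f j * g j, ?_⟩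
  rw [hf]
  push_cast
  refine Finset.sum_congr rfl fun j hj => ?_
  rw [show ev Φ j μ = g j from hg j hj]

theorem IsDominant.isCoweight {b : Φ.Base} {μ : N} (h : IsDominant b μ) : IsCoweight b μ :=
  fun i hi => let ⟨z, hz⟩ := h i hi; ⟨z, by rw [hz]; simp⟩

theorem IsDominant.ev_nonneg {b : Φ.Base} {μ : N} (h : IsDominant b μ) :
    ∀ i ∈ b.support, 0 ≤ ev Φ i μ :=
  fun i hi => let ⟨z, hz⟩ := h i hi; by rw [ev, hz]; positivity

theorem weyl_le : weyl Φ ≤ rootAut Φ := by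
  rw [weyl, Subgroup.closure_le]
  rintro _ ⟨a, rfl⟩
  exact affRefl_mem a 0

theorem weyl_apply_zero {w : N ≃ᵃ[ℝ] N} (hw : w ∈ weyl Φ) : w 0 = 0 := by
  rw [weyl] at hw
  induction hw using Subgroup.closure_induction with
  | mem x hx => obtain ⟨a, rfl⟩ := hx; simp [affRefl_apply']
  | one => rfl
  | mul x y _ _ hx hy => rw [mul_apply, hy, hx]
  | inv x _ hx => apply x.injective; rw [apply_inv_apply, hx]

theorem weyl_apply_eq {w : N ≃ᵃ[ℝ] N} (hw : w ∈ weyl Φ) (v : N) : w v = w.linear v := by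
  have := w.map_vadd 0 v
  rw [weyl_apply_zero hw] at this
  simpa using this

theorem weyl_apply_add {w : N ≃ᵃ[ℝ] N} (hw : w ∈ weyl Φ) (u v : N) : w (u + v) = w u + w v := by
  simp only [weyl_apply_eq hw, map_add]

theorem weyl_apply_sub {w : N ≃ᵃ[ℝ] N} (hw : w ∈ weyl Φ) (u v : N) : w (u - v) = w u - w v := by
  simp only [weyl_apply_eq hw, map_sub]

theorem weyl_apply_smul {w : N ≃ᵃ[ℝ] N} (hw : w ∈ weyl Φ) (t : ℝ) (v : N) :
    w (t • v) = t • w v := by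
  simp only [weyl_apply_eq hw, map_smul]

theorem shift_weyl {w : N ≃ᵃ[ℝ] N} (hw : w ∈ weyl Φ) (a : ι) : shift Φ w a = 0 := by
  have := shift_eq (weyl_le hw) a
  rw [weyl_apply_zero hw, map_zero] at this
  exact_mod_cast this

theorem ev_weyl {w : N ≃ᵃ[ℝ] N} (hw : w ∈ weyl Φ) (a : ι) (v : N) :
    ev Φ a (w v) = ev Φ (pull Φ w a) v := by
  rw [ev_apply (weyl_le hw), shift_weyl hw, Int.cast_zero, add_zero]

theorem weyl_coroot {w : N ≃ᵃ[ℝ] N} (hw : w ∈ weyl Φ) (a : ι) :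
    w (Φ.coroot (pull Φ w a)) = Φ.coroot a := by
  have := apply_add_smul_coroot (weyl_le hw) a 0 1
  rwa [weyl_apply_zero hw, one_smul, one_smul, zero_add, zero_add] at this

theorem weyl_coroot' {w : N ≃ᵃ[ℝ] N} (hw : w ∈ weyl Φ) (a : ι) :
    w (Φ.coroot a) = Φ.coroot (pull Φ w⁻¹ a) := by
  have := weyl_coroot hw (pull Φ w⁻¹ a)
  rwa [pull_pull_inv (weyl_le hw)] at this

theorem affRefl_mem_weyl (a : ι) : affRefl Φ a 0 ∈ weyl Φ :=
  Subgroup.subset_closure ⟨a, rfl⟩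

theorem weyl_mul_trans {w : N ≃ᵃ[ℝ] N} (hw : w ∈ weyl Φ) (μ : N) :
    w * trans μ = trans (w μ) * w := by
  ext v
  rw [mul_apply, mul_apply, trans_apply, trans_apply, weyl_apply_add hw]

end AlcoveWalks

end

/-! ### Integer coordinates of alcoves, walls and length. -/

noncomputable section

namespace AlcoveWalks

variable {ι M N : Type*} [Fintype ι] [AddCommGroup M] [Module ℝ M] [AddCommGroup N] [Module ℝ N]
  {Φ : RootPairing ι ℝ M N} [Φ.IsRootSystem] [Φ.IsCrystallographic] [Φ.IsReduced]
  {b : Φ.Base} {θ : ι} {x y : N ≃ᵃ[ℝ] N}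

/-! ### The position of an alcove relative to the hyperplanes -/

open Classical in
/-- The root `a` takes values strictly between `lvl b x a` and `lvl b x a + 1` on `x c₀`. -/
def lvl (b : Φ.Base) (x : N ≃ᵃ[ℝ] N) (a : ι) : ℤ :=
  shift Φ x a + if b.IsPos (pull Φ x a) then 0 else -1

theorem lvl_of_isPos {a : ι} (h : b.IsPos (pull Φ x a)) : lvl b x a = shift Φ x a := by
  rw [lvl, if_pos h, add_zero]

theorem lvl_of_not_isPos {a : ι} (h : ¬ b.IsPos (pull Φ x a)) : lvl b x a = shift Φ x a - 1 := by
  rw [lvl, if_neg h]; rfl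

theorem lvl_le_shift (x : N ≃ᵃ[ℝ] N) (a : ι) : lvl b x a ≤ shift Φ x a := by
  by_cases h : b.IsPos (pull Φ x a)
  · rw [lvl_of_isPos h]
  · rw [lvl_of_not_isPos h]; omega

theorem shift_le_lvl_add_one (x : N ≃ᵃ[ℝ] N) (a : ι) : shift Φ x a ≤ lvl b x a + 1 := by
  by_cases h : b.IsPos (pull Φ x a)
  · rw [lvl_of_isPos h]; omega
  · rw [lvl_of_not_isPos h]; omega

theorem lvl_mul (hx : x ∈ rootAut Φ) (hy : y ∈ rootAut Φ) (a : ι) :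
    lvl b (x * y) a = shift Φ x a + lvl b y (pull Φ x a) := by
  rw [lvl, lvl, pull_mul hx hy, shift_mul hx hy, add_assoc]

theorem lvl_ng (hx : x ∈ rootAut Φ) (a : ι) : lvl b x (ng Φ a) = -1 - lvl b x a := by
  by_cases h : b.IsPos (pull Φ x a)
  · have h' : ¬ b.IsPos (pull Φ x (ng Φ a)) := by rw [pull_ng hx, isPos_ng]; simpa using h
    rw [lvl_of_isPos h, lvl_of_not_isPos h', shift_ng hx]; ring
  · have h' : b.IsPos (pull Φ x (ng Φ a)) := by rw [pull_ng hx, isPos_ng]; exact h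
    rw [lvl_of_not_isPos h, lvl_of_isPos h', shift_ng hx]; ring

theorem lvl_one_of_isPos {a : ι} (h : b.IsPos a) : lvl b (1 : N ≃ᵃ[ℝ] N) a = 0 := by
  rw [lvl_of_isPos (by rwa [pull_one]), shift_one]

theorem lvl_one_of_not_isPos {a : ι} (h : ¬ b.IsPos a) : lvl b (1 : N ≃ᵃ[ℝ] N) a = -1 := by
  rw [lvl_of_not_isPos (by rwa [pull_one]), shift_one]; rfl

theorem mem_fundAlcove {v : N} : v ∈ fundAlcove b θ ↔
    (∀ i ∈ b.support, 0 < ev Φ i v) ∧ ev Φ θ v < 1 := by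
  have : ∀ i, affRoot Φ i 0 v = ev Φ i v := fun i => by simp [affRoot, ev]
  simp only [fundAlcove, Set.mem_ofPred_eq, this]
  refine and_congr_right fun _ => ?_
  change 0 < -ev Φ θ v + 1 ↔ _
  constructor <;> intro h <;> linarith

theorem ev_mem_Ioo (hθ : IsHighestRoot b θ) {v : N} (hv : v ∈ fundAlcove b θ) {a : ι}
    (ha : b.IsPos a) : 0 < ev Φ a v ∧ ev Φ a v < 1 := by
  rw [mem_fundAlcove] at hv
  have hv' : ∀ i ∈ b.support, 0 ≤ ev Φ i v := fun i hi => (hv.1 i hi).le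
  obtain ⟨i, hi, h⟩ := exists_le_ev_of_isPos ha hv'
  exact ⟨(hv.1 i hi).trans_le h, (hθ.ev_le a hv').trans_lt hv.2⟩

theorem fundAlcove_nonempty (hθ : IsHighestRoot b θ) : ∃ v, v ∈ fundAlcove b θ := by
  have hpos : 0 < ev Φ θ (heightVector b) := (isPos_iff_ev b).1 hθ.isPos
  refine ⟨(1 / (2 * ev Φ θ (heightVector b))) • heightVector b, mem_fundAlcove.2 ⟨?_, ?_⟩⟩
  · intro i hi
    rw [map_smul, ev_heightVector_simple b hi]
    simp only [smul_eq_mul]; positivity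
  · rw [map_smul, smul_eq_mul, one_div, mul_inv, mul_assoc, inv_mul_cancel₀ hpos.ne']
    norm_num

theorem lvl_lt_ev (hθ : IsHighestRoot b θ) (hx : x ∈ rootAut Φ) (a : ι) {v : N}
    (hv : v ∈ fundAlcove b θ) :
    (lvl b x a : ℝ) < ev Φ a (x v) ∧ ev Φ a (x v) < lvl b x a + 1 := by
  rw [ev_apply hx]
  by_cases h : b.IsPos (pull Φ x a)
  · rw [lvl_of_isPos h]
    have := ev_mem_Ioo hθ hv h
    constructor <;> linarith
  · rw [lvl_of_not_isPos h]
    have := ev_mem_Ioo hθ hv ((isPos_ng b _).2 h)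
    rw [ev_ng] at this
    push_cast
    constructor <;> linarith

/-- On x c₀ the root stays inside an open unit interval with integer end points, so an integral
hyperplane never cuts the alcove and one interior point decides the side. -/
theorem onPos_iff (hθ : IsHighestRoot b θ) (hx : x ∈ rootAut Φ) {a : ι} {k : ℤ} :
    OnPos b θ x a k ↔ -k ≤ lvl b x a := by
  constructor
  · intro h
    obtain ⟨v, hv⟩ := fundAlcove_nonempty hθ
    have h1 : 0 ≤ ev Φ a (x v) + k := h _ ⟨v, hv, rfl⟩
    have h2 := (lvl_lt_ev hθ hx a hv).2
    have h3 : ((-k : ℤ) : ℝ) < (lvl b x a + 1 : ℤ) := by push_cast; linarith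
    have := Int.cast_lt.1 h3
    omega
  · rintro h _ ⟨v, hv, rfl⟩
    change 0 ≤ ev Φ a (x v) + k
    have h2 := (lvl_lt_ev hθ hx a hv).1
    have h3 : ((-k : ℤ) : ℝ) ≤ lvl b x a := Int.cast_le.2 h
    push_cast at h3
    linarith

theorem onNeg_iff (hθ : IsHighestRoot b θ) (hx : x ∈ rootAut Φ) {a : ι} {k : ℤ} :
    OnNeg b θ x a k ↔ lvl b x a < -k := by
  constructor
  · intro h
    obtain ⟨v, hv⟩ := fundAlcove_nonempty hθ
    have h1 : ev Φ a (x v) + k ≤ 0 := h _ ⟨v, hv, rfl⟩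
    have h2 := (lvl_lt_ev hθ hx a hv).1
    have h3 : (lvl b x a : ℝ) < (-k : ℤ) := by push_cast; linarith
    exact Int.cast_lt.1 h3
  · rintro h _ ⟨v, hv, rfl⟩
    change ev Φ a (x v) + k ≤ 0
    have h2 := (lvl_lt_ev hθ hx a hv).2
    have h3 : ((lvl b x a + 1 : ℤ) : ℝ) ≤ (-k : ℤ) := Int.cast_le.2 h
    push_cast at h3
    linarith

/-! ### The generators and the wall between adjacent alcoves -/

/-- The root of the simple affine root with label `s`. -/
def simpleRoot (b : Φ.Base) (θ : ι) : Option b.support → ι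
  | some i => i
  | none => ng Φ θ

/-- The multiple of `δ` in the simple affine root with label `s`. -/
def simpleLevel (b : Φ.Base) : Option b.support → ℤ
  | some _ => 0
  | none => 1

theorem gen_eq (s : Option b.support) :
    gen b θ s = affRefl Φ (simpleRoot b θ s) (simpleLevel b s) := by
  cases s with
  | some i => rfl
  | none => exact (affRefl_ng θ (-1)).symm

theorem gen_mem (s : Option b.support) : gen b θ s ∈ rootAut Φ := by
  rw [gen_eq]; exact affRefl_mem _ _

theorem gen_mul_self (s : Option b.support) : gen b θ s * gen b θ s = 1 := by
  rw [gen_eq]; exact affRefl_mul_self _ _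

theorem mul_gen_mul_gen (x : N ≃ᵃ[ℝ] N) (s : Option b.support) :
    x * gen b θ s * gen b θ s = x := by
  rw [mul_assoc, gen_mul_self, mul_one]

theorem lvl_one_simpleRoot (hθ : IsHighestRoot b θ) (s : Option b.support) :
    lvl b (1 : N ≃ᵃ[ℝ] N) (simpleRoot b θ s) = -simpleLevel b s := by
  cases s with
  | some i => exact lvl_one_of_isPos (RootPairing.Base.isPos_of_mem_support i.2)
  | none =>
    refine lvl_one_of_not_isPos ?_
    rw [simpleRoot, isPos_ng, not_not]
    exact hθ.isPos

theorem lvl_gen_simpleRoot (hθ : IsHighestRoot b θ) (s : Option b.support) :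
    lvl b (gen b θ s) (simpleRoot b θ s) = -simpleLevel b s - 1 := by
  rw [gen_eq]
  cases s with
  | some i =>
    rw [lvl_of_not_isPos, shift_affRefl]
    · simp [simpleLevel]
    · rw [pull_affRefl]
      change ¬ b.IsPos (ng Φ i)
      rw [isPos_ng, not_not]
      exact RootPairing.Base.isPos_of_mem_support i.2
  | none =>
    rw [lvl_of_isPos, shift_affRefl, pr_self]
    · rfl
    · rw [pull_affRefl]
      change b.IsPos (ng Φ (ng Φ θ))
      rw [ng_ng]
      exact hθ.isPos

/-- A generator moves c₀ across its own wall and no other hyperplane. For s_i this is the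
permutation of the other positive roots; for s₀ it rests on the pairings with θ^∨ being 0 or 1. -/
theorem lvl_gen_of_ne (hθ : IsHighestRoot b θ) {s : Option b.support} {a : ι}
    (h : a ≠ simpleRoot b θ s) (h' : a ≠ ng Φ (simpleRoot b θ s)) :
    lvl b (gen b θ s) a = lvl b (1 : N ≃ᵃ[ℝ] N) a := by
  cases s with
  | some i =>
    have hiff : b.IsPos (pull Φ (gen b θ (some i)) a) ↔ b.IsPos a := by
      rw [gen, pull_affRefl, isPos_reflectionPerm_simple i.2 h h']
    have hs : shift Φ (gen b θ (some i)) a = 0 := by rw [gen, shift_affRefl, neg_zero, zero_mul]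
    by_cases ha : b.IsPos a
    · rw [lvl_of_isPos (hiff.2 ha), lvl_one_of_isPos ha, hs]
    · rw [lvl_of_not_isPos (mt hiff.1 ha), lvl_one_of_not_isPos ha, hs]; rfl
  | none =>
    simp only [simpleRoot, ng_ng] at h h'
    have key : ∀ a, b.IsPos a → a ≠ θ → lvl b (gen b θ none) a = lvl b (1 : N ≃ᵃ[ℝ] N) a := by
      intro a ha hne
      rw [lvl_one_of_isPos ha]
      have h1 := hθ.pr_nonneg ha
      have h2 := hθ.pr_le_one hne
      by_cases h3 : pr Φ a θ = 0
      · rw [gen, lvl_of_isPos, shift_affRefl, h3, mul_zero]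
        rw [pull_affRefl, isPos_iff_ev, ev_reflectionPerm, h3]
        simpa [← isPos_iff_ev] using ha
      -- Here a − θ is negative, and this drop of one is compensated by the shift ⟨θ^∨, a⟩ = 1.
      · have h3 : pr Φ a θ = 1 := by omega
        rw [gen, lvl_of_not_isPos, shift_affRefl, h3]
        · rfl
        · rw [pull_affRefl, isPos_iff_ev, ev_reflectionPerm, h3]
          have := hθ.ev_le a heightVector_nonneg
          push_cast; linarith
    by_cases ha : b.IsPos a
    · exact key a ha h'
    · have := key (ng Φ a) ((isPos_ng b a).2 ha) fun e => h (eq_ng_iff.2 e)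
      rw [lvl_ng (gen_mem _), lvl_ng (one_mem _)] at this
      omega

/-- The root of the affine root that vanishes on the wall between `x c₀` and `x s c₀` and is
positive on `x c₀`. -/
def wallRoot (b : Φ.Base) (θ : ι) (x : N ≃ᵃ[ℝ] N) (s : Option b.support) : ι :=
  pull Φ x⁻¹ (simpleRoot b θ s)

/-- The multiple of `δ` in the affine root that vanishes on the wall between `x c₀` and `x s c₀`
and is positive on `x c₀`. -/
def wallLevel (b : Φ.Base) (θ : ι) (x : N ≃ᵃ[ℝ] N) (s : Option b.support) : ℤ :=
  simpleLevel b s - shift Φ x (wallRoot b θ x s)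

variable {s : Option b.support}

theorem pull_wallRoot (hx : x ∈ rootAut Φ) (s : Option b.support) :
    pull Φ x (wallRoot b θ x s) = simpleRoot b θ s := pull_pull_inv hx _

theorem mul_gen (hx : x ∈ rootAut Φ) (s : Option b.support) :
    x * gen b θ s = affRefl Φ (wallRoot b θ x s) (wallLevel b θ x s) * x := by
  rw [← mul_affRefl hx, pull_wallRoot hx, gen_eq, wallLevel, sub_add_cancel]

theorem lvl_wallRoot (hθ : IsHighestRoot b θ) (hx : x ∈ rootAut Φ) (s : Option b.support) :
    lvl b x (wallRoot b θ x s) = -wallLevel b θ x s := by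
  have := lvl_mul (b := b) hx (one_mem (rootAut Φ)) (wallRoot b θ x s)
  rw [mul_one, pull_wallRoot hx, lvl_one_simpleRoot hθ] at this
  rw [this, wallLevel]; ring

theorem lvl_mul_gen_wallRoot (hθ : IsHighestRoot b θ) (hx : x ∈ rootAut Φ) (s : Option b.support) :
    lvl b (x * gen b θ s) (wallRoot b θ x s) = -wallLevel b θ x s - 1 := by
  rw [lvl_mul hx (gen_mem s), pull_wallRoot hx, lvl_gen_simpleRoot hθ, wallLevel]; ring

theorem lvl_mul_gen_of_ne (hθ : IsHighestRoot b θ) (hx : x ∈ rootAut Φ) {a : ι}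
    (h : a ≠ wallRoot b θ x s) (h' : a ≠ ng Φ (wallRoot b θ x s)) :
    lvl b (x * gen b θ s) a = lvl b x a := by
  have := lvl_mul (b := b) hx (one_mem (rootAut Φ)) a
  rw [mul_one] at this
  rw [this, lvl_mul hx (gen_mem s), lvl_gen_of_ne hθ]
  · intro e
    rw [← pull_wallRoot hx] at e
    exact h (pull_injective hx e)
  · intro e
    rw [← pull_wallRoot hx, ← pull_ng hx] at e
    exact h' (pull_injective hx e)

theorem lvl_mul_gen_ng (hθ : IsHighestRoot b θ) (hx : x ∈ rootAut Φ) (s : Option b.support) :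
    lvl b (x * gen b θ s) (ng Φ (wallRoot b θ x s)) = lvl b x (ng Φ (wallRoot b θ x s)) + 1 := by
  rw [lvl_ng (mul_mem hx (gen_mem s)), lvl_ng hx, lvl_mul_gen_wallRoot hθ hx, lvl_wallRoot hθ hx]
  ring

/-- Adjacent alcoves are separated by their common wall only. Later identifications of a crossed
hyperplane go through this uniqueness. -/
theorem eq_wall (hθ : IsHighestRoot b θ) (hx : x ∈ rootAut Φ) {a : ι} {k : ℤ}
    (h : -k ≤ lvl b x a) (h' : lvl b (x * gen b θ s) a < -k) :
    a = wallRoot b θ x s ∧ k = wallLevel b θ x s := by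
  by_cases h1 : a = wallRoot b θ x s
  · subst h1
    rw [lvl_wallRoot hθ hx] at h
    rw [lvl_mul_gen_wallRoot hθ hx] at h'
    exact ⟨rfl, by omega⟩
  · by_cases h2 : a = ng Φ (wallRoot b θ x s)
    · subst h2
      rw [lvl_mul_gen_ng hθ hx] at h'
      omega
    · rw [lvl_mul_gen_of_ne hθ hx h1 h2] at h'
      omega

theorem onPos_onNeg_iff (hθ : IsHighestRoot b θ) (hx : x ∈ rootAut Φ) {a : ι} {k : ℤ} :
    (OnPos b θ x a k ∧ OnNeg b θ (x * gen b θ s) a k) ↔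
      a = wallRoot b θ x s ∧ k = wallLevel b θ x s := by
  rw [onPos_iff hθ hx, onNeg_iff hθ (mul_mem hx (gen_mem s))]
  refine ⟨fun h => eq_wall hθ hx h.1 h.2, ?_⟩
  rintro ⟨rfl, rfl⟩
  rw [lvl_wallRoot hθ hx, lvl_mul_gen_wallRoot hθ hx]
  constructor <;> omega

theorem wallRoot_mul {g : N ≃ᵃ[ℝ] N} (hg : g ∈ rootAut Φ) (hx : x ∈ rootAut Φ)
    (s : Option b.support) : wallRoot b θ (g * x) s = pull Φ g⁻¹ (wallRoot b θ x s) := by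
  rw [wallRoot, mul_inv_rev, pull_mul (inv_mem hx) (inv_mem hg), wallRoot]

theorem wall_mul_gen (hθ : IsHighestRoot b θ) (hx : x ∈ rootAut Φ) (s : Option b.support) :
    wallRoot b θ (x * gen b θ s) s = ng Φ (wallRoot b θ x s) ∧
      wallLevel b θ (x * gen b θ s) s = -wallLevel b θ x s := by
  have := eq_wall (s := s) hθ (mul_mem hx (gen_mem s)) (a := ng Φ (wallRoot b θ x s))
    (k := -wallLevel b θ x s) (by
      rw [lvl_ng (mul_mem hx (gen_mem s)), lvl_mul_gen_wallRoot hθ hx]; omega) (by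
      rw [mul_gen_mul_gen, lvl_ng hx, lvl_wallRoot hθ hx]; omega)
  exact ⟨this.1.symm, this.2.symm⟩

theorem onNeg_onPos_iff (hθ : IsHighestRoot b θ) (hx : x ∈ rootAut Φ) {a : ι} {k : ℤ} :
    (OnNeg b θ x a k ∧ OnPos b θ (x * gen b θ s) a k) ↔
      a = ng Φ (wallRoot b θ x s) ∧ k = -wallLevel b θ x s := by
  have := onPos_onNeg_iff (s := s) (a := a) (k := k) hθ
    (mul_mem hx (gen_mem (θ := θ) s))
  rw [mul_gen_mul_gen, (wall_mul_gen hθ hx s).1, (wall_mul_gen hθ hx s).2] at this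
  rw [and_comm, this]

/-! ### The length function -/

open Classical in
/-- The finite set of positive roots. -/
def posRoots (b : Φ.Base) : Finset ι := {a | b.IsPos a}

theorem mem_posRoots {a : ι} : a ∈ posRoots b ↔ b.IsPos a := by simp [posRoots]

/-- All positive roots have level 0 on c₀, so the hyperplanes of direction a separating c₀ from x c₀
are as many as the absolute value of the level of a. -/
theorem len_eq (hθ : IsHighestRoot b θ) (hx : x ∈ rootAut Φ) :
    len b θ x = ∑ a ∈ posRoots b, (lvl b x a).natAbs := by
  classical
  have h : {h : ι × ℤ | b.IsPos h.1 ∧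
    ((OnPos b θ 1 h.1 h.2 ∧ OnNeg b θ x h.1 h.2) ∨
      (OnNeg b θ 1 h.1 h.2 ∧ OnPos b θ x h.1 h.2))} =
      ((posRoots b).sigma fun a => Finset.Ico (min 0 (-lvl b x a)) (max 0 (-lvl b x a))).image
        fun p => (p.1, p.2) := by
    ext ⟨a, k⟩
    simp only [Set.mem_ofPred_eq, Finset.coe_image, Set.mem_image, Finset.mem_coe, Finset.mem_sigma,
      Finset.mem_Ico, mem_posRoots, Prod.mk.injEq, Sigma.exists]
    have : b.IsPos a → (((OnPos b θ 1 a k ∧ OnNeg b θ x a k) ∨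
        (OnNeg b θ 1 a k ∧ OnPos b θ x a k)) ↔
        (min 0 (-lvl b x a) ≤ k ∧ k < max 0 (-lvl b x a))) := by
      intro ha
      rw [onPos_iff hθ hx, onNeg_iff hθ hx, onPos_iff hθ (one_mem _), onNeg_iff hθ (one_mem _),
        lvl_one_of_isPos ha]
      omega
    constructor
    · rintro ⟨ha, h⟩
      exact ⟨a, k, ⟨ha, (this ha).1 h⟩, rfl, rfl⟩
    · rintro ⟨a', k', ⟨ha, h⟩, rfl, rfl⟩
      exact ⟨ha, (this ha).2 h⟩
  rw [len, h, Set.ncard_coe_finset, Finset.card_image_of_injective, Finset.card_sigma]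
  · refine Finset.sum_congr rfl fun a _ => ?_
    rw [Int.card_Ico]
    omega
  · rintro ⟨a, k⟩ ⟨a', k'⟩ h
    simp only [Prod.mk.injEq] at h
    obtain ⟨rfl, rfl⟩ := h
    rfl

theorem len_one (hθ : IsHighestRoot b θ) : len b θ (1 : N ≃ᵃ[ℝ] N) = 0 := by
  rw [len_eq hθ (one_mem _)]
  refine Finset.sum_eq_zero fun a ha => ?_
  rw [lvl_one_of_isPos (mem_posRoots.1 ha), Int.natAbs_zero]

theorem sum_posRoots_sub_eq {A : Type*} [AddCommGroup A] (f g : ι → A) {c : ι} (hc : b.IsPos c)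
    (h : ∀ a, a ≠ c → a ≠ ng Φ c → f a = g a) :
    ∑ a ∈ posRoots b, f a = ∑ a ∈ posRoots b, g a + (f c - g c) := by
  classical
  rw [← Finset.add_sum_erase _ f (mem_posRoots.2 hc), ← Finset.add_sum_erase _ g (mem_posRoots.2 hc)]
  have : ∑ a ∈ (posRoots b).erase c, f a = ∑ a ∈ (posRoots b).erase c, g a := by
    refine Finset.sum_congr rfl fun a ha => ?_
    rw [Finset.mem_erase, mem_posRoots] at ha
    refine h a ha.1 fun e => ?_
    have := ha.2
    rw [e, isPos_ng] at this
    exact this hc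
  rw [this]
  abel

/-- The wall root is nonnegative on x c₀, so the condition says that c₀ lies on the same side of the
wall as x c₀. Only the summand of this root changes. -/
theorem len_mul_gen (hθ : IsHighestRoot b θ) (hx : x ∈ rootAut Φ) (s : Option b.support) :
    (len b θ (x * gen b θ s) : ℤ) = len b θ x +
      if lvl b x (wallRoot b θ x s) ≤ lvl b (1 : N ≃ᵃ[ℝ] N) (wallRoot b θ x s) then 1 else -1 := by
  rw [len_eq hθ hx, len_eq hθ (mul_mem hx (gen_mem s))]
  push_cast
  have h1 := lvl_wallRoot hθ hx s
  have h2 := lvl_mul_gen_wallRoot hθ hx s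
  by_cases hc : b.IsPos (wallRoot b θ x s)
  · rw [sum_posRoots_sub_eq (fun a => |lvl b (x * gen b θ s) a|) (fun a => |lvl b x a|) hc
      fun a h h' => by rw [lvl_mul_gen_of_ne hθ hx h h'], lvl_one_of_isPos hc]
    rw [h1, h2]
    congr 1
    split_ifs with h
    · rw [abs_of_nonpos (by omega), abs_of_nonpos (by omega)]; ring
    · rw [abs_of_nonneg (by omega), abs_of_nonneg (by omega)]; ring
  · have hc' : b.IsPos (ng Φ (wallRoot b θ x s)) := (isPos_ng b _).2 hc
    rw [sum_posRoots_sub_eq (fun a => |lvl b (x * gen b θ s) a|) (fun a => |lvl b x a|) hc'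
      fun a h h' => by rw [lvl_mul_gen_of_ne hθ hx (by rwa [ng_ng] at h') h],
      lvl_one_of_not_isPos hc]
    rw [lvl_ng hx, lvl_ng (mul_mem hx (gen_mem s)), h1, h2]
    congr 1
    split_ifs with h
    · rw [abs_of_nonneg (by omega), abs_of_nonneg (by omega)]; ring
    · rw [abs_of_nonpos (by omega), abs_of_nonpos (by omega)]; ring

theorem len_mul_gen_le (hθ : IsHighestRoot b θ) (hx : x ∈ rootAut Φ) (s : Option b.support) :
    len b θ (x * gen b θ s) ≤ len b θ x + 1 := by
  have := len_mul_gen hθ hx s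
  split_ifs at this <;> omega

/-- The sum of the positions of an alcove relative to the positive roots. -/
def lvlSum (b : Φ.Base) (x : N ≃ᵃ[ℝ] N) : ℤ := ∑ a ∈ posRoots b, lvl b x a

-- The signed analogue of the length formula: a negative crossing contributes −1 and a positive one
-- +1, wherever c₀ lies.
open Classical in
theorem lvlSum_mul_gen (hθ : IsHighestRoot b θ) (hx : x ∈ rootAut Φ) (s : Option b.support) :
    lvlSum b (x * gen b θ s) =
      lvlSum b x + if b.IsPos (wallRoot b θ x s) then -1 else 1 := by
  have h1 := lvl_wallRoot hθ hx s
  have h2 := lvl_mul_gen_wallRoot hθ hx s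
  rw [lvlSum, lvlSum]
  split_ifs with hc
  · rw [sum_posRoots_sub_eq (lvl b (x * gen b θ s)) (lvl b x) hc
      fun a h h' => lvl_mul_gen_of_ne hθ hx h h', h1, h2]
    ring
  · have hc' : b.IsPos (ng Φ (wallRoot b θ x s)) := (isPos_ng b _).2 hc
    rw [sum_posRoots_sub_eq (lvl b (x * gen b θ s)) (lvl b x) hc'
      fun a h h' => lvl_mul_gen_of_ne hθ hx (by rwa [ng_ng] at h') h, lvl_mul_gen_ng hθ hx]
    ring

/-! ### Elements of the extended affine Weyl group -/

theorem extAffWeyl_mem (hx : x ∈ extAffWeyl b) : x ∈ rootAut Φ := by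
  obtain ⟨μ, hμ, w, hw, rfl⟩ := hx
  exact mul_mem (trans_mem hμ.exists_int) (weyl_le hw)

theorem lengthZero_mem {γ : N ≃ᵃ[ℝ] N} (hγ : γ ∈ lengthZero b θ) : γ ∈ rootAut Φ :=
  extAffWeyl_mem hγ.1

theorem lvl_lengthZero (hθ : IsHighestRoot b θ) {γ : N ≃ᵃ[ℝ] N} (hγ : γ ∈ lengthZero b θ) (a : ι) :
    lvl b γ a = lvl b (1 : N ≃ᵃ[ℝ] N) a := by
  have key : ∀ a, b.IsPos a → lvl b γ a = lvl b (1 : N ≃ᵃ[ℝ] N) a := by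
    intro a ha
    have h := hγ.2
    rw [len_eq hθ (lengthZero_mem hγ), Finset.sum_eq_zero_iff] at h
    rw [lvl_one_of_isPos ha]
    exact Int.natAbs_eq_zero.1 (h a (mem_posRoots.2 ha))
  by_cases ha : b.IsPos a
  · exact key a ha
  · have := key (ng Φ a) ((isPos_ng b a).2 ha)
    rw [lvl_ng (lengthZero_mem hγ), lvl_ng (one_mem _)] at this
    omega

/-- Elements of Ω have the same levels as 1, so the final jump to another sheet changes neither
levels nor length. -/
theorem lvl_mul_lengthZero (hθ : IsHighestRoot b θ) (hx : x ∈ rootAut Φ) {γ : N ≃ᵃ[ℝ] N}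
    (hγ : γ ∈ lengthZero b θ) (a : ι) : lvl b (x * γ) a = lvl b x a := by
  have := lvl_mul (b := b) hx (one_mem (rootAut Φ)) a
  rw [mul_one] at this
  rw [lvl_mul hx (lengthZero_mem hγ), lvl_lengthZero hθ hγ, this]

theorem len_mul_lengthZero (hθ : IsHighestRoot b θ) (hx : x ∈ rootAut Φ) {γ : N ≃ᵃ[ℝ] N}
    (hγ : γ ∈ lengthZero b θ) : len b θ (x * γ) = len b θ x := by
  rw [len_eq hθ hx, len_eq hθ (mul_mem hx (lengthZero_mem hγ))]
  refine Finset.sum_congr rfl fun a _ => ?_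
  rw [lvl_mul_lengthZero hθ hx hγ]

end AlcoveWalks

end

/-! ### Exchange arguments in W₀, the cone Q⁺ and saturated sets. -/

noncomputable section

namespace AlcoveWalks

variable {ι M N : Type*} [Fintype ι] [AddCommGroup M] [Module ℝ M] [AddCommGroup N] [Module ℝ N]
  {Φ : RootPairing ι ℝ M N} [Φ.IsRootSystem] [Φ.IsCrystallographic] [Φ.IsReduced]
  {b : Φ.Base} {θ : ι} {w : N ≃ᵃ[ℝ] N}

/-! ### The finite Weyl group -/

/-- The product of the simple reflections along a word. -/
def simpleProd (L : List b.support) : N ≃ᵃ[ℝ] N := (L.map fun i => affRefl Φ i 0).prod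

theorem simpleProd_nil : simpleProd ([] : List b.support) = 1 := rfl

theorem simpleProd_cons (i : b.support) (L : List b.support) :
    simpleProd (i :: L) = affRefl Φ i 0 * simpleProd L := by simp [simpleProd]

theorem simpleProd_append (L L' : List b.support) :
    simpleProd (L ++ L') = simpleProd L * simpleProd L' := by simp [simpleProd]

theorem simpleProd_mem (L : List b.support) : simpleProd L ∈ weyl Φ := by
  refine list_prod_mem fun x hx => ?_
  obtain ⟨i, -, rfl⟩ := List.mem_map.1 hx
  exact affRefl_mem_weyl _

theorem affRefl_inv (c : ι) (j : ℤ) : (affRefl Φ c j)⁻¹ = affRefl Φ c j :=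
  inv_eq_of_mul_eq_one_left (affRefl_mul_self c j)

theorem simpleProd_reverse (L : List b.support) : simpleProd L.reverse = (simpleProd L)⁻¹ := by
  induction L with
  | nil => simp [simpleProd]
  | cons i L ih =>
    rw [List.reverse_cons, simpleProd_append, simpleProd_cons, simpleProd_cons, mul_inv_rev, ih,
      simpleProd_nil, mul_one, affRefl_inv]

theorem exists_simpleProd_affRefl (b : Φ.Base) (a : ι) :
    ∃ L : List b.support, simpleProd L = affRefl Φ a 0 := by
  refine b.induction_reflect (p := fun a => ∃ L : List b.support, simpleProd L = affRefl Φ a 0) a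
    ?_ ?_ ?_
  · rintro i ⟨L, hL⟩
    refine ⟨L, hL.trans ?_⟩
    have := affRefl_ng (Φ := Φ) i 0
    rw [neg_zero] at this
    exact this.symm
  · intro i hi
    exact ⟨[⟨i, hi⟩], by simp [simpleProd]⟩
  · rintro i j ⟨L, hL⟩ hj
    refine ⟨⟨j, hj⟩ :: (L ++ [⟨j, hj⟩]), ?_⟩
    rw [simpleProd_cons, simpleProd_append, hL, simpleProd_cons, simpleProd_nil, mul_one]
    have := mul_affRefl (affRefl_mem (Φ := Φ) j 0) (Φ.reflectionPerm j i) 0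
    rw [pull_affRefl, shift_affRefl, neg_zero, zero_mul, add_zero,
      RootPairing.reflectionPerm_self] at this
    rw [← mul_assoc, this, mul_assoc, affRefl_mul_self, mul_one]

theorem exists_simpleProd (b : Φ.Base) (hw : w ∈ weyl Φ) :
    ∃ L : List b.support, simpleProd L = w := by
  rw [weyl] at hw
  induction hw using Subgroup.closure_induction with
  | mem x hx => obtain ⟨a, rfl⟩ := hx; exact exists_simpleProd_affRefl b a
  | one => exact ⟨[], rfl⟩
  | mul x y _ _ hx hy =>
    obtain ⟨L, rfl⟩ := hx
    obtain ⟨L', rfl⟩ := hy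
    exact ⟨L ++ L', simpleProd_append L L'⟩
  | inv x _ hx =>
    obtain ⟨L, rfl⟩ := hx
    exact ⟨L.reverse, simpleProd_reverse L⟩

theorem isPos_simple (i : b.support) : b.IsPos i := RootPairing.Base.isPos_of_mem_support i.2

theorem pull_mul_simple_inv (hw : w ∈ weyl Φ) (i : ι) :
    pull Φ (w * affRefl Φ i 0)⁻¹ i = ng Φ (pull Φ w⁻¹ i) := by
  rw [mul_inv_rev, affRefl_inv, pull_mul (affRefl_mem _ _) (inv_mem (weyl_le hw)), pull_affRefl]
  exact pull_ng (inv_mem (weyl_le hw)) i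

/-- The exchange property. -/
theorem exists_simpleProd_mul (L : List b.support) (j : b.support)
    (h : ¬ b.IsPos (pull Φ (simpleProd L)⁻¹ j)) :
    ∃ L' : List b.support, L'.length + 1 = L.length ∧
      simpleProd L * affRefl Φ j 0 = simpleProd L' := by
  induction L with
  | nil => rw [simpleProd_nil, inv_one, pull_one] at h; exact absurd (isPos_simple j) h
  | cons i L ih =>
    have hL := weyl_le (simpleProd_mem L)
    by_cases h' : b.IsPos (pull Φ (simpleProd L)⁻¹ j)
    · refine ⟨L, rfl, ?_⟩
      rw [simpleProd_cons, mul_inv_rev, affRefl_inv, pull_mul (inv_mem hL) (affRefl_mem _ _),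
        pull_affRefl] at h
      -- A simple reflection makes only its own simple root negative. Conjugation then gives L s_j =
      -- s_i L, and the first letter i cancels.
      have hij : pull Φ (simpleProd L)⁻¹ j = i := by
        by_contra hne
        exact h (h'.reflectionPerm i.2 hne)
      have := mul_affRefl hL (i : ι) 0
      rw [shift_weyl (simpleProd_mem L), ← hij, pull_pull_inv hL, hij, add_zero] at this
      rw [simpleProd_cons, mul_assoc, this, affRefl_mul_cancel_left]
    · obtain ⟨L', hlen, hprod⟩ := ih h'
      refine ⟨i :: L', by simp [hlen], ?_⟩
      rw [simpleProd_cons, simpleProd_cons, mul_assoc, hprod]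

/-- If a word for w ends in j and w keeps α_j positive, the preceding letters make α_j negative, so
by exchange the word can be shortened. -/
theorem eq_one_of_isPos (hw : w ∈ weyl Φ) (h : ∀ i ∈ b.support, b.IsPos (pull Φ w⁻¹ i)) :
    w = 1 := by
  obtain ⟨L, rfl⟩ := exists_simpleProd b hw
  clear hw
  induction hn : L.length using Nat.strong_induction_on generalizing L with
  | _ n ih =>
    rcases List.eq_nil_or_concat L with rfl | ⟨L₁, j, rfl⟩
    · rfl
    · rw [List.concat_eq_append] at h hn ⊢
      rw [simpleProd_append, simpleProd_cons, simpleProd_nil, mul_one] at h ⊢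
      have h1 := h j j.2
      rw [pull_mul_simple_inv (simpleProd_mem L₁), isPos_ng] at h1
      obtain ⟨L', hlen, hprod⟩ := exists_simpleProd_mul L₁ j h1
      rw [hprod] at h ⊢
      refine ih L'.length ?_ L' h rfl
      simp only [List.length_append, List.length_singleton] at hn
      omega

theorem not_isPos_pull_of_simple (hw : w ∈ weyl Φ) (h : ∀ i ∈ b.support, ¬ b.IsPos (pull Φ w i))
    {a : ι} (ha : b.IsPos a) : ¬ b.IsPos (pull Φ w a) := by
  have h' : ∀ i ∈ b.support, 0 < ev Φ i (-w (heightVector b)) := fun i hi => by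
    rw [map_neg, ev_weyl hw, ← ev_ng, ← isPos_iff_ev, isPos_ng]; exact h i hi
  obtain ⟨i, hi, hle⟩ := exists_le_ev_of_isPos ha fun i hi => (h' i hi).le
  rw [← isPos_ng, isPos_iff_ev, ev_ng, ← ev_weyl hw, ← map_neg]
  exact (h' i hi).trans_le hle

theorem wallRoot_some (w : N ≃ᵃ[ℝ] N) (i : b.support) :
    wallRoot b θ w (some i) = pull Φ w⁻¹ i := rfl

theorem len_mul_simple (hθ : IsHighestRoot b θ) (hw : w ∈ weyl Φ) {i : b.support}
    (h : b.IsPos (pull Φ w⁻¹ i)) : len b θ (w * affRefl Φ i 0) = len b θ w + 1 := by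
  have := len_mul_gen hθ (weyl_le hw) (some i)
  rw [wallRoot_some, lvl_one_of_isPos h, lvl_of_isPos, shift_weyl hw, if_pos le_rfl] at this
  · exact_mod_cast this
  · rw [pull_pull_inv (weyl_le hw)]; exact isPos_simple i

theorem len_mul_simple_of_not (hθ : IsHighestRoot b θ) (hw : w ∈ weyl Φ) {i : b.support}
    (h : ¬ b.IsPos (pull Φ w⁻¹ i)) : len b θ (w * affRefl Φ i 0) + 1 = len b θ w := by
  have := len_mul_gen hθ (weyl_le hw) (some i)
  rw [wallRoot_some, lvl_one_of_not_isPos h, lvl_of_isPos, shift_weyl hw, if_neg (by norm_num),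
    gen] at this
  · omega
  · rw [pull_pull_inv (weyl_le hw)]; exact isPos_simple i

theorem exists_isReducedWord (hθ : IsHighestRoot b θ) (hw : w ∈ weyl Φ) :
    ∃ L : List b.support, IsReducedWord b θ L w := by
  induction hn : len b θ w using Nat.strong_induction_on generalizing w with
  | _ n ih =>
    by_cases h : ∀ i ∈ b.support, b.IsPos (pull Φ w⁻¹ i)
    · obtain rfl := eq_one_of_isPos hw h
      exact ⟨[], rfl, (len_one hθ).symm⟩
    · push Not at h
      obtain ⟨i, hi, h⟩ := h
      have hlen : len b θ (w * affRefl Φ i 0) + 1 = len b θ w :=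
        len_mul_simple_of_not hθ hw (i := ⟨i, hi⟩) h
      obtain ⟨L, hL, hL'⟩ := ih _ (by omega) (mul_mem hw (affRefl_mem_weyl i)) rfl
      refine ⟨L ++ [⟨i, hi⟩], ?_, ?_⟩
      · change simpleProd _ = w
        rw [simpleProd_append, show simpleProd L = _ from hL, simpleProd_cons, simpleProd_nil,
          mul_one, mul_assoc, affRefl_mul_self, mul_one]
      · rw [List.length_append, hL', List.length_singleton]
        exact hlen

/-- A simple root kept positive by w₀ would allow a longer element; negativity on simple roots
passes to all positive roots. -/
theorem IsLongest.not_isPos_pull_inv {w₀ : N ≃ᵃ[ℝ] N} (hθ : IsHighestRoot b θ)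
    (hw₀ : IsLongest b θ w₀) {a : ι} (ha : b.IsPos a) : ¬ b.IsPos (pull Φ w₀⁻¹ a) := by
  refine not_isPos_pull_of_simple (inv_mem hw₀.1) (fun i hi h => ?_) ha
  have h1 := len_mul_simple hθ hw₀.1 (i := ⟨i, hi⟩) h
  have h2 := hw₀.2 _ (mul_mem hw₀.1 (affRefl_mem_weyl i))
  simp only at h1
  omega

theorem IsLongest.not_isPos_pull {w₀ : N ≃ᵃ[ℝ] N} (hθ : IsHighestRoot b θ)
    (hw₀ : IsLongest b θ w₀) {a : ι} (ha : b.IsPos a) : ¬ b.IsPos (pull Φ w₀ a) := fun h => by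
  have := hw₀.not_isPos_pull_inv hθ h
  rw [pull_inv_pull (weyl_le hw₀.1)] at this
  exact this ha

/-! ### The cone of positive coroots -/

theorem nsmul_coroot_mem {a : ι} (ha : b.IsPos a) (n : ℕ) :
    (n : ℝ) • Φ.coroot a ∈ corootCone b := by
  rw [Nat.cast_smul_eq_nsmul]
  exact nsmul_mem (coroot_mem_corootCone ha) n

theorem zsmul_coroot_mem {a : ι} (ha : b.IsPos a) {n : ℤ} (hn : 0 ≤ n) :
    (n : ℝ) • Φ.coroot a ∈ corootCone b := by
  lift n to ℕ using hn
  exact_mod_cast nsmul_coroot_mem ha n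

/-- The linear form on coweights that takes the value `1` at all simple coroots. -/
def coheight (b : Φ.Base) : N →ₗ[ℝ] ℝ := Φ.toLinearMap (heightVector b.flip)

theorem coheight_coroot {i : ι} (hi : i ∈ b.support) : coheight b (Φ.coroot i) = 1 :=
  ev_heightVector_simple (Φ := Φ.flip) b.flip hi

/-- This makes Q⁺ a pointed cone, so that antisymmetry arguments with ±q ∈ Q⁺ are available. -/
theorem coheight_nonneg {q : N} (hq : q ∈ corootCone b) : q = 0 ∨ 0 < coheight b q := by
  induction hq using AddSubmonoid.closure_induction with
  | mem x hx => obtain ⟨i, hi, rfl⟩ := hx; right; rw [coheight_coroot hi]; norm_num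
  | zero => exact Or.inl rfl
  | add x y _ _ hx hy =>
    rcases hx with rfl | hx
    · rwa [zero_add]
    · rcases hy with rfl | hy
      · rw [add_zero]; exact Or.inr hx
      · rw [map_add]; exact Or.inr (add_pos hx hy)

theorem coheight_nonneg' {q : N} (hq : q ∈ corootCone b) : 0 ≤ coheight b q := by
  rcases coheight_nonneg hq with rfl | h
  · rw [map_zero]
  · exact h.le

theorem eq_zero_of_mem_of_neg_mem {q : N} (hq : q ∈ corootCone b) (hq' : -q ∈ corootCone b) :
    q = 0 := by
  rcases coheight_nonneg hq with h | h
  · exact h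
  · have := coheight_nonneg' hq'
    rw [map_neg] at this
    linarith

/-- Write w = w's_i with w shortened by s_i. Then wλ = w'λ − ⟨λ,α_i⟩ w'α_i^∨ with w'α_i positive,
and induction on the word applies to w'. -/
theorem sub_weyl_mem {lam : N} (hlam : IsDominant b lam) (hw : w ∈ weyl Φ) :
    lam - w lam ∈ corootCone b := by
  obtain ⟨L, rfl⟩ := exists_simpleProd b hw
  induction hn : L.length using Nat.strong_induction_on generalizing L with
  | _ n ih =>
    by_cases h : ∀ i ∈ b.support, b.IsPos (pull Φ (simpleProd L)⁻¹ i)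
    · rw [eq_one_of_isPos hw h]
      simp
    · push Not at h
      obtain ⟨i, hi, h⟩ := h
      obtain ⟨L', hlen, hprod⟩ := exists_simpleProd_mul L ⟨i, hi⟩ h
      have h1 := ih L'.length (by omega) L' (simpleProd_mem L') rfl
      have h2 := pull_mul_simple_inv hw i
      rw [hprod] at h2
      have h3 : simpleProd L = simpleProd L' * affRefl Φ i 0 := by
        rw [← hprod, mul_assoc, affRefl_mul_self, mul_one]
      obtain ⟨z, hz⟩ := hlam i hi
      have h4 : simpleProd L lam = simpleProd L' lam - (z : ℝ) • Φ.coroot (pull Φ (simpleProd L')⁻¹ i) := by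
        rw [h3, mul_apply, affRefl_apply', weyl_apply_sub (simpleProd_mem L'),
          weyl_apply_smul (simpleProd_mem L'), weyl_coroot' (simpleProd_mem L'),
          show ev Φ i lam = z from hz, Int.cast_zero, add_zero]
      rw [h4, ← sub_add]
      refine add_mem h1 (nsmul_coroot_mem ?_ z)
      rw [h2, isPos_ng]
      exact h

theorem eq_of_dominant {lam : N} (hlam : IsDominant b lam) (hw : w ∈ weyl Φ)
    (h : ∀ i ∈ b.support, 0 ≤ ev Φ i (w lam)) : w lam = lam := by
  have hd : IsDominant b (w lam) := by
    intro i hi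
    obtain ⟨z, hz⟩ := hlam.isCoweight.exists_int (pull Φ w i)
    have h1 := h i hi
    have h2 := ev_weyl hw i lam
    rw [h2, hz] at h1
    refine ⟨z.toNat, ?_⟩
    have h3 : (0 : ℤ) ≤ z := by exact_mod_cast h1
    change ev Φ i (w lam) = _
    rw [h2, hz]
    exact_mod_cast (Int.toNat_of_nonneg h3).symm
  have h1 := sub_weyl_mem hlam hw
  have h2 := sub_weyl_mem hd (inv_mem hw)
  rw [inv_apply_apply, ← neg_sub] at h2
  exact (sub_eq_zero.1 (eq_zero_of_mem_of_neg_mem h1 h2)).symm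

/-! ### Saturated sets -/

variable {lam ν : N}

theorem mem_saturatedSet : ν ∈ saturatedSet b lam ↔ ∀ w ∈ weyl Φ, lam - w ν ∈ corootCone b := by
  simp only [saturatedSet, Set.mem_iInter, Set.mem_image, SetLike.mem_coe]
  constructor
  · intro h w hw
    obtain ⟨q, hq, hq'⟩ := h w⁻¹ (inv_mem hw)
    rw [← hq', apply_inv_apply, sub_sub_cancel]
    exact hq
  · intro h w hw
    refine ⟨_, h w⁻¹ (inv_mem hw), ?_⟩
    rw [sub_sub_cancel, apply_inv_apply]

theorem weyl_apply_mem_saturatedSet (hw : w ∈ weyl Φ) (h : ν ∈ saturatedSet b lam) :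
    w ν ∈ saturatedSet b lam := by
  rw [mem_saturatedSet] at h ⊢
  exact fun v hv => h (v * w) (mul_mem hv hw)

theorem dominant_mem_saturatedSet (hlam : IsDominant b lam) : lam ∈ saturatedSet b lam :=
  mem_saturatedSet.2 fun _ hw => sub_weyl_mem hlam hw

/-- Π_λ contains the whole string between ν and s_aν. After applying w, compare with wν if wa is
positive and with w s_aν if it is negative. -/
theorem sub_smul_coroot_mem_saturatedSet {a : ι} {z c : ℤ} (h : ν ∈ saturatedSet b lam)
    (hz : ev Φ a ν = z) (hc : 0 ≤ c) (hcz : c ≤ z) :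
    ν - (c : ℝ) • Φ.coroot a ∈ saturatedSet b lam := by
  have h' := weyl_apply_mem_saturatedSet (affRefl_mem_weyl (Φ := Φ) a) h
  rw [affRefl_apply', Int.cast_zero, add_zero, hz] at h'
  rw [mem_saturatedSet] at h h' ⊢
  intro w hw
  rw [weyl_apply_sub hw, weyl_apply_smul hw, weyl_coroot' hw]
  by_cases hpos : b.IsPos (pull Φ w⁻¹ a)
  · rw [← sub_add]
    exact add_mem (h w hw) (zsmul_coroot_mem hpos hc)
  · have h1 := h' w hw
    rw [weyl_apply_sub hw, weyl_apply_smul hw, weyl_coroot' hw] at h1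
    have h2 := add_mem h1 (zsmul_coroot_mem ((isPos_ng b _).2 hpos) (sub_nonneg.2 hcz))
    rw [coroot_ng] at h2
    convert! h2 using 1
    push_cast
    module

theorem sub_smul_coroot_mem_saturatedSet' {a : ι} {z c : ℤ} (h : ν ∈ saturatedSet b lam)
    (hz : ev Φ a ν = z) (hc : c ≤ 0) (hcz : z ≤ c) :
    ν - (c : ℝ) • Φ.coroot a ∈ saturatedSet b lam := by
  have := sub_smul_coroot_mem_saturatedSet (a := ng Φ a) (z := -z) (c := -c) h
    (by rw [ev_ng, hz]; push_cast; rfl) (by omega) (by omega)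
  rw [coroot_ng] at this
  push_cast at this
  rwa [neg_smul_neg] at this

theorem saturatedSet_exists_int (hlam : IsDominant b lam) (h : ν ∈ saturatedSet b lam) (a : ι) :
    ∃ z : ℤ, ev Φ a ν = z := by
  have h1 := mem_saturatedSet.1 h 1 (one_mem _)
  rw [AffineEquiv.coe_one, id] at h1
  have h2 : ∀ q ∈ corootCone b, ∃ z : ℤ, ev Φ a q = z := by
    intro q hq
    induction hq using AddSubmonoid.closure_induction with
    | mem x hx => obtain ⟨i, hi, rfl⟩ := hx; exact ⟨_, ev_coroot a i⟩
    | zero => exact ⟨0, by simp⟩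
    | add x y _ _ hx hy =>
      obtain ⟨z, hz⟩ := hx
      obtain ⟨z', hz'⟩ := hy
      exact ⟨z + z', by rw [map_add, hz, hz']; push_cast; rfl⟩
  obtain ⟨z, hz⟩ := h2 _ h1
  obtain ⟨z', hz'⟩ := hlam.isCoweight.exists_int a
  rw [map_sub, hz'] at hz
  exact ⟨z' - z, by push_cast; linarith⟩

/-- Testing membership with w = s_i turns −mα_i^∨ into +mα_i^∨, whose coheight m is then bounded.
Without this bound the natural supremum defining `maxStep` would be the default 0. -/
theorem bddAbove_maxStep {i : ι} (hi : i ∈ b.support) :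
    BddAbove {m : ℕ | ν - m • Φ.coroot i ∈ saturatedSet b lam} := by
  refine ⟨⌊coheight b (lam - affRefl Φ i 0 ν)⌋₊, fun m hm => Nat.le_floor ?_⟩
  have h := mem_saturatedSet.1 hm _ (affRefl_mem_weyl i)
  have h1 := coheight_nonneg' h
  rw [weyl_apply_sub (affRefl_mem_weyl i), ← Nat.cast_smul_eq_nsmul ℝ,
    weyl_apply_smul (affRefl_mem_weyl i), weyl_coroot' (affRefl_mem_weyl i), affRefl_inv,
    pull_affRefl, show Φ.coroot (Φ.reflectionPerm i i) = -Φ.coroot i from coroot_ng i, ← sub_add,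
    map_add, map_smul, map_neg, coheight_coroot hi, smul_eq_mul] at h1
  linarith

theorem maxStep_mem {i : ι} (hi : i ∈ b.support) (h : ν ∈ saturatedSet b lam) :
    ν - maxStep b lam ν i • Φ.coroot i ∈ saturatedSet b lam :=
  Nat.sSup_mem (s := {m : ℕ | ν - m • Φ.coroot i ∈ saturatedSet b lam}) ⟨0, by simpa using h⟩
    (bddAbove_maxStep hi)

theorem le_maxStep {i : ι} (hi : i ∈ b.support) {m : ℕ}
    (h : ν - m • Φ.coroot i ∈ saturatedSet b lam) : m ≤ maxStep b lam ν i :=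
  le_csSup (bddAbove_maxStep hi) h

end AlcoveWalks

end

/-! ### Extremal points of Π_λ: maximal strings along a word of w₀ end at w₀λ. -/

noncomputable section

namespace AlcoveWalks

variable {ι M N : Type*} [Fintype ι] [AddCommGroup M] [Module ℝ M] [AddCommGroup N] [Module ℝ N]
  {Φ : RootPairing ι ℝ M N} [Φ.IsRootSystem] [Φ.IsCrystallographic] [Φ.IsReduced]
  {b : Φ.Base} {θ : ι} {v w : N ≃ᵃ[ℝ] N} {lam μ : N}

/-! ### Descending along maximal strings in a saturated set -/

/-- The monoid generated by the positive coroots that `v` makes negative. -/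
def inversionCone (b : Φ.Base) (v : N ≃ᵃ[ℝ] N) : AddSubmonoid N :=
  AddSubmonoid.closure (Φ.coroot '' {β | b.IsPos β ∧ ¬ b.IsPos (pull Φ v⁻¹ β)})

theorem coroot_mem_inversionCone {β : ι} (h : b.IsPos β) (h' : ¬ b.IsPos (pull Φ v⁻¹ β)) :
    Φ.coroot β ∈ inversionCone b v :=
  AddSubmonoid.subset_closure ⟨β, ⟨h, h'⟩, rfl⟩

theorem inversionCone_le : inversionCone b v ≤ corootCone b := by
  rw [inversionCone, AddSubmonoid.closure_le]
  rintro _ ⟨β, hβ, rfl⟩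
  exact coroot_mem_corootCone hβ.1

/-- The coroot string through β^∨ contains β^∨ − dα_i^∨. It stays positive because only the
α_i-coefficient changes, and v makes it negative because vβ is negative and vα_i positive. -/
theorem coroot_sub_nsmul_mem_inversionCone (hv : v ∈ weyl Φ) {i : ι} (hi : i ∈ b.support)
    (hvi : b.IsPos (pull Φ v⁻¹ i)) {β : ι} (h : b.IsPos β) (h' : ¬ b.IsPos (pull Φ v⁻¹ β))
    {d : ℕ} (hd : (d : ℤ) ≤ pr Φ i β) :
    Φ.coroot β - d • Φ.coroot i ∈ inversionCone b v := by
  have hne : i ≠ β := by rintro rfl; exact h' hvi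
  have hne' : Φ.flip.root i ≠ -Φ.flip.root β := by
    intro e
    have : i = ng Φ β := Φ.coroot.injective (by rw [coroot_ng]; exact e)
    have h1 := RootPairing.Base.isPos_of_mem_support hi
    rw [this, isPos_ng] at h1
    exact h1 h
  have := Module.IsReflexive.of_isPerfPair Φ.toLinearMap
  have := Module.IsReflexive.of_isPerfPair Φ.toLinearMap.flip
  have hlin := RootPairing.IsReduced.linearIndependent Φ.flip hne hne'
  have hchain := RootPairing.chainBotCoeff_sub_chainTopCoeff hlin
  have hmem : Φ.flip.root β - d • Φ.flip.root i ∈ Set.range Φ.flip.root := by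
    rw [RootPairing.root_sub_nsmul_mem_range_iff_le_chainBotCoeff hlin]
    have : pr Φ i β = Φ.flip.pairingIn ℤ β i := rfl
    omega
  obtain ⟨γ, hγ⟩ := hmem
  have hγ1 : Φ.flip.root γ = Φ.flip.root β + (-(d : ℤ)) • Φ.flip.root i := by
    rw [hγ, neg_smul, natCast_zsmul, sub_eq_add_neg]
  have hpos : b.IsPos γ := by
    rw [← isPos_flip_iff]
    exact RootPairing.Base.IsPos.add_zsmul hne.symm ((isPos_flip_iff β).2 h) hi hγ1
  have hneg : ¬ b.IsPos (pull Φ v⁻¹ γ) := by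
    have hγ2 : Φ.flip.root (pull Φ v⁻¹ γ) =
        Φ.flip.root (pull Φ v⁻¹ β) + (-(d : ℤ)) • Φ.flip.root (pull Φ v⁻¹ i) := by
      change Φ.coroot _ = Φ.coroot _ + _ • Φ.coroot _
      rw [← weyl_coroot' hv, ← weyl_coroot' hv, ← weyl_coroot' hv]
      rw [show Φ.coroot γ = Φ.coroot β + (-(d : ℤ)) • Φ.coroot i from hγ1,
        ← Int.cast_smul_eq_zsmul ℝ, ← Int.cast_smul_eq_zsmul ℝ, weyl_apply_add hv,
        weyl_apply_smul hv]
    have e := b.flip.height_add_zsmul hγ2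
    rw [← isPos_flip_iff, RootPairing.Base.isPos_iff] at h' hvi ⊢
    rw [e, smul_eq_mul]
    nlinarith
  have := coroot_mem_inversionCone hpos hneg
  rwa [show Φ.coroot γ = Φ.coroot β - d • Φ.coroot i from hγ] at this

theorem sub_nsmul_mem_inversionCone (hv : v ∈ weyl Φ) {i : ι} (hi : i ∈ b.support)
    (hvi : b.IsPos (pull Φ v⁻¹ i)) {η : N} (hη : η ∈ inversionCone b v) :
    ∃ z : ℤ, ev Φ i η = z ∧ ∀ d : ℕ, (d : ℤ) ≤ max 0 z → η - d • Φ.coroot i ∈ inversionCone b v := by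
  induction hη using AddSubmonoid.closure_induction with
  | mem x hx =>
    obtain ⟨β, hβ, rfl⟩ := hx
    refine ⟨_, ev_coroot i β, fun d hd => ?_⟩
    by_cases h0 : d = 0
    · rw [h0, zero_smul, sub_zero]
      exact coroot_mem_inversionCone hβ.1 hβ.2
    · exact coroot_sub_nsmul_mem_inversionCone hv hi hvi hβ.1 hβ.2 (by omega)
  | zero =>
    refine ⟨0, by simp, fun d hd => ?_⟩
    obtain rfl : d = 0 := by omega
    rw [zero_smul, sub_zero]
    exact zero_mem _
  | add x y _ _ hx hy =>
    obtain ⟨z, hz, hz'⟩ := hx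
    obtain ⟨t, ht, ht'⟩ := hy
    refine ⟨z + t, by rw [map_add, hz, ht]; push_cast; rfl, fun d hd => ?_⟩
    -- Split d: the first summand takes as much as its own value at α_i allows, the second takes the
    -- rest, since max 0 (z+t) ≤ max 0 z + max 0 t.
    have h1 := hz' (min d (max 0 z).toNat) (by omega)
    have h2 := ht' (d - min d (max 0 z).toNat) (by omega)
    have h3 : d = min d (max 0 z).toNat + (d - min d (max 0 z).toNat) := by omega
    rw [h3, add_smul, add_sub_add_comm]
    exact add_mem h1 h2

/-- A positive root made negative by v s_i is either α_i or the s_i-image of a positive root made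
negative by v. -/
theorem exists_of_mem_inversionCone_mul (hv : v ∈ weyl Φ) {i : ι} (hi : i ∈ b.support) {κ : N}
    (hκ : κ ∈ inversionCone b (v * affRefl Φ i 0)) :
    ∃ (n : ℕ) (η : N), η ∈ inversionCone b v ∧ κ = n • Φ.coroot i + affRefl Φ i 0 η := by
  induction hκ using AddSubmonoid.closure_induction with
  | mem x hx =>
    obtain ⟨γ, ⟨hγ, hγ'⟩, rfl⟩ := hx
    by_cases h : γ = i
    · exact ⟨1, 0, zero_mem _, by rw [weyl_apply_zero (affRefl_mem_weyl i), h]; simp⟩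
    · refine ⟨0, Φ.coroot (Φ.reflectionPerm i γ), coroot_mem_inversionCone ?_ ?_, ?_⟩
      · exact hγ.reflectionPerm hi h
      · rwa [mul_inv_rev, affRefl_inv, pull_mul (affRefl_mem _ _) (inv_mem (weyl_le hv)),
          pull_affRefl] at hγ'
      · rw [zero_smul, zero_add, ← pull_affRefl i 0, weyl_coroot (affRefl_mem_weyl i)]
  | zero => exact ⟨0, 0, zero_mem _, by rw [weyl_apply_zero (affRefl_mem_weyl i)]; simp⟩
  | add x y _ _ hx hy =>
    obtain ⟨n, η, hη, rfl⟩ := hx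
    obtain ⟨n', η', hη', rfl⟩ := hy
    refine ⟨n + n', η + η', add_mem hη hη', ?_⟩
    rw [weyl_apply_add (affRefl_mem_weyl i)]
    module

/-- If ⟨μ,α_i⟩ ≥ 0, the reflected point s_iμ = μ − ⟨μ,α_i⟩α_i^∨ already lies in Π_λ. -/
theorem ev_le_maxStep (hlam : IsDominant b lam) {i : ι} (hi : i ∈ b.support)
    (hμ : μ ∈ saturatedSet b lam) : ev Φ i μ ≤ maxStep b lam μ i := by
  obtain ⟨z, hz⟩ := saturatedSet_exists_int hlam hμ i
  rw [hz]
  by_cases h : 0 ≤ z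
  · have h1 := sub_smul_coroot_mem_saturatedSet hμ hz h le_rfl
    lift z to ℕ using h
    rw [Int.cast_natCast, Nat.cast_smul_eq_nsmul] at h1
    exact_mod_cast le_maxStep hi h1
  · exact le_trans (Int.cast_nonpos.2 (by omega)) (Nat.cast_nonneg _)

/-- The point `μ` is extremal in the saturated set with respect to the inversions of `v`. -/
def IsExtremal (b : Φ.Base) (lam : N) (v : N ≃ᵃ[ℝ] N) (μ : N) : Prop :=
  ∀ X ∈ saturatedSet b lam, μ - X ∈ inversionCone b v → X = μ

/-- A competitor X below μ − mα_i^∨ is first pushed along its α_i-string to a competitor below μ.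
Extremality of μ then puts X on the line μ + ℤα_i^∨, where the choice of m decides. -/
theorem IsExtremal.sub_maxStep (hlam : IsDominant b lam) (hv : v ∈ weyl Φ) {i : ι}
    (hi : i ∈ b.support) (hvi : b.IsPos (pull Φ v⁻¹ i)) (hμ : μ ∈ saturatedSet b lam)
    (h : IsExtremal b lam v μ) :
    IsExtremal b lam (v * affRefl Φ i 0) (μ - maxStep b lam μ i • Φ.coroot i) := by
  intro X hX hmem
  have hmax : ∀ m : ℕ, μ - m • Φ.coroot i ∈ saturatedSet b lam → m ≤ maxStep b lam μ i :=
    fun m hm => le_maxStep hi hm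
  have hev := ev_le_maxStep hlam hi hμ
  generalize maxStep b lam μ i = m at *
  obtain ⟨n, η, hη, hκ⟩ := exists_of_mem_inversionCone_mul hv hi hmem
  obtain ⟨z, hz, hshrink⟩ := sub_nsmul_mem_inversionCone hv hi hvi hη
  have hXe : X = μ - η + ((z - n - m : ℤ) : ℝ) • Φ.coroot i := by
    rw [affRefl_apply', hz, Int.cast_zero, add_zero, ← Nat.cast_smul_eq_nsmul ℝ,
      ← Nat.cast_smul_eq_nsmul ℝ] at hκ
    have : X = μ - (m : ℝ) • Φ.coroot i - ((n : ℝ) • Φ.coroot i + (η - (z : ℝ) • Φ.coroot i)) := by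
      rw [← hκ]; abel
    rw [this]
    push_cast
    module
  obtain ⟨k, hk⟩ : ∃ k : ℤ, X = μ + (k : ℝ) • Φ.coroot i := by
    -- If the coefficient is nonnegative, it is at most z, so it can be absorbed into η without
    -- leaving the cone.
    by_cases ht : 0 ≤ z - n - m
    · refine ⟨0, ?_⟩
      rw [Int.cast_zero, zero_smul, add_zero]
      apply h X hX
      have := hshrink (z - n - m).toNat (by omega)
      rw [← Nat.cast_smul_eq_nsmul ℝ, ← Int.cast_natCast, Int.toNat_of_nonneg ht] at this
      rw [hXe]
      convert! this using 1
      abel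
    · refine ⟨z - n - m, ?_⟩
      obtain ⟨e, he⟩ := saturatedSet_exists_int hlam hX i
      -- With e = ⟨X,α_i⟩ = ⟨μ,α_i⟩ + z − 2n − 2m and ⟨μ,α_i⟩ ≤ m, the point μ − η lies on the
      -- string from X to s_iX, hence in Π_λ.
      have hle : e ≤ z - n - m := by
        have h1 := he
        rw [hXe, map_add, map_sub, map_smul, ev_coroot, pr_self, hz] at h1
        simp only [smul_eq_mul] at h1
        push_cast at h1
        have : (e : ℝ) ≤ ((z - n - m : ℤ) : ℝ) := by
          push_cast
          have : (0 : ℝ) ≤ n := Nat.cast_nonneg n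
          linarith
        exact_mod_cast this
      have h1 := sub_smul_coroot_mem_saturatedSet' hX he (by omega) hle
      have h2 : X - ((z - n - m : ℤ) : ℝ) • Φ.coroot i = μ - η := by rw [hXe]; abel
      rw [h2] at h1
      have h3 := h _ h1 (by rwa [sub_sub_cancel])
      rw [hXe, h3]
  -- Maximality of m bounds X from below; the cone condition bounds it from above, and pointedness
  -- gives equality.
  have hkm : -(m : ℤ) ≤ k := by
    by_contra! hcon
    have := hmax (-k).toNat (by
      rw [← Nat.cast_smul_eq_nsmul ℝ, ← Int.cast_natCast, Int.toNat_of_nonneg (by omega)]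
      push_cast
      rw [neg_smul, sub_neg_eq_add, ← hk]
      exact hX)
    omega
  have hpos : b.IsPos i := RootPairing.Base.isPos_of_mem_support hi
  have h1 := zsmul_coroot_mem hpos (n := m + k) (by omega)
  have h2 := inversionCone_le hmem
  have h3 : μ - m • Φ.coroot i - X = -(((m + k : ℤ) : ℝ) • Φ.coroot i) := by
    rw [hk, ← Nat.cast_smul_eq_nsmul ℝ]; push_cast; module
  rw [h3] at h2
  have h4 := eq_zero_of_mem_of_neg_mem h1 h2
  rw [h4, neg_zero, sub_eq_zero] at h3
  exact h3.symm

/-- The end point of the descent along maximal strings in the directions given by a word. -/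
def descend (b : Φ.Base) (lam : N) : N → List b.support → N
  | μ, [] => μ
  | μ, i :: word => descend b lam (μ - maxStep b lam μ i • Φ.coroot i) word

theorem len_mul_simpleProd_le (hθ : IsHighestRoot b θ) (hv : v ∈ weyl Φ) (L : List b.support) :
    len b θ (v * simpleProd L) ≤ len b θ v + L.length := by
  induction L generalizing v with
  | nil => rw [simpleProd_nil, mul_one]; exact le_rfl
  | cons i L ih =>
    have h1 := ih (mul_mem hv (affRefl_mem_weyl (Φ := Φ) i))
    have h2 := len_mul_gen_le hθ (weyl_le hv) (some i)
    rw [gen] at h2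
    rw [simpleProd_cons, ← mul_assoc, List.length_cons]
    omega

theorem IsExtremal.descend (hθ : IsHighestRoot b θ) (hlam : IsDominant b lam) (hv : v ∈ weyl Φ)
    (hμ : μ ∈ saturatedSet b lam) (h : IsExtremal b lam v μ) (L : List b.support)
    (hL : len b θ (v * simpleProd L) = len b θ v + L.length) :
    IsExtremal b lam (v * simpleProd L) (descend b lam μ L) ∧
      AlcoveWalks.descend b lam μ L ∈ saturatedSet b lam := by
  induction L generalizing v μ with
  | nil => rw [simpleProd_nil, mul_one]; exact ⟨h, hμ⟩
  | cons i L ih =>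
    have hv' := mul_mem hv (affRefl_mem_weyl (Φ := Φ) i)
    have hle := len_mul_simpleProd_le hθ hv' L
    rw [simpleProd_cons, ← mul_assoc, List.length_cons] at hL
    have hpos : b.IsPos (pull Φ v⁻¹ i) := by
      by_contra hcon
      have := len_mul_simple_of_not hθ hv hcon
      omega
    have hlen := len_mul_simple hθ hv hpos
    rw [simpleProd_cons, ← mul_assoc]
    exact ih hv' (maxStep_mem i.2 hμ) (h.sub_maxStep hlam hv i.2 hpos hμ) (by omega)

/-- For v = 1 the cone is zero and every point is extremal. For w₀ the cone reaches w₀λ from every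
point of Π_λ, so extremality of the end point identifies it. -/
theorem descend_longest {w₀ : N ≃ᵃ[ℝ] N} (hθ : IsHighestRoot b θ) (hw₀ : IsLongest b θ w₀)
    (hlam : IsDominant b lam) (hμ : μ ∈ saturatedSet b lam) {L : List b.support}
    (hL : IsReducedWord b θ L w₀) : descend b lam μ L = w₀ lam := by
  have h1 : IsExtremal b lam (1 : N ≃ᵃ[ℝ] N) μ := by
    intro X _ hX
    have : inversionCone b (1 : N ≃ᵃ[ℝ] N) = ⊥ := by
      rw [inversionCone, eq_bot_iff, AddSubmonoid.closure_le]
      rintro _ ⟨β, hβ, rfl⟩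
      rw [Set.mem_ofPred_eq, inv_one, pull_one] at hβ
      exact absurd hβ.1 hβ.2
    rw [this, AddSubmonoid.mem_bot, sub_eq_zero] at hX
    exact hX.symm
  have hprod : simpleProd L = w₀ := hL.1
  obtain ⟨h2, h3⟩ := h1.descend hθ hlam (one_mem _) hμ L (by
    rw [one_mul, hprod, len_one hθ, zero_add, hL.2])
  rw [one_mul, hprod] at h2
  refine (h2 _ (weyl_apply_mem_saturatedSet hw₀.1 (dominant_mem_saturatedSet hlam)) ?_).symm
  have h4 := mem_saturatedSet.1 h3 w₀⁻¹ (inv_mem hw₀.1)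
  -- As w₀ exchanges positive and negative roots, −w₀ carries Q⁺ into the inversion cone of w₀.
  have h5 : ∀ q ∈ corootCone b, -w₀ q ∈ inversionCone b w₀ := by
    intro q hq
    induction hq using AddSubmonoid.closure_induction with
    | mem x hx =>
      obtain ⟨i, hi, rfl⟩ := hx
      rw [weyl_coroot' hw₀.1, ← coroot_ng]
      have h6 : b.IsPos (ng Φ (pull Φ w₀⁻¹ i)) := (isPos_ng b _).2
        (hw₀.not_isPos_pull_inv hθ (RootPairing.Base.isPos_of_mem_support hi))
      exact coroot_mem_inversionCone h6 (hw₀.not_isPos_pull_inv hθ h6)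
    | zero => rw [weyl_apply_zero hw₀.1, neg_zero]; exact zero_mem _
    | add x y _ _ hx hy => rw [weyl_apply_add hw₀.1, neg_add]; exact add_mem hx hy
  have h6 := h5 _ h4
  rwa [weyl_apply_sub hw₀.1, apply_inv_apply, neg_sub] at h6

end AlcoveWalks

end

/-! ### Reduced words, Bruhat order, and step counts for alcove walks. -/

noncomputable section

namespace AlcoveWalks

variable {ι M N : Type*} [Fintype ι] [AddCommGroup M] [Module ℝ M] [AddCommGroup N] [Module ℝ N]
  {Φ : RootPairing ι ℝ M N} [Φ.IsRootSystem] [Φ.IsCrystallographic] [Φ.IsReduced]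
  {b : Φ.Base} {θ : ι} {x y w γ : N ≃ᵃ[ℝ] N} {lam : N} {word : List (Option b.support)}

/-! ### Reduced words -/

/-- The product of the generators along a word. -/
def genProd (b : Φ.Base) (θ : ι) (L : List (Option b.support)) : N ≃ᵃ[ℝ] N :=
  (L.map (gen b θ)).prod

theorem genProd_append (L L' : List (Option b.support)) :
    genProd b θ (L ++ L') = genProd b θ L * genProd b θ L' := by simp [genProd]

theorem genProd_cons (s : Option b.support) (L : List (Option b.support)) :
    genProd b θ (s :: L) = gen b θ s * genProd b θ L := by simp [genProd]

theorem genProd_mem (L : List (Option b.support)) : genProd b θ L ∈ rootAut Φ := by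
  refine list_prod_mem fun x hx => ?_
  obtain ⟨s, -, rfl⟩ := List.mem_map.1 hx
  exact gen_mem s

theorem genProd_take_succ {k : ℕ} {s : Option b.support} (h : word[k]? = some s) :
    genProd b θ (word.take (k + 1)) = genProd b θ (word.take k) * gen b θ s := by
  rw [List.take_add_one, h, genProd_append]
  simp [genProd]

theorem genProd_take_succ_of_none {k : ℕ} (h : word[k]? = none) :
    genProd b θ (word.take (k + 1)) = genProd b θ (word.take k) := by
  rw [List.take_add_one, h]
  simp

theorem len_genProd_take_le (hθ : IsHighestRoot b θ) (word : List (Option b.support)) (k d : ℕ) :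
    len b θ (genProd b θ (word.take (k + d))) ≤ len b θ (genProd b θ (word.take k)) + d := by
  induction d with
  | zero => exact le_rfl
  | succ d ih =>
    rw [← add_assoc]
    cases h : word[k + d]? with
    | none => rw [genProd_take_succ_of_none h]; omega
    | some s =>
      rw [genProd_take_succ h]
      have := len_mul_gen_le hθ (genProd_mem (θ := θ) (word.take (k + d))) s
      omega

/-- Each step of a reduced word leads away from the fundamental alcove. -/
theorem IsReducedExpr.lvl_le (hθ : IsHighestRoot b θ) (h : IsReducedExpr b θ word γ w) {k : ℕ}
    {s : Option b.support} (hs : word[k]? = some s) :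
    lvl b (genProd b θ (word.take k)) (wallRoot b θ (genProd b θ (word.take k)) s) ≤
      lvl b (1 : N ≃ᵃ[ℝ] N) (wallRoot b θ (genProd b θ (word.take k)) s) := by
  have hk : k < word.length := (List.getElem?_eq_some_iff.1 hs).1
  have hlen : len b θ (genProd b θ word) = word.length := by
    rw [← len_mul_lengthZero hθ (genProd_mem word) h.1, h.2.2]
    exact congrArg _ h.2.1
  -- Each letter adds at most one to the length and the total equals the number of letters, so no
  -- letter can decrease it.
  have h1 := len_genProd_take_le hθ word 0 k
  have h2 := len_genProd_take_le hθ word (k + 1) (word.length - (k + 1))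
  rw [List.take_of_length_le (by omega), hlen] at h2
  rw [List.take_zero, zero_add, show genProd b θ [] = 1 from rfl, len_one hθ] at h1
  have h3 := len_mul_gen hθ (genProd_mem (θ := θ) (word.take k)) s
  rw [genProd_take_succ hs] at h2
  split_ifs at h3 with h4
  · exact h4
  · omega

/-- A reduced word never crosses a hyperplane twice. -/
theorem IsReducedExpr.lvl_lt (hθ : IsHighestRoot b θ) (h : IsReducedExpr b θ word γ w) {k : ℕ}
    {s : Option b.support} (hs : word[k]? = some s) {l : ℕ} (hl : k + 1 ≤ l) :
    lvl b (genProd b θ (word.take l)) (wallRoot b θ (genProd b θ (word.take k)) s) <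
      lvl b (genProd b θ (word.take k)) (wallRoot b θ (genProd b θ (word.take k)) s) := by
  have hle := h.lvl_le hθ hs
  have h1 := lvl_wallRoot hθ (genProd_mem (θ := θ) (word.take k)) s
  have h2 := lvl_mul_gen_wallRoot hθ (genProd_mem (θ := θ) (word.take k)) s
  rw [← genProd_take_succ hs] at h2
  generalize wallRoot b θ (genProd b θ (word.take k)) s = c at *
  generalize wallLevel b θ (genProd b θ (word.take k)) s = j at *
  induction l, hl using Nat.le_induction with
  | base => omega
  | succ l hl ih =>
    cases ht : word[l]? with
    | none => rwa [genProd_take_succ_of_none ht]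
    | some t =>
      by_contra! hcon
      rw [genProd_take_succ ht] at hcon
      have hx := genProd_mem (θ := θ) (word.take l)
      have h3 := h.lvl_le hθ ht
      generalize genProd b θ (word.take l) = x at *
      -- Returning to the first side would cross the same wall towards c₀, against `lvl_le` for
      -- letter l.
      have h4 := eq_wall (s := t) (a := c) (k := j) hθ (mul_mem hx (gen_mem (θ := θ) t))
        (by omega) (by rw [mul_gen_mul_gen]; omega)
      rw [(wall_mul_gen hθ hx t).1] at h4
      have h5 : wallRoot b θ x t = ng Φ c := eq_ng_iff.2 h4.1.symm
      rw [h5, lvl_ng hx, lvl_ng (one_mem _)] at h3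
      omega

/-- Every wall met by a reduced word still separates its end from c₀. This selects the roots to
which the sign hypothesis of `Walk.folds_le` applies. -/
theorem IsReducedExpr.lvl_final (hθ : IsHighestRoot b θ) (h : IsReducedExpr b θ word γ w) {k : ℕ}
    {s : Option b.support} (hs : word[k]? = some s) :
    lvl b w (wallRoot b θ (genProd b θ (word.take k)) s) <
      lvl b (1 : N ≃ᵃ[ℝ] N) (wallRoot b θ (genProd b θ (word.take k)) s) := by
  have hk : k < word.length := (List.getElem?_eq_some_iff.1 hs).1
  have h1 := h.lvl_lt hθ hs (l := word.length) hk
  rw [List.take_length] at h1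
  have h2 : genProd b θ word * γ = w := h.2.1
  rw [← h2, lvl_mul_lengthZero hθ (genProd_mem word) h.1]
  exact h1.trans_le (h.lvl_le hθ hs)

/-! ### The Bruhat order -/

/-- The element `x` is obtained from `y` by a reflection that moves it closer to `1`. -/
def BruhatStep (b : Φ.Base) (y x : N ≃ᵃ[ℝ] N) : Prop :=
  ∃ a k, x = affRefl Φ a k * y ∧ -k ≤ lvl b (1 : N ≃ᵃ[ℝ] N) a ∧ lvl b y a < -k

/-- The Bruhat order. -/
def BruhatLE (b : Φ.Base) (w x : N ≃ᵃ[ℝ] N) : Prop := Relation.ReflTransGen (BruhatStep b) w x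

theorem BruhatLE.mem (hw : w ∈ rootAut Φ) (h : BruhatLE b w x) : x ∈ rootAut Φ := by
  induction h with
  | refl => exact hw
  | tail _ h ih =>
    obtain ⟨a, k, rfl, -, -⟩ := h
    exact mul_mem (affRefl_mem a k) ih

theorem bruhatStep_gen (hθ : IsHighestRoot b θ) (hw : w ∈ rootAut Φ) {s : Option b.support}
    (h : lvl b w (wallRoot b θ w s) ≤ lvl b (1 : N ≃ᵃ[ℝ] N) (wallRoot b θ w s)) :
    BruhatStep b (w * gen b θ s) w := by
  refine ⟨wallRoot b θ w s, wallLevel b θ w s, ?_, ?_, ?_⟩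
  · rw [mul_gen hw, affRefl_mul_cancel_left]
  · rwa [← lvl_wallRoot hθ hw]
  · rw [lvl_mul_gen_wallRoot hθ hw]; omega

/-- The lifting property. -/
theorem BruhatLE.mul_gen (hθ : IsHighestRoot b θ) (hw : w ∈ rootAut Φ) {s : Option b.support}
    (h : lvl b w (wallRoot b θ w s) ≤ lvl b (1 : N ≃ᵃ[ℝ] N) (wallRoot b θ w s))
    (hx : BruhatLE b w x) : BruhatLE b (w * gen b θ s) (x * gen b θ s) := by
  induction hx with
  | refl => exact Relation.ReflTransGen.refl
  | @tail y x hwy hyx ih =>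
    obtain ⟨a, k, rfl, h1, h2⟩ := hyx
    have hy := BruhatLE.mem hw hwy
    by_cases h3 : lvl b (y * gen b θ s) a < -k
    · exact ih.tail ⟨a, k, by rw [mul_assoc], h1, h3⟩
    -- Otherwise the reflecting hyperplane is the wall between y and ys, so the reflected element
    -- times s is y itself, and ws → w → y.
    · have h4 := eq_wall (s := s) (a := a) (k := k) hθ (mul_mem hy (gen_mem (θ := θ) s))
        (by omega) (by rw [mul_gen_mul_gen]; exact h2)
      have h5 := AlcoveWalks.mul_gen (θ := θ) (mul_mem hy (gen_mem (θ := θ) s)) s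
      rw [mul_gen_mul_gen, ← h4.1, ← h4.2] at h5
      rw [mul_assoc, ← h5]
      exact Relation.ReflTransGen.head (bruhatStep_gen hθ hw h) hwy

theorem BruhatLE.mul_lengthZero (hθ : IsHighestRoot b θ) (hw : w ∈ rootAut Φ)
    (hγ : γ ∈ lengthZero b θ) (hx : BruhatLE b w x) : BruhatLE b (w * γ) (x * γ) := by
  induction hx with
  | refl => exact Relation.ReflTransGen.refl
  | @tail y x hwy hyx ih =>
    obtain ⟨a, k, rfl, h1, h2⟩ := hyx
    refine ih.tail ⟨a, k, by rw [mul_assoc], h1, ?_⟩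
    rwa [lvl_mul_lengthZero hθ (BruhatLE.mem hw hwy) hγ]

/-- The hyperplane separates y c₀ from c₀, so k ≥ 0 and ⟨y(0),a⟩ ≤ −k. The reflected point thus lies
on the string between y(0) and its linear reflection. -/
theorem BruhatLE.apply_zero_mem (hw : w ∈ rootAut Φ) (h : BruhatLE b w x)
    (h0 : w 0 ∈ saturatedSet b lam) : x 0 ∈ saturatedSet b lam := by
  induction h with
  | refl => exact h0
  | @tail y x hwy hyx ih =>
    obtain ⟨a, k, rfl, h1, h2⟩ := hyx
    have hy := BruhatLE.mem hw hwy
    rw [mul_apply, affRefl_apply', ← shift_eq hy, ← Int.cast_add]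
    have h3 := shift_le_lvl_add_one (b := b) y a
    have h4 : 0 ≤ k := by
      have := lvl_le_shift (b := b) (1 : N ≃ᵃ[ℝ] N) a
      rw [shift_one] at this
      omega
    exact sub_smul_coroot_mem_saturatedSet' ih (shift_eq hy a).symm (by omega) (by omega)

/-! ### Steps of alcove walks -/

namespace Walk

variable {p : Walk b} {k : ℕ} {s : Option b.support} {a : ι} {j : ℤ}

theorem pos_zero : p.pos θ 0 = 1 := rfl

theorem pos_succ_cross (h : p.steps[k]? = some (s, .cross)) :
    p.pos θ (k + 1) = p.pos θ k * gen b θ s := by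
  rw [pos, pos, List.take_add_one, h]
  simp

theorem pos_succ_fold (h : p.steps[k]? = some (s, .fold)) : p.pos θ (k + 1) = p.pos θ k := by
  rw [pos, pos, List.take_add_one, h]
  simp

theorem pos_succ_none (h : p.steps[k]? = none) : p.pos θ (k + 1) = p.pos θ k := by
  rw [pos, pos, List.take_add_one, h]
  simp

theorem pos_mem (p : Walk b) (k : ℕ) : p.pos θ k ∈ rootAut Φ := by
  induction k with
  | zero => exact one_mem _
  | succ k ih =>
    cases h : p.steps[k]? with
    | none => rwa [pos_succ_none h]
    | some st =>
      obtain ⟨s, _ | _⟩ := st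
      · rw [pos_succ_cross h]; exact mul_mem ih (gen_mem s)
      · rwa [pos_succ_fold h]

theorem negCrossingOn_iff (hθ : IsHighestRoot b θ) : p.NegCrossingOn θ k a j ↔
    ∃ s, p.steps[k]? = some (s, .cross) ∧ a = wallRoot b θ (p.pos θ k) s ∧
      j = wallLevel b θ (p.pos θ k) s := by
  simp only [NegCrossingOn, onPos_onNeg_iff hθ (pos_mem p k)]

theorem posFoldOn_iff (hθ : IsHighestRoot b θ) : p.PosFoldOn θ k a j ↔
    ∃ s, p.steps[k]? = some (s, .fold) ∧ a = wallRoot b θ (p.pos θ k) s ∧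
      j = wallLevel b θ (p.pos θ k) s := by
  simp only [PosFoldOn, onPos_onNeg_iff hθ (pos_mem p k)]

theorem posCrossingOn_iff (hθ : IsHighestRoot b θ) : p.PosCrossingOn θ k a j ↔
    ∃ s, p.steps[k]? = some (s, .cross) ∧ a = ng Φ (wallRoot b θ (p.pos θ k) s) ∧
      j = -wallLevel b θ (p.pos θ k) s := by
  simp only [PosCrossingOn, onNeg_onPos_iff hθ (pos_mem p k)]

theorem positivelyFolded_iff (hθ : IsHighestRoot b θ) : p.PositivelyFolded θ ↔
    ∀ k s, p.steps[k]? = some (s, .fold) → b.IsPos (wallRoot b θ (p.pos θ k) s) := by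
  refine forall_congr' fun k => forall_congr' fun s => forall_congr' fun hs => ?_
  simp only [posFoldOn_iff hθ]
  constructor
  · rintro ⟨a, j, ha, s', hs', rfl, -⟩
    rw [hs] at hs'
    obtain rfl : s = s' := by simpa using hs'
    exact ha
  · exact fun h => ⟨_, _, h, s, hs, rfl, rfl⟩

/-- Step `k` is a fold. -/
def IsFold (p : Walk b) (k : ℕ) : Prop := ∃ s, p.steps[k]? = some (s, .fold)

/-- Step `k` is a negative crossing. -/
def IsNegCross (θ : ι) (p : Walk b) (k : ℕ) : Prop :=
  ∃ s, p.steps[k]? = some (s, .cross) ∧ b.IsPos (wallRoot b θ (p.pos θ k) s)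

/-- Step `k` is a positive crossing. -/
def IsPosCross (θ : ι) (p : Walk b) (k : ℕ) : Prop :=
  ∃ s, p.steps[k]? = some (s, .cross) ∧ ¬ b.IsPos (wallRoot b θ (p.pos θ k) s)

theorem IsFold.lt (h : p.IsFold k) : k < p.steps.length := by
  obtain ⟨s, h⟩ := h
  exact (List.getElem?_eq_some_iff.1 h).1

theorem IsPosCross.lt (h : p.IsPosCross θ k) : k < p.steps.length := by
  obtain ⟨s, h, -⟩ := h
  exact (List.getElem?_eq_some_iff.1 h).1

open Classical in
theorem dim_eq_sum (hθ : IsHighestRoot b θ) (p : Walk b) :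
    p.dim θ = ∑ k ∈ Finset.range p.steps.length, (if p.IsPosCross θ k then 1 else 0) +
      ∑ k ∈ Finset.range p.steps.length, (if p.IsFold k then 1 else 0) := by
  have key : ∀ Q : ℕ → Prop, (∀ k, Q k → k < p.steps.length) →
      {k | Q k}.ncard = ∑ k ∈ Finset.range p.steps.length, (if Q k then 1 else 0) := by
    intro Q hQ
    rw [← Finset.card_filter, ← Set.ncard_coe_finset]
    congr 1
    ext k
    simp only [Set.mem_ofPred_eq, Finset.coe_filter, Finset.mem_range]
    exact ⟨fun h => ⟨hQ k h, h⟩, fun h => h.2⟩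
  rw [← key _ fun k hk => hk.lt, ← key _ fun k hk => hk.lt]
  have h1 : ∀ k, (∃ a j, b.IsPos a ∧ p.PosCrossingOn θ k a j) ↔ p.IsPosCross θ k := by
    intro k
    simp only [posCrossingOn_iff hθ]
    constructor
    · rintro ⟨a, j, ha, s, hs, rfl, -⟩
      exact ⟨s, hs, (isPos_ng b _).1 ha⟩
    · rintro ⟨s, hs, h⟩
      exact ⟨_, _, (isPos_ng b _).2 h, s, hs, rfl, rfl⟩
  simp only [dim, h1]
  rfl

open Classical in
theorem kind_sum (p : Walk b) (hk : k < p.steps.length) :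
    (if p.IsPosCross θ k then 1 else 0) + (if p.IsFold k then 1 else 0) +
      (if p.IsNegCross θ k then 1 else 0) = 1 := by
  have hst := List.getElem?_eq_getElem hk
  generalize p.steps[k] = st at hst
  obtain ⟨s, _ | _⟩ := st
  · have h1 : ¬ p.IsFold k := by rintro ⟨t, ht⟩; rw [hst] at ht; simp at ht
    rw [if_neg h1]
    have h2 : p.IsPosCross θ k ↔ ¬ b.IsPos (wallRoot b θ (p.pos θ k) s) := by
      refine ⟨?_, fun h => ⟨s, hst, h⟩⟩
      rintro ⟨t, ht, h⟩
      rw [hst] at ht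
      obtain rfl : s = t := by simpa using ht
      exact h
    have h3 : p.IsNegCross θ k ↔ b.IsPos (wallRoot b θ (p.pos θ k) s) := by
      refine ⟨?_, fun h => ⟨s, hst, h⟩⟩
      rintro ⟨t, ht, h⟩
      rw [hst] at ht
      obtain rfl : s = t := by simpa using ht
      exact h
    by_cases h : b.IsPos (wallRoot b θ (p.pos θ k) s)
    · rw [if_neg (fun h' => h2.1 h' h), if_pos (h3.2 h)]
    · rw [if_pos (h2.2 h), if_neg (fun h' => h (h3.1 h'))]
  · have h1 : p.IsFold k := ⟨s, hst⟩
    have h2 : ¬ p.IsPosCross θ k := by rintro ⟨t, ht, -⟩; rw [hst] at ht; simp at ht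
    have h3 : ¬ p.IsNegCross θ k := by rintro ⟨t, ht, -⟩; rw [hst] at ht; simp at ht
    rw [if_pos h1, if_neg h2, if_neg h3]

open Classical in
theorem dim_add_negCross (hθ : IsHighestRoot b θ) (p : Walk b) :
    p.dim θ + ∑ k ∈ Finset.range p.steps.length, (if p.IsNegCross θ k then 1 else 0) =
      p.steps.length := by
  rw [dim_eq_sum hθ, ← Finset.sum_add_distrib, ← Finset.sum_add_distrib,
    Finset.sum_congr rfl fun k hk => kind_sum p (Finset.mem_range.1 hk)]
  simp

open Classical in
theorem lvlSum_pos (hθ : IsHighestRoot b θ) (p : Walk b) (k : ℕ) :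
    lvlSum b (p.pos θ k) = ∑ l ∈ Finset.range k,
      ((if p.IsPosCross θ l then 1 else 0) - (if p.IsNegCross θ l then 1 else 0) : ℤ) := by
  induction k with
  | zero =>
    rw [Finset.sum_range_zero, pos_zero, lvlSum]
    exact Finset.sum_eq_zero fun a ha => lvl_one_of_isPos (mem_posRoots.1 ha)
  | succ k ih =>
    rw [Finset.sum_range_succ, ← ih]
    cases hst : p.steps[k]? with
    | none =>
      have h2 : ¬ p.IsPosCross θ k := by rintro ⟨t, ht, -⟩; rw [hst] at ht; simp at ht
      have h3 : ¬ p.IsNegCross θ k := by rintro ⟨t, ht, -⟩; rw [hst] at ht; simp at ht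
      rw [pos_succ_none hst, if_neg h2, if_neg h3, sub_zero, add_zero]
    | some st =>
      obtain ⟨s, _ | _⟩ := st
      · rw [pos_succ_cross hst, lvlSum_mul_gen hθ (pos_mem p k)]
        by_cases h : b.IsPos (wallRoot b θ (p.pos θ k) s)
        · have h2 : ¬ p.IsPosCross θ k := by
            rintro ⟨t, ht, h'⟩
            rw [hst] at ht
            obtain rfl : s = t := by simpa using ht
            exact h' h
          rw [if_pos h, if_neg h2, if_pos ⟨s, hst, h⟩, zero_sub]
        · have h2 : ¬ p.IsNegCross θ k := by
            rintro ⟨t, ht, h'⟩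
            rw [hst] at ht
            obtain rfl : s = t := by simpa using ht
            exact h h'
          rw [if_neg h, if_pos ⟨s, hst, h⟩, if_neg h2, sub_zero]
      · have h2 : ¬ p.IsPosCross θ k := by rintro ⟨t, ht, -⟩; rw [hst] at ht; simp at ht
        have h3 : ¬ p.IsNegCross θ k := by rintro ⟨t, ht, -⟩; rw [hst] at ht; simp at ht
        rw [pos_succ_fold hst, if_neg h2, if_neg h3, sub_zero, add_zero]

open Classical in
/-- The number of folds of a walk. -/
def folds (p : Walk b) : ℕ := ∑ k ∈ Finset.range p.steps.length, (if p.IsFold k then 1 else 0)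

/-- With P positive crossings, N negative crossings and F folds: dim = P + F, the length is P + F +
N, and `lvlSum` at the end is P − N. -/
theorem two_mul_dim (hθ : IsHighestRoot b θ) (p : Walk b) :
    2 * (p.dim θ : ℤ) = p.steps.length + p.folds + lvlSum b (p.pos θ p.steps.length) := by
  classical
  have h1 := dim_add_negCross hθ p
  have h2 := lvlSum_pos hθ p p.steps.length
  have h3 := dim_eq_sum hθ p
  rw [Finset.sum_sub_distrib] at h2
  have h4 := congrArg (Nat.cast (R := ℤ)) h1
  have h5 := congrArg (Nat.cast (R := ℤ)) h3
  rw [folds]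
  push_cast at h4 h5 ⊢
  linarith

/-- A folded alcove walk of reduced type ends below its type in the Bruhat order. -/
theorem bruhatLE_endAlcove (hθ : IsHighestRoot b θ) (h : IsReducedExpr b θ word γ w)
    (htype : p.steps.map Prod.fst = word) (hsheet : p.sheet = γ) :
    BruhatLE b w (p.endAlcove θ) := by
  have key : ∀ k, BruhatLE b (genProd b θ (word.take k)) (p.pos θ k) := by
    intro k
    induction k with
    | zero => exact Relation.ReflTransGen.refl
    | succ k ih =>
      cases hst : p.steps[k]? with
      | none =>
        have hw : word[k]? = none := by rw [← htype, List.getElem?_map, hst]; rfl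
        rwa [pos_succ_none hst, genProd_take_succ_of_none hw]
      | some st =>
        have hw : word[k]? = some st.1 := by rw [← htype, List.getElem?_map, hst]; rfl
        have hle := h.lvl_le hθ hw
        have hmem := genProd_mem (θ := θ) (word.take k)
        rw [genProd_take_succ hw]
        obtain ⟨s, _ | _⟩ := st
        · rw [pos_succ_cross hst]
          exact ih.mul_gen hθ hmem hle
        -- At a fold the walk stays put while the type grows, and ws lies above w, which lies above
        -- the current alcove.
        · rw [pos_succ_fold hst]
          exact Relation.ReflTransGen.head (bruhatStep_gen hθ hmem hle) ih
  have h1 := key word.length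
  rw [List.take_length] at h1
  have h2 := h1.mul_lengthZero hθ (genProd_mem word) h.1
  have h3 : p.steps.length = word.length := by rw [← htype, List.length_map]
  rw [endAlcove, hsheet, h3]
  have h4 : genProd b θ word * γ = w := h.2.1
  rwa [h4] at h2

end Walk

end AlcoveWalks

end

/-! ### The dimension bound: inversions versus folds, and lengths of the types. -/

noncomputable section

namespace AlcoveWalks

variable {ι M N : Type*} [Fintype ι] [AddCommGroup M] [Module ℝ M] [AddCommGroup N] [Module ℝ N]
  {Φ : RootPairing ι ℝ M N} [Φ.IsRootSystem] [Φ.IsCrystallographic] [Φ.IsReduced]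
  {b : Φ.Base} {θ : ι} {x u w m γ : N ≃ᵃ[ℝ] N} {lam : N} {word : List (Option b.support)}

/-! ### Sums over the positive roots -/

open Classical in
/-- The positive one of the roots `±a`. -/
def absRoot (b : Φ.Base) (a : ι) : ι := if b.IsPos a then a else ng Φ a

theorem absRoot_of_isPos {a : ι} (h : b.IsPos a) : absRoot b a = a := if_pos h

theorem absRoot_of_not_isPos {a : ι} (h : ¬ b.IsPos a) : absRoot b a = ng Φ a := if_neg h

theorem isPos_absRoot (a : ι) : b.IsPos (absRoot b a) := by
  by_cases h : b.IsPos a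
  · rwa [absRoot_of_isPos h]
  · rwa [absRoot_of_not_isPos h, isPos_ng]

/-- The linear part permutes the pairs ±a, hence their positive members. -/
theorem sum_absRoot_pull {A : Type*} [AddCommMonoid A] (hx : x ∈ rootAut Φ) (F : ι → A) :
    ∑ a ∈ posRoots b, F (absRoot b (pull Φ x a)) = ∑ a ∈ posRoots b, F a := by
  have hmaps : ∀ a ∈ posRoots b, absRoot b (pull Φ x a) ∈ posRoots b :=
    fun a _ => mem_posRoots.2 (isPos_absRoot _)
  have hinj : Set.InjOn (fun a => absRoot b (pull Φ x a)) (posRoots b) := by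
    intro a ha c hc h
    simp only [Finset.mem_coe, mem_posRoots] at ha hc
    simp only at h
    by_cases h1 : b.IsPos (pull Φ x a) <;> by_cases h2 : b.IsPos (pull Φ x c)
    · rw [absRoot_of_isPos h1, absRoot_of_isPos h2] at h
      exact pull_injective hx h
    · rw [absRoot_of_isPos h1, absRoot_of_not_isPos h2, ← pull_ng hx] at h
      rw [pull_injective hx h, isPos_ng] at ha
      exact absurd hc ha
    · rw [absRoot_of_not_isPos h1, absRoot_of_isPos h2, ← pull_ng hx] at h
      rw [← pull_injective hx h, isPos_ng] at hc
      exact absurd ha hc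
    · rw [absRoot_of_not_isPos h1, absRoot_of_not_isPos h2] at h
      exact pull_injective hx (ng_injective h)
  exact Finset.sum_nbij _ hmaps hinj
    (Finset.surjOn_of_injOn_of_card_le _ hmaps hinj le_rfl) fun a _ => rfl

theorem sum_pull_of_even {A : Type*} [AddCommMonoid A] (hx : x ∈ rootAut Φ) (F : ι → A)
    (hF : ∀ a, F (ng Φ a) = F a) :
    ∑ a ∈ posRoots b, F (pull Φ x a) = ∑ a ∈ posRoots b, F a := by
  rw [← sum_absRoot_pull hx F]
  refine Finset.sum_congr rfl fun a _ => ?_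
  by_cases h : b.IsPos (pull Φ x a)
  · rw [absRoot_of_isPos h]
  · rw [absRoot_of_not_isPos h, hF]

theorem two_mul_rho (b : Φ.Base) (v : N) :
    2 * Φ.toLinearMap (rho b) v = ∑ a ∈ posRoots b, ev Φ a v := by
  rw [rho, map_smul, map_sum, LinearMap.smul_apply, LinearMap.sum_apply, smul_eq_mul]
  rw [← mul_assoc, mul_one_div_cancel (by norm_num), one_mul]
  rfl

open Classical in
/-- The positive roots that the linear part of the inverse of `x` makes negative. -/
def inversions (b : Φ.Base) (x : N ≃ᵃ[ℝ] N) : Finset ι :=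
  (posRoots b).filter fun a => ¬ b.IsPos (pull Φ x a)

theorem mem_inversions {a : ι} :
    a ∈ inversions b x ↔ b.IsPos a ∧ ¬ b.IsPos (pull Φ x a) := by
  simp only [inversions, Finset.mem_filter, mem_posRoots]

/-- The level is the value at x(0), lowered by one exactly at the inversions. -/
theorem lvlSum_eq (hx : x ∈ rootAut Φ) :
    (lvlSum b x : ℝ) = 2 * Φ.toLinearMap (rho b) (x 0) - (inversions b x).card := by
  classical
  rw [two_mul_rho, inversions, Finset.card_filter, lvlSum]
  push_cast
  rw [← Finset.sum_sub_distrib]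
  refine Finset.sum_congr rfl fun a _ => ?_
  rw [← shift_eq hx]
  by_cases h : b.IsPos (pull Φ x a)
  · rw [lvl_of_isPos h, if_neg (not_not.2 h), sub_zero]
  · rw [lvl_of_not_isPos h, if_pos h]; push_cast; rfl

theorem isPos_of_ev_nonneg {a : ι} (h : 0 ≤ ev Φ a (heightVector b)) : b.IsPos a := by
  by_contra hcon
  rw [← isPos_ng, isPos_iff_ev, ev_ng] at hcon
  linarith

/-- A reflection in a positive root that stays positive increases the number of inversions. -/
theorem card_inversions_lt (hx : x ∈ rootAut Φ) {c : ι} (hc : b.IsPos c)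
    (hxc : b.IsPos (pull Φ x c)) (j : ℤ) :
    (inversions b x).card < (inversions b (affRefl Φ c j * x)).card := by
  classical
  have hpull : ∀ a, pull Φ (affRefl Φ c j * x) a = pull Φ x (Φ.reflectionPerm c a) := fun a => by
    rw [pull_mul (affRefl_mem c j) hx, pull_affRefl]
  have hcmem : c ∈ inversions b (affRefl Φ c j * x) := by
    rw [mem_inversions, hpull]
    refine ⟨hc, ?_⟩
    change ¬ b.IsPos (pull Φ x (ng Φ c))
    rw [pull_ng hx, isPos_ng, not_not]
    exact hxc
  -- An injection of the old inversions into the new ones other than c: reflect a in c when the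
  -- result is positive, and keep a otherwise.
  let f : ι → ι := fun a => if b.IsPos (Φ.reflectionPerm c a) then Φ.reflectionPerm c a else a
  have hle : (inversions b x).card ≤ ((inversions b (affRefl Φ c j * x)).erase c).card := by
    refine Finset.card_le_card_of_injOn f ?_ ?_
    · intro a ha
      rw [Finset.mem_coe, mem_inversions] at ha
      rw [Finset.mem_coe, Finset.mem_erase, mem_inversions, hpull]
      by_cases h : b.IsPos (Φ.reflectionPerm c a)
      · simp only [f, if_pos h, RootPairing.reflectionPerm_self]
        refine ⟨fun e => ?_, h, ha.2⟩
        have : a = ng Φ c := by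
          have := congrArg (Φ.reflectionPerm c) e
          rwa [RootPairing.reflectionPerm_self] at this
        rw [this, isPos_ng] at ha
        exact ha.1 hc
      · simp only [f, if_neg h]
        -- As s_c a is negative, ⟨c^∨, a⟩ is positive. Subtracting this multiple of the positive
        -- pull-back of c keeps the pull-back of a negative.
        refine ⟨fun e => ha.2 (e ▸ hxc), ha.1, fun hcon => ?_⟩
        rw [isPos_iff_ev, pull_reflectionPerm hx, ev_reflectionPerm, pr_pull hx] at hcon
        have h1 := (isPos_iff_ev b).1 ha.1
        have h2 := (isPos_iff_ev b).1 hc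
        have h3 := (isPos_iff_ev b).1 hxc
        have h4 : ev Φ (pull Φ x a) (heightVector b) < 0 := by
          by_contra! h'
          exact ha.2 (isPos_of_ev_nonneg h')
        have h5 : ev Φ (Φ.reflectionPerm c a) (heightVector b) < 0 := by
          by_contra! h'
          exact h (isPos_of_ev_nonneg h')
        rw [ev_reflectionPerm] at h5
        have h6 : (0 : ℝ) < pr Φ a c := by
          by_contra! h'
          nlinarith
        nlinarith
    · intro a ha c' hc' h
      rw [Finset.mem_coe, mem_inversions] at ha hc'
      by_cases h1 : b.IsPos (Φ.reflectionPerm c a) <;>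
        by_cases h2 : b.IsPos (Φ.reflectionPerm c c') <;>
        simp only [f, h1, h2, if_true, if_false] at h
      · exact (Φ.reflectionPerm c).injective h
      · rw [← h, RootPairing.reflectionPerm_self] at h2
        exact absurd ha.1 h2
      · rw [h, RootPairing.reflectionPerm_self] at h1
        exact absurd hc'.1 h1
      · exact h
  rw [Finset.card_erase_of_mem hcmem] at hle
  have := Finset.card_pos.2 ⟨c, hcmem⟩
  omega

/-! ### The bound on the number of folds -/

/-- Interpolate between w and the end alcove: follow p for k steps, then the rest of the word
without folds. A crossing changes nothing; a fold multiplies on the left by the reflection in its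
positive wall root, which stays positive when pulled back, so `card_inversions_lt` gives a new
inversion. -/
theorem Walk.folds_le (hθ : IsHighestRoot b θ) {p : Walk b} (h : IsReducedExpr b θ word γ w)
    (hT : ∀ c, lvl b w c < lvl b (1 : N ≃ᵃ[ℝ] N) c → b.IsPos (pull Φ w c))
    (hfold : p.PositivelyFolded θ) (htype : p.steps.map Prod.fst = word) (hsheet : p.sheet = γ) :
    p.folds ≤ (inversions b (p.endAlcove θ)).card := by
  classical
  rw [Walk.positivelyFolded_iff hθ] at hfold
  have hγ := lengthZero_mem h.1
  have hlen : p.steps.length = word.length := by rw [← htype, List.length_map]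
  have key : ∀ k ≤ word.length, ∑ l ∈ Finset.range k, (if p.IsFold l then 1 else 0) ≤
      (inversions b (p.pos θ k * genProd b θ (word.drop k) * γ)).card := by
    intro k
    induction k with
    | zero => intro _; simp
    | succ k ih =>
      intro hk
      have ih := ih (by omega)
      obtain ⟨st, hst⟩ : ∃ st, p.steps[k]? = some st :=
        ⟨_, List.getElem?_eq_getElem (by omega)⟩
      have hw : word[k]? = some st.1 := by rw [← htype, List.getElem?_map, hst]; rfl
      have hdrop : word.drop k = st.1 :: word.drop (k + 1) := by
        obtain ⟨hlt, he⟩ := List.getElem?_eq_some_iff.1 hw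
        rw [List.drop_eq_getElem_cons hlt, he]
      have hz := genProd_mem (θ := θ) (word.drop (k + 1))
      have hx := Walk.pos_mem (θ := θ) p k
      rw [Finset.sum_range_succ]
      rw [hdrop, genProd_cons] at ih
      obtain ⟨s, _ | _⟩ := st
      · have h1 : ¬ p.IsFold k := by rintro ⟨t, ht⟩; rw [hst] at ht; simp at ht
        rw [if_neg h1, Walk.pos_succ_cross hst, add_zero, mul_assoc (p.pos θ k)]
        exact ih
      · rw [if_pos ⟨s, hst⟩, Walk.pos_succ_fold hst]
        dsimp only at hw hdrop ih
        have hc := hfold k s hst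
        have hg := gen_mem (θ := θ) s
        -- Pulled back along the initial segment, the wall root becomes the simple affine root of
        -- the letter. So `hT` at w is a statement about the remaining segment alone, unaffected by
        -- earlier folds.
        have hpull : b.IsPos (pull Φ (gen b θ s * genProd b θ (word.drop (k + 1)) * γ)
            (simpleRoot b θ s)) := by
          have hG := genProd_mem (θ := θ) (word.take k)
          have h1 := hT _ (h.lvl_final hθ hw)
          have h2 : w = genProd b θ (word.take k) *
              (gen b θ s * genProd b θ (word.drop (k + 1)) * γ) := by
            have h3 : genProd b θ word * γ = w := h.2.1
            have h4 := genProd_append (θ := θ) (word.take k) (word.drop k)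
            rw [List.take_append_drop, hdrop, genProd_cons] at h4
            rw [← h3, h4, mul_assoc]
          rw [h2, pull_mul hG (mul_mem (mul_mem hg hz) hγ), pull_wallRoot hG] at h1
          exact h1
        have hE : p.pos θ k * genProd b θ (word.drop (k + 1)) * γ =
            affRefl Φ (wallRoot b θ (p.pos θ k) s) (wallLevel b θ (p.pos θ k) s) *
              (p.pos θ k * (gen b θ s * genProd b θ (word.drop (k + 1)) * γ)) := by
          rw [← mul_assoc, ← mul_gen hx, ← mul_assoc, ← mul_assoc, mul_gen_mul_gen]
        have hlt := card_inversions_lt (b := b) (mul_mem hx (mul_mem (mul_mem hg hz) hγ)) hc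
          (by rw [pull_mul hx (mul_mem (mul_mem hg hz) hγ), pull_wallRoot hx]; exact hpull)
          (wallLevel b θ (p.pos θ k) s)
        rw [← hE] at hlt
        rw [mul_assoc (p.pos θ k)] at ih
        omega
  have h1 := key word.length le_rfl
  rw [List.drop_length, show genProd b θ [] = 1 from rfl, mul_one] at h1
  rw [Walk.folds, Walk.endAlcove, hsheet, hlen]
  exact h1

/-! ### Minimal coset representatives -/

/-- A simple root vanishing at λ and made negative by u would give a shorter representative. A
positive root vanishing at λ involves only such simple roots, as λ is dominant. -/
theorem minReps_isPos (hθ : IsHighestRoot b θ) (hlam : IsDominant b lam)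
    (hu : u ∈ minReps b θ lam) {a : ι} (ha : b.IsPos a) (h0 : ev Φ a lam = 0) :
    b.IsPos (pull Φ u⁻¹ a) := by
  have hsimple : ∀ i ∈ b.support, ev Φ i lam = 0 → b.IsPos (pull Φ u⁻¹ i) := by
    intro i hi h
    by_contra hcon
    have h1 : len b θ (u * affRefl Φ i 0) + 1 = len b θ u :=
      len_mul_simple_of_not hθ hu.1 (i := ⟨i, hi⟩) hcon
    have h2 := hu.2 (affRefl Φ i 0) (affRefl_mem_weyl i) (by rw [affRefl_apply', h]; simp)
    omega
  obtain ⟨f, hf, -, hf'⟩ := exists_coeff b a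
  have hf' := hf' ha
  apply isPos_of_ev_nonneg
  rw [← ev_weyl (inv_mem hu.1), hf]
  rw [hf, Finset.sum_eq_zero_iff_of_nonneg fun j hj => mul_nonneg
    (by exact_mod_cast hf' j) (hlam.ev_nonneg j hj)] at h0
  refine Finset.sum_nonneg fun j hj => ?_
  rcases mul_eq_zero.1 (h0 j hj) with h | h
  · rw [h, zero_mul]
  · rw [ev_weyl (inv_mem hu.1)]
    exact mul_nonneg (by exact_mod_cast hf' j) ((isPos_iff_ev b).1 (hsimple j hj h)).le

/-- The element u⁻¹u' fixes λ. If it made a simple root negative, that root would vanish at λ, and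
minimality of u and of u' would give it opposite signs. -/
theorem minReps_unique (hθ : IsHighestRoot b θ) (hlam : IsDominant b lam) {u' : N ≃ᵃ[ℝ] N}
    (hu : u ∈ minReps b θ lam) (hu' : u' ∈ minReps b θ lam) (h : u lam = u' lam) : u = u' := by
  have hv : u⁻¹ * u' ∈ weyl Φ := mul_mem (inv_mem hu.1) hu'.1
  suffices u⁻¹ * u' = 1 by exact inv_mul_eq_one.1 this
  refine eq_one_of_isPos (b := b) hv fun i hi => ?_
  have hi := RootPairing.Base.isPos_of_mem_support hi
  have hfix : (u⁻¹ * u')⁻¹ lam = lam := by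
    rw [mul_inv_rev, inv_inv, mul_apply, h, inv_apply_apply]
  have hev : ev Φ (pull Φ (u⁻¹ * u')⁻¹ i) lam = ev Φ i lam := by
    rw [← ev_weyl (inv_mem hv), hfix]
  have hnn := ev_nonneg_of_isPos hi hlam.ev_nonneg
  by_contra hcon
  have hpos := (isPos_ng b _).2 hcon
  have h1 := ev_nonneg_of_isPos hpos hlam.ev_nonneg
  rw [ev_ng, hev] at h1
  have h0 : ev Φ i lam = 0 := by linarith
  have h2 := minReps_isPos hθ hlam hu hpos (by rw [ev_ng, hev, h0, neg_zero])
  rw [pull_ng (inv_mem (weyl_le hu.1)), isPos_ng] at h2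
  apply h2
  rw [← pull_mul (inv_mem (weyl_le hv)) (inv_mem (weyl_le hu.1))]
  have : (u⁻¹ * u')⁻¹ * u⁻¹ = u'⁻¹ := by group
  rw [this]
  exact minReps_isPos hθ hlam hu' hi h0

theorem exists_mem_minReps (hw : w ∈ weyl Φ) : ∃ u ∈ minReps b θ lam, u lam = w lam := by
  classical
  have hne : ∃ n, ∃ v ∈ weyl Φ, v lam = w lam ∧ len b θ v = n := ⟨_, w, hw, rfl, rfl⟩
  obtain ⟨u, hu, hul, hn⟩ := Nat.find_spec hne
  refine ⟨u, ⟨hu, fun v hv hvl => ?_⟩, hul⟩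
  rw [hn]
  exact Nat.find_min' hne ⟨u * v, mul_mem hu hv, by rw [mul_apply, hvl, hul], rfl⟩

/-- The shape of the shortest element of the double coset of a dominant translation. -/
structure IsShortest (b : Φ.Base) (lam : N) (m w : N ≃ᵃ[ℝ] N) : Prop where
  mem : w ∈ weyl Φ
  eq : m = trans lam * w
  isPos : ∀ a, b.IsPos a → ev Φ a lam = 0 → b.IsPos (pull Φ w a)
  not_isPos : ∀ a, b.IsPos a → 0 < ev Φ a lam → ¬ b.IsPos (pull Φ w a)

/-- The levels of the other positive roots are permuted, while the level l < 0 of α_i becomes −1 −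
l, of smaller absolute value. -/
theorem len_simple_mul (hθ : IsHighestRoot b θ) (hx : x ∈ rootAut Φ) {i : ι} (hi : i ∈ b.support)
    (h : lvl b x i < 0) : len b θ (affRefl Φ i 0 * x) < len b θ x := by
  classical
  have hi' := RootPairing.Base.isPos_of_mem_support hi
  have hl : ∀ a, lvl b (affRefl Φ i 0 * x) a = lvl b x (Φ.reflectionPerm i a) := fun a => by
    rw [lvl_mul (affRefl_mem _ _) hx, shift_affRefl, pull_affRefl]; ring
  rw [len_eq hθ hx, len_eq hθ (mul_mem (affRefl_mem _ _) hx),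
    ← Finset.add_sum_erase _ _ (mem_posRoots.2 hi'),
    ← Finset.add_sum_erase _ (fun a => (lvl b x a).natAbs) (mem_posRoots.2 hi')]
  have hmaps : ∀ a ∈ (posRoots b).erase i, Φ.reflectionPerm i a ∈ (posRoots b).erase i := by
    intro a ha
    rw [Finset.mem_erase, mem_posRoots] at ha ⊢
    refine ⟨fun e => ?_, ha.2.reflectionPerm hi ha.1⟩
    have : a = ng Φ i := by
      have := congrArg (Φ.reflectionPerm i) e
      rwa [RootPairing.reflectionPerm_self] at this
    rw [this, isPos_ng] at ha
    exact ha.2 hi'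
  have hsum : ∑ a ∈ (posRoots b).erase i, (lvl b (affRefl Φ i 0 * x) a).natAbs =
      ∑ a ∈ (posRoots b).erase i, (lvl b x a).natAbs :=
    Finset.sum_nbij' (Φ.reflectionPerm i) (Φ.reflectionPerm i) hmaps hmaps
      (fun a _ => by rw [RootPairing.reflectionPerm_self])
      (fun a _ => by rw [RootPairing.reflectionPerm_self]) fun a _ => by rw [hl]
  rw [hsum, hl]
  change (lvl b x (ng Φ i)).natAbs + _ < _
  rw [lvl_ng hx]
  omega

/-- Minimality under left multiplication puts the alcove in the dominant chamber, so vλ = λ, and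
roots vanishing at λ stay positive. Right multiplication settles the roots positive at λ. -/
theorem IsMinimalIn.exists_isShortest (hθ : IsHighestRoot b θ) (hlam : IsDominant b lam)
    (hm : IsMinimalIn b θ lam m) : ∃ w, IsShortest b lam m w := by
  obtain ⟨⟨v, hv, w, hw, rfl⟩, hmin⟩ := hm
  have ht : trans lam ∈ rootAut Φ := trans_mem hlam.isCoweight.exists_int
  have hmem : v * trans lam * w ∈ rootAut Φ := mul_mem (mul_mem (weyl_le hv) ht) (weyl_le hw)
  have h0 : (v * trans lam * w) 0 = v lam := by
    rw [mul_apply, mul_apply, weyl_apply_zero hw, trans_apply, add_zero]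
  have hleft : ∀ i ∈ b.support, 0 ≤ lvl b (v * trans lam * w) i := by
    intro i hi
    by_contra! hcon
    have h1 := len_simple_mul hθ hmem hi hcon
    have h2 := hmin (affRefl Φ i 0 * (v * trans lam * w))
      ⟨affRefl Φ i 0 * v, mul_mem (affRefl_mem_weyl i) hv, w, hw, by simp only [mul_assoc]⟩
    omega
  have hvl : v lam = lam := by
    refine eq_of_dominant hlam hv fun i hi => ?_
    rw [← h0, ← shift_eq hmem]
    exact_mod_cast (hleft i hi).trans (lvl_le_shift _ _)
  have heq : v * trans lam * w = trans lam * (v * w) := by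
    rw [weyl_mul_trans hv, hvl, mul_assoc]
  have hvw := mul_mem hv hw
  rw [heq] at hleft hmem hmin
  have hshift : ∀ a, (shift Φ (trans lam * (v * w)) a : ℝ) = ev Φ a lam := fun a => by
    rw [shift_eq hmem, mul_apply, weyl_apply_zero hvw, trans_apply, add_zero]
  have hpull : ∀ a, pull Φ (trans lam * (v * w)) a = pull Φ (v * w) a := fun a => by
    rw [pull_mul ht (weyl_le hvw), pull_trans ht]
  refine ⟨v * w, hvw, heq, fun a ha hal => ?_, fun a ha hal hcon => ?_⟩
  · by_contra hcon
    rw [← hpull] at hcon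
    have h1 := lvl_of_not_isPos hcon
    have h2 := hshift a
    rw [hal] at h2
    obtain ⟨c, hc⟩ := fundAlcove_nonempty hθ
    have h3 := (lvl_lt_ev hθ hmem a hc).2
    have h4 : 0 ≤ ev Φ a ((trans lam * (v * w)) c) := by
      refine ev_nonneg_of_isPos ha fun i hi => ?_
      have h5 := (lvl_lt_ev hθ hmem i hc).1
      have h6 : (0 : ℝ) ≤ lvl b (trans lam * (v * w)) i := by exact_mod_cast hleft i hi
      linarith
    have h7 : (lvl b (trans lam * (v * w)) a : ℝ) = -1 := by
      rw [h1]; push_cast; rw [h2]; norm_num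
    linarith
  -- The antidominance of (vw)⁻¹λ: otherwise a simple reflection on the right would shorten the
  -- element.
  · have hright : ∀ i ∈ b.support, 0 ≤ ev Φ i (-(v * w)⁻¹ lam) := by
      intro i hi
      rw [map_neg, ev_weyl (inv_mem hvw)]
      by_contra! hneg
      have h1 := len_mul_gen hθ hmem (some ⟨i, hi⟩)
      have h2 := hmin (trans lam * (v * w) * affRefl Φ i 0)
        ⟨1, one_mem _, v * w * affRefl Φ i 0, mul_mem hvw (affRefl_mem_weyl i),
          by simp only [mul_assoc, one_mul]⟩
      have hwr : wallRoot b θ (trans lam * (v * w)) (some ⟨i, hi⟩) = pull Φ (v * w)⁻¹ i := by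
        apply pull_injective hmem
        rw [pull_wallRoot hmem, hpull, pull_pull_inv (weyl_le hvw)]
        rfl
      rw [hwr] at h1
      set c := pull Φ (v * w)⁻¹ i with hcdef
      have hcpos : b.IsPos c := by
        by_contra hc
        have := ev_nonneg_of_isPos ((isPos_ng b _).2 hc) hlam.ev_nonneg
        rw [ev_ng] at this
        linarith
      have h3 : lvl b (trans lam * (v * w)) c = shift Φ (trans lam * (v * w)) c := by
        apply lvl_of_isPos
        rw [hpull, hcdef, pull_pull_inv (weyl_le hvw)]
        exact RootPairing.Base.isPos_of_mem_support hi
      have h4 : 0 < shift Φ (trans lam * (v * w)) c := by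
        have := hshift c
        have h5 : (0 : ℝ) < shift Φ (trans lam * (v * w)) c := by rw [this]; linarith
        exact_mod_cast h5
      rw [lvl_one_of_isPos hcpos, h3, if_neg (by omega)] at h1
      change ((len b θ (trans lam * (v * w) * affRefl Φ i 0) : ℕ) : ℤ) = _ at h1
      omega
    have h1 := ev_nonneg_of_isPos hcon hright
    rw [map_neg, ← ev_weyl hvw, apply_inv_apply] at h1
    linarith

theorem IsShortest.mem_rootAut (hlam : IsDominant b lam) (hm : IsShortest b lam m w) :
    m ∈ rootAut Φ := by
  rw [hm.eq]
  exact mul_mem (trans_mem hlam.isCoweight.exists_int) (weyl_le hm.mem)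

theorem IsShortest.shift_eq (hlam : IsDominant b lam) (hm : IsShortest b lam m w) (a : ι) :
    (shift Φ m a : ℝ) = ev Φ a lam := by
  rw [AlcoveWalks.shift_eq (hm.mem_rootAut hlam), hm.eq, mul_apply, weyl_apply_zero hm.mem,
    trans_apply, add_zero]

theorem IsShortest.pull_eq (hlam : IsDominant b lam) (hm : IsShortest b lam m w) (a : ι) :
    pull Φ m a = pull Φ w a := by
  have ht : trans lam ∈ rootAut Φ := trans_mem hlam.isCoweight.exists_int
  rw [hm.eq, pull_mul ht (weyl_le hm.mem), pull_trans ht]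

/-- The position of the shortest element, according to the sign of the value of a root. -/
theorem IsShortest.lvl_cases (hlam : IsDominant b lam) (hm : IsShortest b lam m w) (a : ι) :
    (0 < shift Φ m a ∧ b.IsPos a ∧ lvl b m a = shift Φ m a - 1) ∨
    (shift Φ m a = 0 ∧ lvl b m a = lvl b (1 : N ≃ᵃ[ℝ] N) a) ∨
    (shift Φ m a < 0 ∧ ¬ b.IsPos a ∧ lvl b m a = shift Φ m a ∧ b.IsPos (pull Φ m a)) := by
  have hmem := hm.mem_rootAut hlam
  have hpos : ∀ a, 0 < shift Φ m a → b.IsPos a ∧ ¬ b.IsPos (pull Φ m a) := by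
    intro a h
    have h1 : 0 < ev Φ a lam := by rw [← hm.shift_eq hlam]; exact_mod_cast h
    have ha : b.IsPos a := by
      by_contra hcon
      have := ev_nonneg_of_isPos ((isPos_ng b _).2 hcon) hlam.ev_nonneg
      rw [ev_ng] at this
      linarith
    refine ⟨ha, ?_⟩
    rw [hm.pull_eq hlam]
    exact hm.not_isPos a ha h1
  rcases lt_trichotomy (shift Φ m a) 0 with h | h | h
  · right; right
    have h1 := hpos (ng Φ a) (by rw [shift_ng hmem]; omega)
    rw [pull_ng hmem, isPos_ng, isPos_ng, not_not] at h1
    exact ⟨h, h1.1, lvl_of_isPos h1.2, h1.2⟩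
  · right; left
    refine ⟨h, ?_⟩
    have h0 : ev Φ a lam = 0 := by rw [← hm.shift_eq hlam, h, Int.cast_zero]
    by_cases ha : b.IsPos a
    · rw [lvl_one_of_isPos ha, lvl_of_isPos, h]
      rw [hm.pull_eq hlam]
      exact hm.isPos a ha h0
    · rw [lvl_one_of_not_isPos ha, lvl_of_not_isPos, h]
      · rfl
      · have := hm.isPos (ng Φ a) ((isPos_ng b _).2 ha) (by rw [ev_ng, h0, neg_zero])
        rw [pull_ng (weyl_le hm.mem), isPos_ng] at this
        rwa [hm.pull_eq hlam]
  · left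
    obtain ⟨h1, h2⟩ := hpos a h
    exact ⟨h, h1, lvl_of_not_isPos h2⟩

theorem lvl_weyl_mul (hu : u ∈ weyl Φ) (hx : x ∈ rootAut Φ) (a : ι) :
    lvl b (u * x) a = lvl b x (pull Φ u a) := by
  rw [lvl_mul (weyl_le hu) hx, shift_weyl hu, zero_add]

theorem minReps_isPos_pull (hθ : IsHighestRoot b θ) (hlam : IsDominant b lam)
    (hu : u ∈ minReps b θ lam) {a : ι} (h0 : ev Φ (pull Φ u a) lam = 0) :
    b.IsPos (pull Φ u a) ↔ b.IsPos a := by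
  have hmem := weyl_le hu.1
  by_cases h : b.IsPos (pull Φ u a)
  · have := minReps_isPos hθ hlam hu h h0
    rw [pull_inv_pull hmem] at this
    simp only [h, this]
  · have := minReps_isPos hθ hlam hu ((isPos_ng b _).2 h) (by rw [ev_ng, h0, neg_zero])
    rw [pull_ng (inv_mem hmem), pull_inv_pull hmem, isPos_ng] at this
    simp only [h, this]

/-- Supplies the sign hypothesis of `Walk.folds_le` for u m_λ. A separating root must take a
negative value at λ after being pulled back by u; value zero is excluded by minimality of u. -/
theorem isPos_pull_of_lvl_lt (hθ : IsHighestRoot b θ) (hlam : IsDominant b lam)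
    (hm : IsShortest b lam m w) (hu : u ∈ minReps b θ lam) (c : ι)
    (h : lvl b (u * m) c < lvl b (1 : N ≃ᵃ[ℝ] N) c) : b.IsPos (pull Φ (u * m) c) := by
  have hmem := hm.mem_rootAut hlam
  rw [pull_mul (weyl_le hu.1) hmem]
  rw [lvl_weyl_mul hu.1 hmem] at h
  rcases hm.lvl_cases hlam (pull Φ u c) with ⟨h1, h2, h3⟩ | ⟨h1, h2⟩ | ⟨h1, h2, h3, h4⟩
  · have := lvl_le_shift (b := b) (1 : N ≃ᵃ[ℝ] N) c
    rw [shift_one] at this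
    omega
  · have h0 : ev Φ (pull Φ u c) lam = 0 := by rw [← hm.shift_eq hlam, h1, Int.cast_zero]
    have hiff := minReps_isPos_pull hθ hlam hu h0
    by_cases hc : b.IsPos c
    · rw [h2, lvl_one_of_isPos hc, lvl_one_of_isPos (hiff.2 hc)] at h
      omega
    · rw [h2, lvl_one_of_not_isPos hc, lvl_one_of_not_isPos (mt hiff.1 hc)] at h
      omega
  · exact h4

/-- Since m c₀ is dominant, a positive root made negative by pulling back along u has level −1 − l
with l ≥ 0, contributing exactly one more than l. -/
theorem len_mul_shortest (hθ : IsHighestRoot b θ) (hlam : IsDominant b lam)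
    (hm : IsShortest b lam m w) (hu : u ∈ weyl Φ) :
    len b θ (u * m) = len b θ u + len b θ m := by
  have hmem := hm.mem_rootAut hlam
  have hnn : ∀ a, b.IsPos a → 0 ≤ lvl b m a := by
    intro a ha
    rcases hm.lvl_cases hlam a with ⟨h1, h2, h3⟩ | ⟨h1, h2⟩ | ⟨h1, h2, h3, h4⟩
    · omega
    · rw [h2, lvl_one_of_isPos ha]
    · exact absurd ha h2
  rw [len_eq hθ (mul_mem (weyl_le hu) hmem), len_eq hθ (weyl_le hu), len_eq hθ hmem,
    ← sum_absRoot_pull (weyl_le hu) fun a => (lvl b m a).natAbs, ← Finset.sum_add_distrib]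
  refine Finset.sum_congr rfl fun a _ => ?_
  rw [lvl_weyl_mul hu hmem]
  by_cases h : b.IsPos (pull Φ u a)
  · rw [absRoot_of_isPos h, lvl_of_isPos h, shift_weyl hu, Int.natAbs_zero, zero_add]
  · have h1 := hnn _ ((isPos_ng b _).2 h)
    rw [absRoot_of_not_isPos h, lvl_of_not_isPos h, shift_weyl hu]
    rw [lvl_ng hmem] at h1 ⊢
    omega

/-- Root by root, the level is at most |⟨λ, ·⟩| in absolute value; minimality of u is needed for the
roots whose pull-back vanishes at λ. -/
theorem len_mul_shortest_le (hθ : IsHighestRoot b θ) (hlam : IsDominant b lam)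
    (hm : IsShortest b lam m w) (hu : u ∈ minReps b θ lam) :
    (len b θ (u * m) : ℝ) ≤ 2 * Φ.toLinearMap (rho b) lam := by
  have hmem := hm.mem_rootAut hlam
  have h1 : ∑ a ∈ posRoots b, |ev Φ a lam| = 2 * Φ.toLinearMap (rho b) lam := by
    rw [two_mul_rho]
    refine Finset.sum_congr rfl fun a ha => ?_
    exact abs_of_nonneg (ev_nonneg_of_isPos (mem_posRoots.1 ha) hlam.ev_nonneg)
  rw [← h1, ← sum_pull_of_even (weyl_le hu.1) (fun a => |ev Φ a lam|)
    fun a => by rw [ev_ng, abs_neg], len_eq hθ (mul_mem (weyl_le hu.1) hmem)]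
  push_cast
  refine Finset.sum_le_sum fun a ha => ?_
  rw [mem_posRoots] at ha
  rw [lvl_weyl_mul hu.1 hmem, ← hm.shift_eq hlam, ← Int.cast_abs]
  have : |lvl b m (pull Φ u a)| ≤ |shift Φ m (pull Φ u a)| := by
    rcases hm.lvl_cases hlam (pull Φ u a) with ⟨h1, h2, h3⟩ | ⟨h1, h2⟩ | ⟨h1, h2, h3, h4⟩
    · rw [abs_of_nonneg (by omega), abs_of_nonneg (by omega)]; omega
    · have h0 : ev Φ (pull Φ u a) lam = 0 := by rw [← hm.shift_eq hlam, h1, Int.cast_zero]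
      rw [h2, lvl_one_of_isPos ((minReps_isPos_pull hθ hlam hu h0).2 ha), h1]
    · rw [h3]
  rw [Nat.cast_natAbs]
  exact_mod_cast this

theorem isReducedExpr_append (hθ : IsHighestRoot b θ) (hlam : IsDominant b lam)
    (hm : IsShortest b lam m w) (hu : u ∈ weyl Φ) {uword mword : List (Option b.support)}
    (hmword : IsReducedExpr b θ mword γ m) (huword : IsReducedExpr b θ uword 1 u) :
    IsReducedExpr b θ (uword ++ mword) γ (u * m) := by
  refine ⟨hmword.1, ?_, ?_⟩
  · have h1 := huword.2.1
    rw [mul_one] at h1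
    rw [List.map_append, List.prod_append, mul_assoc, hmword.2.1, h1]
  · rw [List.length_append, huword.2.2, hmword.2.2, len_mul_shortest hθ hlam hm hu]

end AlcoveWalks

end

/-! ### Root operators: existence, effect on positivity, dimension and end point. -/

noncomputable section

namespace AlcoveWalks

variable {ι M N : Type*} [Fintype ι] [AddCommGroup M] [Module ℝ M] [AddCommGroup N] [Module ℝ N]
  {Φ : RootPairing ι ℝ M N} [Φ.IsRootSystem] [Φ.IsCrystallographic] [Φ.IsReduced]
  {b : Φ.Base} {θ : ι}

namespace Walk

variable {p q : Walk b} {i : ι} {c k l r : ℕ} {j : ℤ} {s t : Option b.support}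

/-! ### Exchanging a crossing and a fold -/

theorem toggleAt_of_ne (h : k ≠ l) : (p.toggleAt k).steps[l]? = p.steps[l]? := by
  simp [toggleAt, h]

theorem toggleAt_self {mv : Move} (h : p.steps[k]? = some (s, mv)) :
    (p.toggleAt k).steps[k]? = some (s, mv.toggle) := by
  simp [toggleAt, h]

theorem toggleAt_map_fst (p : Walk b) (k : ℕ) :
    (p.toggleAt k).steps.map Prod.fst = p.steps.map Prod.fst := by
  apply List.ext_getElem?
  intro l
  rw [List.getElem?_map, List.getElem?_map]
  by_cases h : k = l
  · subst h
    cases hst : p.steps[k]? with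
    | none => simp [toggleAt, hst]
    | some st => rw [toggleAt_self (s := st.1) (mv := st.2) hst]; rfl
  · rw [toggleAt_of_ne h]

theorem pos_eq_of_steps_eq (h : ∀ l < k, q.steps[l]? = p.steps[l]?) (hl : l ≤ k) :
    q.pos θ l = p.pos θ l := by
  induction l with
  | zero => rfl
  | succ l ih =>
    have ih := ih (by omega)
    have hst := h l (by omega)
    cases hp : p.steps[l]? with
    | none => rw [hp] at hst; rw [pos_succ_none hp, pos_succ_none hst, ih]
    | some st =>
      rw [hp] at hst
      obtain ⟨s, _ | _⟩ := st
      · rw [pos_succ_cross hp, pos_succ_cross hst, ih]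
      · rw [pos_succ_fold hp, pos_succ_fold hst, ih]

theorem pos_eq_mul_of_steps_eq {g : N ≃ᵃ[ℝ] N} (h0 : q.pos θ k = g * p.pos θ k)
    (h : ∀ l', k ≤ l' → l' < l → q.steps[l']? = p.steps[l']?) (hl : k ≤ l) :
    q.pos θ l = g * p.pos θ l := by
  induction l, hl using Nat.le_induction with
  | base => exact h0
  | succ l hl ih =>
    have ih := ih fun l' h1 h2 => h l' h1 (by omega)
    have hst := h l hl (by omega)
    cases hp : p.steps[l]? with
    | none => rw [hp] at hst; rw [pos_succ_none hp, pos_succ_none hst, ih]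
    | some st =>
      rw [hp] at hst
      obtain ⟨s, _ | _⟩ := st
      · rw [pos_succ_cross hp, pos_succ_cross hst, ih, mul_assoc]
      · rw [pos_succ_fold hp, pos_succ_fold hst, ih]

/-! ### The critical crossing and the return -/

theorem lvl_pos_succ_of_ne (hθ : IsHighestRoot b θ) (i : ι)
    (h : ∀ t mv, p.steps[l]? = some (t, mv) → wallRoot b θ (p.pos θ l) t ≠ i ∧
      wallRoot b θ (p.pos θ l) t ≠ ng Φ i) :
    lvl b (p.pos θ (l + 1)) i = lvl b (p.pos θ l) i := by
  cases hp : p.steps[l]? with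
  | none => rw [pos_succ_none hp]
  | some st =>
    obtain ⟨s, _ | _⟩ := st
    · obtain ⟨h1, h2⟩ := h _ _ hp
      rw [pos_succ_cross hp, lvl_mul_gen_of_ne hθ (pos_mem p l) h1.symm]
      exact fun e => h2 (eq_ng_iff.2 e.symm)
    · rw [pos_succ_fold hp]

/-- A decrease of the position relative to a root comes from a negative crossing. -/
theorem negCrossingOn_of_lt (hθ : IsHighestRoot b θ)
    (h : lvl b (p.pos θ (l + 1)) i < lvl b (p.pos θ l) i) :
    p.NegCrossingOn θ l i (-lvl b (p.pos θ l) i) ∧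
      lvl b (p.pos θ (l + 1)) i = lvl b (p.pos θ l) i - 1 := by
  cases hp : p.steps[l]? with
  | none => rw [pos_succ_none hp] at h; omega
  | some st =>
    obtain ⟨s, _ | _⟩ := st
    · have hx := pos_mem (θ := θ) p l
      rw [pos_succ_cross hp] at h ⊢
      obtain ⟨h1, h2⟩ := eq_wall (a := i) (s := s) (k := -lvl b (p.pos θ l) i) hθ hx
        (by omega) (by omega)
      refine ⟨(negCrossingOn_iff hθ).2 ⟨s, hp, h1, h2⟩, ?_⟩
      have h3 := lvl_mul_gen_wallRoot hθ hx s
      rw [← h1, ← h2] at h3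
      omega
    · rw [pos_succ_fold hp] at h; omega

theorem NegCrossingOn.lvl_eq (hθ : IsHighestRoot b θ) (h : p.NegCrossingOn θ k i j) :
    lvl b (p.pos θ k) i = -j ∧ lvl b (p.pos θ (k + 1)) i = -j - 1 := by
  obtain ⟨s, hs, rfl, rfl⟩ := (negCrossingOn_iff hθ).1 h
  rw [pos_succ_cross hs]
  exact ⟨lvl_wallRoot hθ (pos_mem p k) s, lvl_mul_gen_wallRoot hθ (pos_mem p k) s⟩

/-- A discrete intermediate value argument: the level starts at 0 and falls in unit steps, and the
step from −(n−1) to −n crosses the hyperplane with δ-coefficient n − 1. -/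
theorem exists_negCrossingOn (hθ : IsHighestRoot b θ) (hi : b.IsPos i) {n : ℤ} (hn : 1 ≤ n)
    (h : lvl b (p.pos θ l) i ≤ -n) : ∃ k, p.NegCrossingOn θ k i (n - 1) := by
  induction l with
  | zero => rw [pos_zero, lvl_one_of_isPos hi] at h; omega
  | succ l ih =>
    by_cases h1 : lvl b (p.pos θ l) i ≤ -n
    · exact ih h1
    · obtain ⟨h2, h3⟩ := negCrossingOn_of_lt (p := p) (l := l) (i := i) hθ (by omega)
      refine ⟨l, ?_⟩
      rwa [show n - 1 = -lvl b (p.pos θ l) i by omega]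

theorem exists_isCritical (hθ : IsHighestRoot b θ) (h : p.NegCrossingOn θ k i j) :
    ∃ d : ℕ × ℤ, p.IsCritical θ i d.1 d.2 := by
  have hfin : {j' : ℤ | ∃ k', p.NegCrossingOn θ k' i j'}.Finite := by
    refine Set.Finite.subset ((Finset.range p.steps.length).image
      fun k => -lvl b (p.pos θ k) i).finite_toSet ?_
    rintro j' ⟨k', hk'⟩
    obtain ⟨s, hs, -, -⟩ := (negCrossingOn_iff hθ).1 hk'
    rw [Finset.mem_coe, Finset.mem_image]
    refine ⟨k', Finset.mem_range.2 (List.getElem?_eq_some_iff.1 hs).1, ?_⟩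
    rw [(hk'.lvl_eq hθ).1, neg_neg]
  obtain ⟨j₀, hj₀, hmax⟩ := Set.exists_max_image _ id hfin ⟨j, k, h⟩
  exact ⟨(sInf {k' | p.NegCrossingOn θ k' i j₀}, j₀), ⟨hj₀, fun j' hj' => hmax j' hj'⟩,
    Nat.sInf_mem hj₀, fun k' hk' => Nat.sInf_le hk'⟩

/-- Step `l` is one at which the part of the walk reflected by the root operator may end. -/
def IsReturnStep (θ : ι) (p : Walk b) (i : ι) (j : ℤ) (l : ℕ) : Prop :=
  p.PosFoldOn θ l i (j + 1) ∨ p.PosCrossingOn θ l i j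

/-- The alcove lies between H_γ and H_{γ+δ}. A negative crossing of H_{γ+δ} contradicts the
maximality of j, a fold on H_γ would not be positive, and the remaining contacts with either
hyperplane are returns. -/
theorem IsCritical.wallRoot_ne (hθ : IsHighestRoot b θ) (hi : b.IsPos i)
    (hp : p.PositivelyFolded θ) (h : p.IsCritical θ i c j) (hl : lvl b (p.pos θ l) i = -j - 1)
    (hr : ¬ p.IsReturnStep θ i j l) {t : Option b.support} {mv : Move}
    (hst : p.steps[l]? = some (t, mv)) :
    wallRoot b θ (p.pos θ l) t ≠ i ∧ wallRoot b θ (p.pos θ l) t ≠ ng Φ i := by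
  have hx := pos_mem (θ := θ) p l
  have hw := lvl_wallRoot hθ hx t
  rw [positivelyFolded_iff hθ] at hp
  constructor
  · intro e
    rw [e, hl] at hw
    cases mv with
    | cross =>
      have h1 : p.NegCrossingOn θ l i (j + 1) :=
        (negCrossingOn_iff hθ).2 ⟨t, hst, e.symm, by omega⟩
      have := h.1.2 ⟨l, h1⟩
      omega
    | fold => exact hr (Or.inl ((posFoldOn_iff hθ).2 ⟨t, hst, e.symm, by omega⟩))
  · intro e
    rw [e, lvl_ng hx, hl] at hw
    cases mv with
    | cross =>
      exact hr (Or.inr ((posCrossingOn_iff hθ).2 ⟨t, hst, by rw [e, ng_ng], by omega⟩))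
    | fold =>
      have := hp l t hst
      rw [e, isPos_ng] at this
      exact this hi

theorem IsCritical.lvl_eq (hθ : IsHighestRoot b θ) (hi : b.IsPos i) (hp : p.PositivelyFolded θ)
    (h : p.IsCritical θ i c j) (hl : c + 1 ≤ l)
    (hr : ∀ l', c < l' → l' < l → ¬ p.IsReturnStep θ i j l') :
    lvl b (p.pos θ l) i = -j - 1 := by
  induction l, hl using Nat.le_induction with
  | base => exact (NegCrossingOn.lvl_eq hθ h.2.1).2
  | succ l hl ih =>
    have ih := ih fun l' h1 h2 => hr l' h1 (by omega)
    rw [lvl_pos_succ_of_ne hθ i fun t mv hst =>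
      h.wallRoot_ne hθ hi hp ih (hr l (by omega) (by omega)) hst, ih]

/-! ### The effect of a root operator -/

/-- The steps of `q` compare with those of `p` at `l` as for a root operator with critical
crossing `c`. -/
def StepOK (θ : ι) (p q : Walk b) (c l : ℕ) : Prop :=
  (q.IsNegCross θ l ↔ p.IsNegCross θ l ∧ l ≠ c) ∧
    ∀ t, q.steps[l]? = some (t, .fold) → b.IsPos (wallRoot b θ (q.pos θ l) t)

theorem stepOK_of_same (hθ : IsHighestRoot b θ) (hp : p.PositivelyFolded θ)
    (hst : q.steps[l]? = p.steps[l]?) (hlc : l ≠ c)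
    (h : ∀ t mv, p.steps[l]? = some (t, mv) →
      (b.IsPos (wallRoot b θ (q.pos θ l) t) ↔ b.IsPos (wallRoot b θ (p.pos θ l) t))) :
    StepOK θ p q c l := by
  rw [positivelyFolded_iff hθ] at hp
  refine ⟨⟨?_, ?_⟩, ?_⟩
  · rintro ⟨t, ht, hpos⟩
    rw [hst] at ht
    exact ⟨⟨t, ht, (h t _ ht).1 hpos⟩, hlc⟩
  · rintro ⟨⟨t, ht, hpos⟩, -⟩
    exact ⟨t, hst.trans ht, (h t _ ht).2 hpos⟩
  · intro t ht
    rw [hst] at ht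
    exact (h t _ ht).2 (hp l t ht)

theorem stepOK_of_fold_cross (hp : p.steps[l]? = some (t, .fold))
    (hq : q.steps[l]? = some (t, .cross)) (h : ¬ b.IsPos (wallRoot b θ (q.pos θ l) t)) :
    StepOK θ p q c l := by
  refine ⟨⟨?_, ?_⟩, ?_⟩
  · rintro ⟨t', ht, hpos⟩
    rw [hq] at ht
    obtain rfl : t = t' := by simpa using ht
    exact absurd hpos h
  · rintro ⟨⟨t', ht, -⟩, -⟩
    rw [hp] at ht
    simp at ht
  · intro t' ht
    rw [hq] at ht
    simp at ht

theorem stepOK_of_cross_fold (hp : p.steps[l]? = some (t, .cross))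
    (hq : q.steps[l]? = some (t, .fold)) (h : b.IsPos (wallRoot b θ (q.pos θ l) t))
    (h' : l = c ∨ ¬ b.IsPos (wallRoot b θ (p.pos θ l) t)) :
    StepOK θ p q c l := by
  refine ⟨⟨?_, ?_⟩, ?_⟩
  · rintro ⟨t', ht, -⟩
    rw [hq] at ht
    simp at ht
  · rintro ⟨⟨t', ht, hpos⟩, hlc⟩
    rw [hp] at ht
    obtain rfl : t = t' := by simpa using ht
    rcases h' with h' | h'
    · exact absurd h' hlc
    · exact absurd hpos h'
  · intro t' ht
    rw [hq] at ht
    obtain rfl : t = t' := by simpa using ht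
    exact h

theorem wallRoot_affRefl_mul {x : N ≃ᵃ[ℝ] N} (hx : x ∈ rootAut Φ) (i : ι) (j : ℤ)
    (t : Option b.support) :
    wallRoot b θ (affRefl Φ i j * x) t = Φ.reflectionPerm i (wallRoot b θ x t) := by
  rw [wallRoot_mul (affRefl_mem i j) hx, affRefl_inv, pull_affRefl]

/-- The properties of the walk `q` obtained from `p` by a root operator with critical crossing `c`
on `H_{α_i + jδ}`. -/
structure IsRaised (θ : ι) (p q : Walk b) (i : ι) (c : ℕ) (j : ℤ) : Prop where
  critical : p.IsCritical θ i c j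
  map_fst : q.steps.map Prod.fst = p.steps.map Prod.fst
  sheet : q.sheet = p.sheet
  pos_critical : q.pos θ c = p.pos θ c
  stepOK : ∀ l, StepOK θ p q c l
  pos_end : ∃ g : N ≃ᵃ[ℝ] N, q.pos θ q.steps.length = g * p.pos θ p.steps.length ∧
    (g = 1 ∨ g = trans (Φ.coroot i) ∨
      (g = affRefl Φ i j ∧ lvl b (p.pos θ p.steps.length) i = -j - 1))

/-- Up to the return the walk keeps to a strip and meets no wall of direction ±α_i. Reflecting in
H_γ acts on the wall roots by s_i, which preserves the signs of all roots other than ±α_i. -/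
theorem IsCritical.toggleAt_spec (hθ : IsHighestRoot b θ) (hi : i ∈ b.support)
    (hp : p.PositivelyFolded θ) (h : p.IsCritical θ i c j) (hst : ∀ l < k, l ≠ c →
      q.steps[l]? = p.steps[l]?) (hc : q.steps[c]? = (p.toggleAt c).steps[c]?) (hck : c < k)
    (hr : ∀ l', c < l' → l' < k → ¬ p.IsReturnStep θ i j l') :
    (∀ l ≤ c, q.pos θ l = p.pos θ l) ∧
      (∀ l, c < l → l ≤ k → q.pos θ l = affRefl Φ i j * p.pos θ l) ∧
      ∀ l < k, StepOK θ p q c l := by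
  have hpos := RootPairing.Base.isPos_of_mem_support hi
  obtain ⟨s, hs, hwr, hwl⟩ := (negCrossingOn_iff hθ).1 h.2.1
  rw [toggleAt_self hs, Move.toggle] at hc
  have h1 : ∀ l ≤ c, q.pos θ l = p.pos θ l := fun l hl =>
    pos_eq_of_steps_eq (k := c) (fun l' hl' => hst l' (by omega) (by omega)) hl
  have h2 : ∀ l, c < l → l ≤ k → q.pos θ l = affRefl Φ i j * p.pos θ l := by
    intro l hl hlk
    refine pos_eq_mul_of_steps_eq (k := c + 1) ?_
      (fun l' h3 h4 => hst l' (by omega) (by omega)) hl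
    rw [pos_succ_fold hc, pos_succ_cross hs, mul_gen (pos_mem p c), ← hwr, ← hwl,
      affRefl_mul_cancel_left, h1 c le_rfl]
  refine ⟨h1, h2, fun l hl => ?_⟩
  rcases lt_trichotomy l c with hlc | rfl | hlc
  · exact stepOK_of_same hθ hp (hst l hl hlc.ne) hlc.ne fun t mv _ => by rw [h1 l hlc.le]
  · refine stepOK_of_cross_fold hs hc ?_ (Or.inl rfl)
    rw [h1 l le_rfl, ← hwr]
    exact hpos
  · refine stepOK_of_same hθ hp (hst l hl hlc.ne') hlc.ne' fun t mv ht => ?_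
    have h3 := h.lvl_eq hθ hpos hp (l := l) hlc fun l' h4 h5 => hr l' h4 (by omega)
    obtain ⟨h4, h5⟩ := h.wallRoot_ne hθ hpos hp h3 (hr l hlc hl) ht
    rw [h2 l hlc hl.le, wallRoot_affRefl_mul (pos_mem p l)]
    exact isPos_reflectionPerm_simple hi h4 h5

/-- Explains the return at a fold on H_{γ+δ}: the pending reflection in H_γ combines with the
crossing that replaces the fold. -/
theorem affRefl_mul_affRefl_succ (i : ι) (j : ℤ) :
    affRefl Φ i j * affRefl Φ i (j + 1) = trans (Φ.coroot i) := by
  ext v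
  rw [mul_apply, affRefl_apply', affRefl_apply', map_sub, map_smul, trans_apply,
    show ev Φ i (Φ.coroot i) = 2 from Φ.root_coroot_two i]
  simp only [smul_eq_mul]
  push_cast
  module

theorem toggleAt_length (p : Walk b) (k : ℕ) : (p.toggleAt k).steps.length = p.steps.length := by
  simp [toggleAt]

/-- The root operator applies as soon as there is a critical crossing. -/
theorem exists_isRaised (hθ : IsHighestRoot b θ) (hi : i ∈ b.support) (hp : p.PositivelyFolded θ)
    (h : ∃ d : ℕ × ℤ, p.IsCritical θ i d.1 d.2) :
    ∃ q c j, p.rootOp θ i = some q ∧ IsRaised θ p q i c j := by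
  have hpos := RootPairing.Base.isPos_of_mem_support hi
  have hcrit := h.choose_spec
  rw [rootOp, dif_pos h]
  generalize h.choose = d at *
  obtain ⟨c, j⟩ := d
  dsimp only at hcrit ⊢
  have hcn : c < p.steps.length := by
    obtain ⟨s, hs, -, -⟩ := (negCrossingOn_iff hθ).1 hcrit.2.1
    exact (List.getElem?_eq_some_iff.1 hs).1
  by_cases hr : ∃ k', p.IsReturn θ i c j k'
  · rw [dif_pos hr]
    refine ⟨_, c, j, rfl, ?_⟩
    have hret := hr.choose_spec
    generalize hr.choose = r at *
    set q := (p.toggleAt c).toggleAt r with hq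
    obtain ⟨⟨hcr, hret⟩, hleast⟩ := hret
    have hno : ∀ l', c < l' → l' < r → ¬ p.IsReturnStep θ i j l' := fun l' h1 h2 h3 =>
      absurd (hleast ⟨h1, h3⟩) (not_le.2 h2)
    have hsame : ∀ l, l ≠ c → l ≠ r → q.steps[l]? = p.steps[l]? := fun l h1 h2 => by
      rw [hq, toggleAt_of_ne h2.symm, toggleAt_of_ne h1.symm]
    obtain ⟨h1, h2, h3⟩ := hcrit.toggleAt_spec (q := q) (k := r) hθ hi hp
      (fun l hl hlc => hsame l hlc hl.ne) (by rw [hq, toggleAt_of_ne (by omega)]) hcr hno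
    have hqr := h2 r hcr le_rfl
    have hx := pos_mem (θ := θ) p r
    -- In both kinds of return the rest of the walk is moved by an element g with trivial linear
    -- part, so its wall roots do not change.
    have hgoal : ∀ g : N ≃ᵃ[ℝ] N, g ∈ rootAut Φ → (∀ a, pull Φ g⁻¹ a = a) →
        q.pos θ (r + 1) = g * p.pos θ (r + 1) → StepOK θ p q c r →
        r < p.steps.length → (g = 1 ∨ g = trans (Φ.coroot i)) → IsRaised θ p q i c j := by
      intro g hg hpull hgr hok hrn hgc
      have hafter : ∀ l, r + 1 ≤ l → q.pos θ l = g * p.pos θ l := fun l hl =>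
        pos_eq_mul_of_steps_eq hgr (fun l' h4 _ => hsame l' (by omega) (by omega)) hl
      have hlen : q.steps.length = p.steps.length := by
        rw [hq, toggleAt_length, toggleAt_length]
      refine ⟨hcrit, by rw [hq, toggleAt_map_fst, toggleAt_map_fst], rfl, h1 c le_rfl,
        fun l => ?_, g, by rw [hlen]; exact hafter _ hrn, ?_⟩
      · rcases lt_trichotomy l r with hlr | rfl | hlr
        · exact h3 l hlr
        · exact hok
        · refine stepOK_of_same hθ hp (hsame l (by omega) hlr.ne') (by omega) fun t mv _ => ?_
          rw [hafter l hlr, wallRoot_mul hg (pos_mem p l), hpull]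
      · rcases hgc with hgc | hgc
        · exact Or.inl hgc
        · exact Or.inr (Or.inl hgc)
    rcases hret with hret | hret
    · obtain ⟨t, ht, hwr, hwl⟩ := (posFoldOn_iff hθ).1 hret
      have hqt : q.steps[r]? = some (t, .cross) :=
        toggleAt_self ((toggleAt_of_ne (by omega)).trans ht)
      have htr := coroot_trans_mem (Φ := Φ) i
      refine hgoal (trans (Φ.coroot i)) htr (fun a => ?_) ?_ ?_
        (List.getElem?_eq_some_iff.1 ht).1 (Or.inr rfl)
      · have := pull_pull_inv htr a
        rwa [pull_trans htr] at this
      · rw [pos_succ_cross hqt, pos_succ_fold ht, hqr, mul_assoc, mul_gen hx, ← hwr, ← hwl,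
          ← mul_assoc, affRefl_mul_affRefl_succ]
      · refine stepOK_of_fold_cross ht hqt ?_
        rw [hqr, wallRoot_affRefl_mul hx, ← hwr]
        change ¬ b.IsPos (ng Φ i)
        rw [isPos_ng, not_not]
        exact hpos
    · obtain ⟨t, ht, hwr, hwl⟩ := (posCrossingOn_iff hθ).1 hret
      have hqt : q.steps[r]? = some (t, .fold) :=
        toggleAt_self ((toggleAt_of_ne (by omega)).trans ht)
      have hwr' : wallRoot b θ (p.pos θ r) t = ng Φ i := eq_ng_iff.2 hwr.symm
      refine hgoal 1 (one_mem _) (fun a => by rw [inv_one, pull_one]) ?_ ?_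
        (List.getElem?_eq_some_iff.1 ht).1 (Or.inl rfl)
      · rw [pos_succ_fold hqt, pos_succ_cross ht, hqr, mul_gen hx, hwr',
          show wallLevel b θ (p.pos θ r) t = -j by omega, affRefl_ng, one_mul]
      · refine stepOK_of_cross_fold ht hqt ?_ (Or.inr ?_)
        · rw [hqr, wallRoot_affRefl_mul hx, hwr', reflectionPerm_ng]
          change b.IsPos (ng Φ (ng Φ i))
          rwa [ng_ng]
        · rw [hwr', isPos_ng, not_not]
          exact hpos
  · rw [dif_neg hr]
    refine ⟨_, c, j, rfl, ?_⟩
    -- Absence of a first return step means absence of any, by well-ordering, so the reflected part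
    -- extends to the end of the walk.
    have hno : ∀ l', c < l' → ¬ p.IsReturnStep θ i j l' := by
      intro l' h1 h2
      have hne : {l : ℕ | c < l ∧ (p.PosFoldOn θ l i (j + 1) ∨ p.PosCrossingOn θ l i j)}.Nonempty :=
        ⟨l', h1, h2⟩
      exact hr ⟨_, Nat.sInf_mem hne, fun k' hk' => Nat.sInf_le hk'⟩
    have key : ∀ k, c < k → _ := fun k hck => hcrit.toggleAt_spec (q := p.toggleAt c) (k := k) hθ hi
      hp (fun l _ hlc => toggleAt_of_ne hlc.symm) rfl hck fun l' h1 _ => hno l' h1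
    refine ⟨hcrit, toggleAt_map_fst _ _, rfl, (key (c + 1) (by omega)).1 c le_rfl,
      fun l => (key (max l c + 1) (by omega)).2.2 l (by omega), affRefl Φ i j, ?_,
      Or.inr (Or.inr ⟨rfl, ?_⟩)⟩
    · rw [toggleAt_length]
      exact (key _ hcn).2.1 _ hcn le_rfl
    · exact hcrit.lvl_eq hθ hpos hp hcn fun l' h1 _ => hno l' h1

theorem IsRaised.length_eq (h : IsRaised θ p q i c j) : q.steps.length = p.steps.length := by
  have := congrArg List.length h.map_fst
  simpa using this

theorem IsRaised.positivelyFolded (hθ : IsHighestRoot b θ) (h : IsRaised θ p q i c j) :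
    q.PositivelyFolded θ :=
  (positivelyFolded_iff hθ).2 fun k s hs => (h.stepOK k).2 s hs

/-- The length is unchanged and the critical crossing is the only negative crossing lost; no new one
appears. -/
theorem IsRaised.dim_eq (hθ : IsHighestRoot b θ) (hi : i ∈ b.support)
    (h : IsRaised θ p q i c j) : q.dim θ = p.dim θ + 1 := by
  classical
  obtain ⟨s, hs, hwr, -⟩ := (negCrossingOn_iff hθ).1 h.critical.2.1
  have hcn : c ∈ Finset.range p.steps.length :=
    Finset.mem_range.2 (List.getElem?_eq_some_iff.1 hs).1
  have hpc : p.IsNegCross θ c := ⟨s, hs, hwr ▸ RootPairing.Base.isPos_of_mem_support hi⟩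
  have hqc : ¬ q.IsNegCross θ c := fun hq => ((h.stepOK c).1.1 hq).2 rfl
  have h1 := dim_add_negCross hθ p
  have h2 := dim_add_negCross hθ q
  rw [h.length_eq] at h2
  rw [← Finset.add_sum_erase _ _ hcn] at h1 h2
  rw [if_pos hpc] at h1
  rw [if_neg hqc] at h2
  have h3 : ∑ k ∈ (Finset.range p.steps.length).erase c, (if q.IsNegCross θ k then 1 else 0) =
      ∑ k ∈ (Finset.range p.steps.length).erase c, (if p.IsNegCross θ k then 1 else 0) := by
    refine Finset.sum_congr rfl fun k hk => ?_
    have hkc := (Finset.mem_erase.1 hk).1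
    have : q.IsNegCross θ k ↔ p.IsNegCross θ k := by
      rw [(h.stepOK k).1]
      exact and_iff_left hkc
    simp only [this]
  rw [h3] at h2
  omega

/-- A root operator raises the end of a walk by a simple coroot or leaves it fixed. -/
theorem IsRaised.endAlcove (hθ : IsHighestRoot b θ) (h : IsRaised θ p q i c j)
    (hγ : p.sheet ∈ lengthZero b θ) {ν : N} {w : N ≃ᵃ[ℝ] N} (hw : w ∈ weyl Φ)
    (hend : p.endAlcove θ = trans ν * w) :
    ∃ ν', (ν' = ν ∨ ν' = ν + Φ.coroot i) ∧ ∃ w' ∈ weyl Φ, q.endAlcove θ = trans ν' * w' := by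
  obtain ⟨g, hg, hcases⟩ := h.pos_end
  have hq : q.endAlcove θ = g * (trans ν * w) := by
    rw [Walk.endAlcove, h.sheet, hg, mul_assoc, ← hend, Walk.endAlcove]
  rcases hcases with rfl | rfl | ⟨rfl, hlvl⟩
  · exact ⟨ν, Or.inl rfl, w, hw, by rw [hq, one_mul]⟩
  · refine ⟨_, Or.inr rfl, w, hw, ?_⟩
    rw [hq]
    ext v
    simp only [mul_apply, trans_apply]
    abel
  · have hmem : p.endAlcove θ ∈ rootAut Φ := mul_mem (pos_mem p _) (lengthZero_mem hγ)
    have hl := lvl_mul_lengthZero (b := b) hθ (pos_mem (θ := θ) p p.steps.length) hγ i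
    rw [hlvl] at hl
    change lvl b (p.endAlcove θ) i = _ at hl
    have hsh := shift_eq hmem i
    rw [hend, mul_apply, weyl_apply_zero hw, trans_apply, add_zero, ← hend] at hsh
    have h1 := lvl_le_shift (b := b) (p.endAlcove θ) i
    have h2 := shift_le_lvl_add_one (b := b) (p.endAlcove θ) i
    refine ⟨affRefl Φ i j ν, ?_, affRefl Φ i 0 * w, mul_mem (affRefl_mem_weyl i) hw, ?_⟩
    · rw [affRefl_apply', ← hsh, ← Int.cast_add]
      -- The end alcove lies in the strip of levels −j − 1, so its image of the origin is on one of
      -- the two bounding hyperplanes: H_γ fixes it, or reflection adds one coroot.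
      rcases (by omega : shift Φ (p.endAlcove θ) i + j = 0 ∨ shift Φ (p.endAlcove θ) i + j = -1)
        with h3 | h3
      · left; rw [h3]; simp
      · right; rw [h3]; simp
    · rw [hq]
      ext v
      simp only [mul_apply, trans_apply, affRefl_apply', map_add, Int.cast_zero]
      module

end Walk

end AlcoveWalks

end

/-! ### Extremal dimension: uniqueness at w₀λ and the strings of root operators. -/

noncomputable section

namespace AlcoveWalks

variable {ι M N : Type*} [Fintype ι] [AddCommGroup M] [Module ℝ M] [AddCommGroup N] [Module ℝ N]
  {Φ : RootPairing ι ℝ M N} [Φ.IsRootSystem] [Φ.IsCrystallographic] [Φ.IsReduced]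
  {b : Φ.Base} {θ : ι}

/-! ### Values of `ρ` -/

/-- The reflection s_i permutes the positive roots other than α_i and negates their values at α_i^∨,
so only α_i contributes to 2ρ. -/
theorem rho_coroot {i : ι} (hi : i ∈ b.support) : Φ.toLinearMap (rho b) (Φ.coroot i) = 1 := by
  classical
  have hpos := RootPairing.Base.isPos_of_mem_support hi
  have h1 := two_mul_rho b (Φ.coroot i)
  have h2 := sum_absRoot_pull (b := b) (affRefl_mem (Φ := Φ) i 0) fun a => ev Φ a (Φ.coroot i)
  have h3 : ∑ a ∈ (posRoots b).erase i, ev Φ (absRoot b (pull Φ (affRefl Φ i 0) a)) (Φ.coroot i) =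
      -∑ a ∈ (posRoots b).erase i, ev Φ a (Φ.coroot i) := by
    rw [← Finset.sum_neg_distrib]
    refine Finset.sum_congr rfl fun a ha => ?_
    rw [Finset.mem_erase, mem_posRoots] at ha
    have hne : a ≠ ng Φ i := by
      rintro rfl
      exact (isPos_ng b i).1 ha.2 hpos
    rw [pull_affRefl, absRoot_of_isPos ((isPos_reflectionPerm_simple hi ha.1 hne).2 ha.2),
      ev_reflectionPerm, ev_coroot, ev_coroot, pr_self]
    push_cast
    ring
  have h4 : absRoot b (pull Φ (affRefl Φ i 0) i) = i := by
    rw [pull_affRefl]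
    change absRoot b (ng Φ i) = i
    rw [absRoot_of_not_isPos (by rw [isPos_ng, not_not]; exact hpos), ng_ng]
  rw [← Finset.add_sum_erase _ _ (mem_posRoots.2 hpos),
    ← Finset.add_sum_erase _ (fun a => ev Φ a (Φ.coroot i)) (mem_posRoots.2 hpos), h4, h3] at h2
  rw [← Finset.add_sum_erase _ _ (mem_posRoots.2 hpos), ev_coroot, pr_self] at h1
  push_cast at h1
  linarith

theorem rho_longest (hθ : IsHighestRoot b θ) {w₀ : N ≃ᵃ[ℝ] N} (hw₀ : IsLongest b θ w₀) (v : N) :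
    Φ.toLinearMap (rho b) (w₀ v) = -Φ.toLinearMap (rho b) v := by
  have h1 := two_mul_rho b (w₀ v)
  have h2 := two_mul_rho b v
  rw [← sum_absRoot_pull (weyl_le hw₀.1) fun a => ev Φ a v] at h2
  have h3 : ∑ a ∈ posRoots b, ev Φ (absRoot b (pull Φ w₀ a)) v =
      -∑ a ∈ posRoots b, ev Φ a (w₀ v) := by
    rw [← Finset.sum_neg_distrib]
    refine Finset.sum_congr rfl fun a ha => ?_
    rw [absRoot_of_not_isPos (hw₀.not_isPos_pull hθ (mem_posRoots.1 ha)), ev_ng, ev_weyl hw₀.1]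
  linarith

/-! ### Straight walks -/

namespace Walk

/-- The walk without folds of a given type. -/
def straight (word : List (Option b.support)) (γ : N ≃ᵃ[ℝ] N) : Walk b where
  steps := word.map fun s => (s, .cross)
  sheet := γ

theorem straight_map_fst (word : List (Option b.support)) (γ : N ≃ᵃ[ℝ] N) :
    (straight word γ).steps.map Prod.fst = word := by
  simp [straight, Function.comp_def]

theorem straight_endAlcove (word : List (Option b.support)) (γ : N ≃ᵃ[ℝ] N) :
    (straight word γ).endAlcove θ = (word.map (gen b θ)).prod * γ := by
  rw [endAlcove, pos, List.take_length, straight, List.map_map]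
  rfl

theorem straight_positivelyFolded (word : List (Option b.support)) (γ : N ≃ᵃ[ℝ] N) :
    (straight word γ).PositivelyFolded θ := by
  intro k s hs
  simp [straight] at hs

theorem eq_straight_of_dim_eq_zero (hθ : IsHighestRoot b θ) {p : Walk b} (h : p.dim θ = 0) :
    p = straight (p.steps.map Prod.fst) p.sheet := by
  classical
  have hfold : ∀ k, ¬ p.IsFold k := by
    intro k hk
    rw [dim_eq_sum hθ] at h
    have h1 : ∑ k ∈ Finset.range p.steps.length, (if p.IsFold k then 1 else 0) = 0 := by omega
    have := Finset.sum_eq_zero_iff.1 h1 k (Finset.mem_range.2 hk.lt)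
    rw [if_pos hk] at this
    exact one_ne_zero this
  obtain ⟨steps, sheet⟩ := p
  simp only [straight, mk.injEq, and_true, List.map_map]
  conv_lhs => rw [← List.map_id steps]
  refine List.map_congr_left fun st hst => ?_
  obtain ⟨k, hk⟩ := List.getElem?_of_mem hst
  obtain ⟨s, _ | _⟩ := st
  · rfl
  · exact absurd ⟨s, hk⟩ (hfold k)

end Walk

/-! ### The walks of the given types -/

variable {lam ν : N} {m w γ : N ≃ᵃ[ℝ] N} {mword : List (Option b.support)}
  {uword : (N ≃ᵃ[ℝ] N) → List (Option b.support)} {p q : Walk b}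

theorem trans_mul_apply_zero (hw : w ∈ weyl Φ) (ν : N) : (trans ν * w) 0 = ν := by
  rw [mul_apply, weyl_apply_zero hw, trans_apply, add_zero]

theorem mem_saturatedSet_of_mem_walkSet (hθ : IsHighestRoot b θ) (hlam : IsDominant b lam)
    (hm : IsShortest b lam m w) (hmword : IsReducedExpr b θ mword γ m)
    (huword : ∀ u ∈ minReps b θ lam, IsReducedExpr b θ (uword u) 1 u)
    (hp : p ∈ walkSet b θ lam mword γ uword ν) : ν ∈ saturatedSet b lam := by
  obtain ⟨-, ⟨u, hu, htype, hsheet⟩, w', hw', hend⟩ := hp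
  have hred := isReducedExpr_append hθ hlam hm hu.1 hmword (huword u hu)
  have h0 : (u * m) 0 = u lam := by
    rw [mul_apply, hm.eq, trans_mul_apply_zero hm.mem]
  have := BruhatLE.apply_zero_mem (mul_mem (weyl_le hu.1) (hm.mem_rootAut hlam))
    (Walk.bruhatLE_endAlcove hθ hred htype hsheet)
    (h0 ▸ weyl_apply_mem_saturatedSet hu.1 (dominant_mem_saturatedSet hlam))
  rwa [hend, trans_mul_apply_zero hw'] at this

/-- In the formula for 2 dim the folds are outweighed by the inversions subtracted in `lvlSum`,
leaving the length of the type, at most 2⟨λ,ρ⟩, and 2⟨ν,ρ⟩. -/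
theorem dim_le_of_mem_walkSet (hθ : IsHighestRoot b θ) (hlam : IsDominant b lam)
    (hm : IsShortest b lam m w) (hmword : IsReducedExpr b θ mword γ m)
    (huword : ∀ u ∈ minReps b θ lam, IsReducedExpr b θ (uword u) 1 u)
    (hp : p ∈ walkSet b θ lam mword γ uword ν) :
    (p.dim θ : ℝ) ≤ Φ.toLinearMap (rho b) (lam + ν) := by
  obtain ⟨hfold, ⟨u, hu, htype, hsheet⟩, w', hw', hend⟩ := hp
  have hred := isReducedExpr_append hθ hlam hm hu.1 hmword (huword u hu)
  have hγ : p.sheet ∈ lengthZero b θ := hsheet ▸ hmword.1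
  have hmem : p.endAlcove θ ∈ rootAut Φ := mul_mem (Walk.pos_mem p _) (lengthZero_mem hγ)
  have h1 := Walk.folds_le hθ hred (fun c => isPos_pull_of_lvl_lt hθ hlam hm hu c) hfold htype
    hsheet
  have h2 := lvlSum_eq (b := b) hmem
  have h3 : lvlSum b (p.endAlcove θ) = lvlSum b (p.pos θ p.steps.length) :=
    Finset.sum_congr rfl fun a _ => lvl_mul_lengthZero hθ (Walk.pos_mem p _) hγ a
  have h4 := congrArg (Int.cast (R := ℝ)) (Walk.two_mul_dim hθ p)
  have h5 := len_mul_shortest_le hθ hlam hm hu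
  have h6 : p.steps.length = len b θ (u * m) := by
    rw [← hred.2.2, ← htype, List.length_map]
  rw [h3, hend, trans_mul_apply_zero hw', ← hend] at h2
  rw [h6] at h4 h2
  push_cast at h4
  rw [h2] at h4
  rw [map_add]
  have h7 : (p.folds : ℝ) ≤ (inversions b (p.endAlcove θ)).card := by exact_mod_cast h1
  linarith

/-- The dimension bound at w₀λ is 0, so a walk there has no folds. A straight walk of type u m_λ
ends over uλ, which determines the minimal representative u. -/
theorem existsUnique_mem_walkSet_longest (hθ : IsHighestRoot b θ) {w₀ : N ≃ᵃ[ℝ] N}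
    (hw₀ : IsLongest b θ w₀) (hlam : IsDominant b lam)
    (hm : IsShortest b lam m w) (hmword : IsReducedExpr b θ mword γ m)
    (huword : ∀ u ∈ minReps b θ lam, IsReducedExpr b θ (uword u) 1 u) :
    ∃! a, a ∈ walkSet b θ lam mword γ uword (w₀ lam) := by
  obtain ⟨u, hu, hul⟩ := exists_mem_minReps (b := b) (θ := θ) (lam := lam) hw₀.1
  have hend : ∀ u ∈ minReps b θ lam,
      (Walk.straight (uword u ++ mword) γ).endAlcove θ = trans (u lam) * (u * w) := by
    intro u hu
    rw [Walk.straight_endAlcove, (isReducedExpr_append hθ hlam hm hu.1 hmword (huword u hu)).2.1,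
      hm.eq, ← mul_assoc, weyl_mul_trans hu.1, mul_assoc]
  refine ⟨Walk.straight (uword u ++ mword) γ, ⟨Walk.straight_positivelyFolded _ _,
    ⟨u, hu, Walk.straight_map_fst _ _, rfl⟩, u * w, mul_mem hu.1 hm.mem, ?_⟩, fun p hp => ?_⟩
  · rw [hend u hu, hul]
  · have hdim : p.dim θ = 0 := by
      have := dim_le_of_mem_walkSet hθ hlam hm hmword huword hp
      rw [map_add, rho_longest hθ hw₀, add_neg_cancel] at this
      exact_mod_cast le_antisymm this (Nat.cast_nonneg _)
    obtain ⟨-, ⟨u', hu', htype, hsheet⟩, w', hw', hend'⟩ := hp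
    have hp' := Walk.eq_straight_of_dim_eq_zero hθ hdim
    rw [htype, hsheet] at hp'
    rw [hp', hend u' hu'] at hend'
    have h0 := DFunLike.congr_fun hend' 0
    rw [trans_mul_apply_zero (mul_mem hu'.1 hm.mem), trans_mul_apply_zero hw'] at h0
    rw [hp', minReps_unique hθ hlam hu' hu (h0.trans hul.symm)]

/-! ### Applying the root operators -/

/-- A root operator keeps a walk of maximal dimension maximal and raises its end. -/
theorem exists_rootOp_eq_some (hθ : IsHighestRoot b θ) (hlam : IsDominant b lam)
    (hm : IsShortest b lam m w) (hmword : IsReducedExpr b θ mword γ m)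
    (huword : ∀ u ∈ minReps b θ lam, IsReducedExpr b θ (uword u) 1 u)
    (hp : p ∈ walkSet b θ lam mword γ uword ν)
    (hdim : (p.dim θ : ℝ) = Φ.toLinearMap (rho b) (lam + ν)) {i : ι} (hi : i ∈ b.support) {n : ℕ}
    {l : ℕ} (hl : lvl b (p.pos θ l) i ≤ -(n + 1 : ℤ)) :
    ∃ q ∈ walkSet b θ lam mword γ uword (ν + Φ.coroot i), p.rootOp θ i = some q ∧
      (q.dim θ : ℝ) = Φ.toLinearMap (rho b) (lam + (ν + Φ.coroot i)) ∧
      ∃ l, lvl b (q.pos θ l) i ≤ -(n : ℤ) := by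
  obtain ⟨k, hk⟩ := Walk.exists_negCrossingOn hθ (RootPairing.Base.isPos_of_mem_support hi)
    (by omega) hl
  obtain ⟨q, c, j, hq, hr⟩ := Walk.exists_isRaised hθ hi hp.1 (Walk.exists_isCritical hθ hk)
  obtain ⟨-, ⟨u, hu, htype, hsheet⟩, w', hw', hend⟩ := id hp
  obtain ⟨ν', hν', w'', hw'', hend'⟩ := hr.endAlcove hθ (hsheet ▸ hmword.1) hw' hend
  have hmem : q ∈ walkSet b θ lam mword γ uword ν' :=
    ⟨hr.positivelyFolded hθ, ⟨u, hu, hr.map_fst.trans htype, hr.sheet.trans hsheet⟩, w'', hw'',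
      hend'⟩
  have hqdim : (q.dim θ : ℝ) = Φ.toLinearMap (rho b) (lam + ν) + 1 := by
    rw [hr.dim_eq hθ hi, Nat.cast_add, Nat.cast_one, hdim]
  -- With the end fixed, the increased dimension would exceed the bound of `dim_le_of_mem_walkSet`.
  obtain rfl : ν' = ν + Φ.coroot i := by
    refine hν'.resolve_left ?_
    rintro rfl
    have := dim_le_of_mem_walkSet hθ hlam hm hmword huword hmem
    linarith
  refine ⟨q, hmem, hq, ?_, c, ?_⟩
  · rw [hqdim, ← add_assoc, map_add _ (lam + ν), rho_coroot hi]
  -- The raised walk agrees with p up to the critical crossing, where the level is −j; the crossing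
  -- found above has δ-coefficient n, so j ≥ n.
  · rw [hr.pos_critical, (Walk.NegCrossingOn.lvl_eq hθ hr.critical.2.1).1]
    have := hr.critical.1.2 ⟨k, hk⟩
    omega

theorem exists_rootOpPow_eq_some (hθ : IsHighestRoot b θ) (hlam : IsDominant b lam)
    (hm : IsShortest b lam m w) (hmword : IsReducedExpr b θ mword γ m)
    (huword : ∀ u ∈ minReps b θ lam, IsReducedExpr b θ (uword u) 1 u)
    {i : ι} (hi : i ∈ b.support) (n : ℕ) {p : Walk b} {ν : N}
    (hp : p ∈ walkSet b θ lam mword γ uword ν)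
    (hdim : (p.dim θ : ℝ) = Φ.toLinearMap (rho b) (lam + ν))
    {l : ℕ} (hl : lvl b (p.pos θ l) i ≤ -(n : ℤ)) :
    ∃ q ∈ walkSet b θ lam mword γ uword (ν + n • Φ.coroot i),
      rootOpPow θ i n (some p) = some q ∧
      (q.dim θ : ℝ) = Φ.toLinearMap (rho b) (lam + (ν + n • Φ.coroot i)) := by
  induction n generalizing p ν l with
  | zero => exact ⟨p, by simpa using hp, rfl, by simpa using hdim⟩
  | succ n ih =>
    obtain ⟨q, hq, hop, hqdim, l', hl'⟩ := exists_rootOp_eq_some hθ hlam hm hmword huword hp hdim hi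
      (n := n) (l := l) (by push_cast at hl; exact hl)
    obtain ⟨r, hr, hpow, hrdim⟩ := ih hq hqdim hl'
    rw [show ν + Φ.coroot i + n • Φ.coroot i = ν + (n + 1) • Φ.coroot i by
      rw [succ_nsmul]; abel] at hr hrdim
    refine ⟨r, hr, ?_, hrdim⟩
    rw [rootOpPow, Function.iterate_succ_apply, Option.bind_some, hop]
    exact hpow

/-- Climbs back from the end of the descent, one maximal string at a time. The maximal step is long
enough in absolute depth for every application of the root operator to be defined. -/
theorem exists_stringWalk_eq_some (hθ : IsHighestRoot b θ) (hlam : IsDominant b lam)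
    (hm : IsShortest b lam m w) (hmword : IsReducedExpr b θ mword γ m)
    (huword : ∀ u ∈ minReps b θ lam, IsReducedExpr b θ (uword u) 1 u)
    {κ : N} (hp : p ∈ walkSet b θ lam mword γ uword κ)
    (hdim : (p.dim θ : ℝ) = Φ.toLinearMap (rho b) (lam + κ)) (word : List b.support) {μ : N}
    (hμ : μ ∈ saturatedSet b lam) (hdesc : descend b lam μ word = κ) :
    ∃ q ∈ walkSet b θ lam mword γ uword μ, stringWalk θ lam p μ word = some q ∧
      (q.dim θ : ℝ) = Φ.toLinearMap (rho b) (lam + μ) := by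
  induction word generalizing μ with
  | nil =>
    obtain rfl : μ = κ := hdesc
    exact ⟨p, hp, rfl, hdim⟩
  | cons i word ih =>
    rw [descend] at hdesc
    rw [stringWalk]
    obtain ⟨q, hq, hstr, hqdim⟩ := ih (maxStep_mem i.2 hμ) hdesc
    have hmax := ev_le_maxStep hlam i.2 hμ
    generalize maxStep b lam μ i = n at *
    rw [hstr]
    -- The end μ − nα_i^∨ has value ⟨μ,α_i⟩ − 2n ≤ −n at α_i, because ⟨μ,α_i⟩ ≤ n.
    have hl : lvl b (q.pos θ q.steps.length) i ≤ -(n : ℤ) := by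
      obtain ⟨-, ⟨u, -, -, hsheet⟩, w', hw', hend⟩ := hq
      have hγ : q.sheet ∈ lengthZero b θ := hsheet ▸ hmword.1
      rw [← lvl_mul_lengthZero hθ (Walk.pos_mem q _) hγ]
      change lvl b (q.endAlcove θ) i ≤ _
      have hmem : q.endAlcove θ ∈ rootAut Φ := mul_mem (Walk.pos_mem q _) (lengthZero_mem hγ)
      refine (lvl_le_shift _ _).trans ?_
      have h1 := shift_eq hmem i
      rw [hend, trans_mul_apply_zero hw', ← hend, map_sub, map_nsmul, ev_coroot, pr_self,
        nsmul_eq_mul] at h1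
      push_cast at h1
      have h2 : (shift Φ (q.endAlcove θ) i : ℝ) ≤ ((-(n : ℤ) : ℤ) : ℝ) := by
        push_cast
        linarith
      exact_mod_cast h2
    have := exists_rootOpPow_eq_some hθ hlam hm hmword huword i.2 n hq hqdim hl
    rwa [sub_add_cancel] at this

end AlcoveWalks

end

/-! ### Assembly of the assertions. -/

theorem theoremC {ι M N : Type*} [Fintype ι] [AddCommGroup M] [Module ℝ M]
    [AddCommGroup N] [Module ℝ N] (Φ : RootPairing ι ℝ M N)
    [Φ.IsRootSystem] [Φ.IsCrystallographic] [Φ.IsReduced] [Φ.IsIrreducible]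
    (b : Φ.Base) (θ : ι) (hθ : AlcoveWalks.IsHighestRoot b θ)
    (w₀ : N ≃ᵃ[ℝ] N) (hw₀ : AlcoveWalks.IsLongest b θ w₀)
    (lam : N) (hlam : AlcoveWalks.IsDominant b lam)
    (m : N ≃ᵃ[ℝ] N) (hm : AlcoveWalks.IsMinimalIn b θ lam m)
    (mword : List (Option b.support)) (γ : N ≃ᵃ[ℝ] N)
    (hmword : AlcoveWalks.IsReducedExpr b θ mword γ m)
    (uword : (N ≃ᵃ[ℝ] N) → List (Option b.support))
    (huword : ∀ u ∈ AlcoveWalks.minReps b θ lam, AlcoveWalks.IsReducedExpr b θ (uword u) 1 u)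
    (μ : N) (hμ : AlcoveWalks.IsCoweight b μ) :
    -- there are no walks unless `μ ∈ Π_λ`
    (μ ∉ AlcoveWalks.saturatedSet b lam →
      AlcoveWalks.walkSet b θ lam mword γ uword μ = ∅) ∧
    -- if `μ ∈ Π_λ` there is a walk of optimal dimension
    (μ ∈ AlcoveWalks.saturatedSet b lam →
      ∃ p ∈ AlcoveWalks.walkSet b θ lam mword γ uword μ,
        (p.dim θ : ℝ) = Φ.toLinearMap (AlcoveWalks.rho b) (lam + μ)) ∧
    -- such a walk arises from the antidominant walk, which is the unique walk ending in
    -- `t_{w₀λ} W₀`, by applying the root operators along any reduced word of `w₀`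
    (∃! a, a ∈ AlcoveWalks.walkSet b θ lam mword γ uword (w₀ lam)) ∧
    (μ ∈ AlcoveWalks.saturatedSet b lam →
      ∀ word : List b.support, AlcoveWalks.IsReducedWord b θ word w₀ →
      ∀ a ∈ AlcoveWalks.walkSet b θ lam mword γ uword (w₀ lam),
        ∃ p ∈ AlcoveWalks.walkSet b θ lam mword γ uword μ,
          AlcoveWalks.stringWalk θ lam a μ word = some p ∧
          (p.dim θ : ℝ) = Φ.toLinearMap (AlcoveWalks.rho b) (lam + μ)) ∧
    -- consequently the set of walks is nonempty exactly for `μ ∈ Π_λ`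
    ((AlcoveWalks.walkSet b θ lam mword γ uword μ).Nonempty ↔
      μ ∈ AlcoveWalks.saturatedSet b lam) := by
  obtain ⟨w, hw⟩ := hm.exists_isShortest hθ hlam
  have hsub : ∀ p ∈ AlcoveWalks.walkSet b θ lam mword γ uword μ,
      μ ∈ AlcoveWalks.saturatedSet b lam := fun p hp =>
    AlcoveWalks.mem_saturatedSet_of_mem_walkSet hθ hlam hw hmword huword hp
  have hunique := AlcoveWalks.existsUnique_mem_walkSet_longest hθ hw₀ hlam hw hmword huword
  have hstring : μ ∈ AlcoveWalks.saturatedSet b lam →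
      ∀ word : List b.support, AlcoveWalks.IsReducedWord b θ word w₀ →
      ∀ a ∈ AlcoveWalks.walkSet b θ lam mword γ uword (w₀ lam),
        ∃ p ∈ AlcoveWalks.walkSet b θ lam mword γ uword μ,
          AlcoveWalks.stringWalk θ lam a μ word = some p ∧
          (p.dim θ : ℝ) = Φ.toLinearMap (AlcoveWalks.rho b) (lam + μ) := by
    intro hμ word hword a ha
    -- The upper bound is zero here, so the antidominant walk attains it and can start the
    -- induction.
    have hdim : (a.dim θ : ℝ) = Φ.toLinearMap (AlcoveWalks.rho b) (lam + w₀ lam) := by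
      have h := AlcoveWalks.dim_le_of_mem_walkSet hθ hlam hw hmword huword ha
      refine le_antisymm h ?_
      rw [map_add, AlcoveWalks.rho_longest hθ hw₀, add_neg_cancel]
      exact Nat.cast_nonneg _
    exact AlcoveWalks.exists_stringWalk_eq_some hθ hlam hw hmword huword ha hdim word hμ
      (AlcoveWalks.descend_longest hθ hw₀ hlam hμ hword)
  have hexists : μ ∈ AlcoveWalks.saturatedSet b lam →
      ∃ p ∈ AlcoveWalks.walkSet b θ lam mword γ uword μ,
        (p.dim θ : ℝ) = Φ.toLinearMap (AlcoveWalks.rho b) (lam + μ) := by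
    intro hμ
    obtain ⟨word, hword⟩ := AlcoveWalks.exists_isReducedWord hθ hw₀.1
    obtain ⟨a, ha, -⟩ := hunique
    obtain ⟨p, hp, -, hdim⟩ := hstring hμ word hword a ha
    exact ⟨p, hp, hdim⟩
  refine ⟨fun hμ => Set.eq_empty_iff_forall_notMem.2 fun p hp => hμ (hsub p hp), hexists, hunique,
    hstring, fun ⟨p, hp⟩ => hsub p hp, fun hμ => ?_⟩
  obtain ⟨p, hp, -⟩ := hexists hμ
  exact ⟨p, hp⟩
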